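/- Let $M$ be a smooth 4-manifold with a smooth metric $g$ of signature $(-,+,+,+)$, and let $\nabla$, $R$, $r=\operatorname{tr}R$ and $W$ be its Levi-Civita connection, Ricci tensor ($R_{bd}=R^a{}_{bad}$), scalar curvature and Weyl tensor. For covariant 2-tensors let $(S\cdot T)_{\alpha\beta}=S_\alpha{}^{\lambda}T_{\lambda\beta}$, $S^2=S\cdot S$, let $\operatorname{tr}$ be the metric trace, and put $$N=R-\tfrac14 r\,g,\qquad b=\operatorname{tr}N^2,\quad c=\operatorname{tr}N^3,\quad d=\operatorname{tr}N^4 .$$ Call $g$ spherically symmetric if around every point there are local coordinates $(x^0,x^1,x^2,x^3)$ in which $g=v+e^{2\lambda}\hat h$, where $v$ is a 2-dimensional Lorentzian metric in the variables $(x^0,x^1)$, $\lambda$ is a function of $(x^0,x^1)$ only, and $\hat h$ is a 2-dimensional Riemannian metric in the variables $(x^2,x^3)$ with Gauss curvature equal to one. Suppose that $7b^2\neq 12d$ at every point of $M$. Then $g$ is spherically symmetric if and only if there are a smooth function $\nu$ on $M$ and a function $\varphi$ on $M$ such that the following holds at every point. * $\nu=\pm\tfrac12\sqrt b$ (one of the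 two signs) if $b^2=4d$ and $b\ge 0$; otherwise $b(b^2-4d)+4c^2\neq0$ and $$\nu=\frac{c\,(7b^2-12d)}{3\,[\,b(b^2-4d)+4c^2\,]} .$$ * $\varphi$ is a double eigenvalue of the Weyl tensor, i.e. the space of 2-forms $F$ with $\tfrac12 W_{\alpha\beta}{}^{\gamma\delta}F_{\gamma\delta}=\varphi F_{\alpha\beta}$ has real dimension at least $4$ (equivalently, complex dimension at least $2$ in the 3-dimensional space of self-dual 2-forms). * With $P=N^2+2\nu N+(3\nu^2-\tfrac b2)\,g$ one has $\operatorname{tr}P\neq0$, and $$h=\frac{2}{\operatorname{tr}P}\,P,\qquad \mu=\nu+\tfrac14 r,\qquad \xi=\nabla\cdot h,\qquad \kappa=-2\varphi-\tfrac16 r+\mu+\tfrac14\,g(\xi,\xi)$$ satisfy 1. $h^2=h$; 2. $h(x,x)\ge0$ for every time-like vector $x$; 3. $2\nabla_\alpha h_{\beta\gamma}=h_{\alpha\beta}\,\xi_\gamma+h_{\alpha\gamma}\,\xi_\beta$ and $d\xi=0$; 4. $\kappa>0$ and $h(d\kappa)=0$. -/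

import Mathlib

open scoped Manifold ContDiff Matrix

noncomputable section

namespace RicciSph

/-! ### Tensor calculus in a coordinate domain

A metric in coordinates is a matrix-valued function on `Fin n → ℝ`; covariant 2-tensors are given by
their matrices of (lower-index) components. All formulas are evaluated only at points of open sets on
which the metric is smooth and non-degenerate. -/

/-- The partial derivative `∂ᵢ f`. -/
def pd {n : ℕ} (i : Fin n) (f : (Fin n → ℝ) → ℝ) (y : Fin n → ℝ) : ℝ :=
  fderiv ℝ f y (Pi.single i 1)

/-- The Christoffel symbols `Γᵏᵢⱼ` of the Levi-Civita connection. -/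
def christoffel {n : ℕ} (G : (Fin n → ℝ) → Matrix (Fin n) (Fin n) ℝ) (y : Fin n → ℝ)
    (k i j : Fin n) : ℝ :=
  (1 / 2) * ∑ l, (G y)⁻¹ k l *
    (pd i (fun z => G z j l) y + pd j (fun z => G z i l) y - pd l (fun z => G z i j) y)

/-- The curvature `Rᵃ_{bcd} = ∂_c Γᵃ_{bd} - ∂_d Γᵃ_{bc} + Γᵃ_{ce} Γᵉ_{bd} - Γᵃ_{de} Γᵉ_{bc}`. -/
def riemannUp {n : ℕ} (G : (Fin n → ℝ) → Matrix (Fin n) (Fin n) ℝ) (y : Fin n → ℝ)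
    (a b c d : Fin n) : ℝ :=
  pd c (fun z => christoffel G z a b d) y - pd d (fun z => christoffel G z a b c) y
    + ∑ e, (christoffel G y a c e * christoffel G y e b d
      - christoffel G y a d e * christoffel G y e b c)

/-- The curvature with all indices lowered, `R_{abcd}`. -/
def riemann {n : ℕ} (G : (Fin n → ℝ) → Matrix (Fin n) (Fin n) ℝ) (y : Fin n → ℝ)
    (a b c d : Fin n) : ℝ :=
  ∑ e, G y a e * riemannUp G y e b c d

/-- The Gauss curvature of a 2-dimensional metric. -/
def gaussCurvature (G : (Fin 2 → ℝ) → Matrix (Fin 2) (Fin 2) ℝ) (y : Fin 2 → ℝ) : ℝ :=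
  riemann G y 0 1 0 1 / (G y).det

/-- The Ricci tensor `R_{bd} = Rᵃ_{bad}`. -/
def ricci {n : ℕ} (G : (Fin n → ℝ) → Matrix (Fin n) (Fin n) ℝ) (y : Fin n → ℝ) :
    Matrix (Fin n) (Fin n) ℝ :=
  Matrix.of fun b d => ∑ a, riemannUp G y a b a d

/-- The metric trace of a covariant 2-tensor. -/
def tr {n : ℕ} (G : (Fin n → ℝ) → Matrix (Fin n) (Fin n) ℝ) (y : Fin n → ℝ)
    (S : Matrix (Fin n) (Fin n) ℝ) : ℝ :=
  ((G y)⁻¹ * S).trace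

/-- The product `(S · T)_{αβ} = S_α^λ T_{λβ}` of covariant 2-tensors. -/
def dot {n : ℕ} (G : (Fin n → ℝ) → Matrix (Fin n) (Fin n) ℝ) (y : Fin n → ℝ)
    (S T : Matrix (Fin n) (Fin n) ℝ) : Matrix (Fin n) (Fin n) ℝ :=
  S * (G y)⁻¹ * T

/-- The scalar curvature `r = tr R`. -/
def scal {n : ℕ} (G : (Fin n → ℝ) → Matrix (Fin n) (Fin n) ℝ) (y : Fin n → ℝ) : ℝ :=
  tr G y (ricci G y)

/-! ### Four-dimensional concomitants -/

/-- A metric on a coordinate domain of dimension four, by components. -/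
abbrev Field4 := (Fin 4 → ℝ) → Matrix (Fin 4) (Fin 4) ℝ

/-- The Weyl tensor `W_{abcd}`. -/
def weyl (G : Field4) (y : Fin 4 → ℝ) (a b c d : Fin 4) : ℝ :=
  riemann G y a b c d
    - (1 / 2) * (G y a c * ricci G y b d - G y a d * ricci G y b c
        + G y b d * ricci G y a c - G y b c * ricci G y a d)
    + (scal G y / 6) * (G y a c * G y b d - G y a d * G y b c)

/-- The Weyl tensor as an endomorphism of 2-tensors, `F_{ab} ↦ ½ W_{ab}^{cd} F_{cd}`. -/
def weylMap (G : Field4) (y : Fin 4 → ℝ) (F : Matrix (Fin 4) (Fin 4) ℝ) :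
    Matrix (Fin 4) (Fin 4) ℝ :=
  Matrix.of fun a b => (1 / 2) * ∑ c, ∑ d, weyl G y a b c d * ((G y)⁻¹ * F * (G y)⁻¹) c d

/-- The space of 2-forms `F` with `W(F) = φ F`. -/
def weylEigenspace (G : Field4) (y : Fin 4 → ℝ) (φ : ℝ) :
    Submodule ℝ (Matrix (Fin 4) (Fin 4) ℝ) where
  carrier := {F | Fᵀ = -F ∧ weylMap G y F = φ • F}
  zero_mem' := by
    refine ⟨by simp, ?_⟩
    ext a b
    simp [weylMap]
  add_mem' := by
    rintro F F' ⟨h1, h2⟩ ⟨h1', h2'⟩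
    refine ⟨by rw [Matrix.transpose_add, h1, h1', neg_add], ?_⟩
    rw [smul_add, ← h2, ← h2']
    ext a b
    simp [weylMap, Matrix.add_mul, mul_add, Finset.sum_add_distrib]
  smul_mem' := by
    rintro s F ⟨h1, h2⟩
    refine ⟨by rw [Matrix.transpose_smul, h1, smul_neg], ?_⟩
    rw [smul_comm, ← h2]
    ext a b
    simp only [weylMap, Matrix.mul_smul, Matrix.smul_mul, Matrix.smul_apply, Matrix.of_apply,
      smul_eq_mul, Finset.mul_sum]
    refine Finset.sum_congr rfl fun c _ => Finset.sum_congr rfl fun d _ => ?_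
    ring

/-- `φ` is a real double eigenvalue of the Weyl tensor. The Weyl tensor commutes with the Hodge dual
and is thereby a complex endomorphism of the 3-dimensional complex space of self-dual 2-forms; a
two-dimensional complex eigenspace with real eigenvalue is the same as a real eigenspace of dimension
four in the 6-dimensional real space of 2-forms (and six exactly if the Weyl tensor
vanishes and `φ = 0`). Such a `φ` is unique. -/
def IsDoubleWeylEigenvalue (G : Field4) (y : Fin 4 → ℝ) (φ : ℝ) : Prop :=
  4 ≤ Module.finrank ℝ (weylEigenspace G y φ)

/-- The traceless Ricci tensor `N = R - ¼ r g`. -/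
def tracelessRicci (G : Field4) (y : Fin 4 → ℝ) : Matrix (Fin 4) (Fin 4) ℝ :=
  ricci G y - (scal G y / 4) • G y

/-- `b = tr N²`. -/
def bInv (G : Field4) (y : Fin 4 → ℝ) : ℝ :=
  tr G y (dot G y (tracelessRicci G y) (tracelessRicci G y))

/-- `c = tr N³`. -/
def cInv (G : Field4) (y : Fin 4 → ℝ) : ℝ :=
  tr G y (dot G y (dot G y (tracelessRicci G y) (tracelessRicci G y)) (tracelessRicci G y))

/-- `d = tr N⁴`. -/
def dInv (G : Field4) (y : Fin 4 → ℝ) : ℝ :=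
  tr G y (dot G y (dot G y (tracelessRicci G y) (tracelessRicci G y))
    (dot G y (tracelessRicci G y) (tracelessRicci G y)))

open Classical in
/-- The values that the traces `b, c, d` allow for the eigenvalue `ν`: the two values `±½√b` if
`b² = 4d` (and `√b` is real), and otherwise the one value
`c (7b² - 12d) / (3 [b (b² - 4d) + 4c²])`, whose denominator must not vanish. -/
def IsNu (b c d ν : ℝ) : Prop :=
  if b ^ 2 = 4 * d ∧ 0 ≤ b then ν = √b / 2 ∨ ν = -(√b / 2)
  else b * (b ^ 2 - 4 * d) + 4 * c ^ 2 ≠ 0 ∧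
    ν = c * (7 * b ^ 2 - 12 * d) / (3 * (b * (b ^ 2 - 4 * d) + 4 * c ^ 2))

/-- `P = N² + 2 ν N + (3 ν² - b/2) g`. -/
def P (G : Field4) (ν : (Fin 4 → ℝ) → ℝ) (y : Fin 4 → ℝ) : Matrix (Fin 4) (Fin 4) ℝ :=
  dot G y (tracelessRicci G y) (tracelessRicci G y) + (2 * ν y) • tracelessRicci G y
    + (3 * ν y ^ 2 - bInv G y / 2) • G y

/-- `h = (2 / tr P) P`. -/
def hProj (G : Field4) (ν : (Fin 4 → ℝ) → ℝ) (y : Fin 4 → ℝ) : Matrix (Fin 4) (Fin 4) ℝ :=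
  (2 / tr G y (P G ν y)) • P G ν y

/-- The covariant derivative `∇_α H_{βγ}` of a covariant 2-tensor field. -/
def nabla (G H : Field4) (y : Fin 4 → ℝ) (α β γ : Fin 4) : ℝ :=
  pd α (fun z => H z β γ) y
    - ∑ l, (christoffel G y l α β * H y l γ + christoffel G y l α γ * H y β l)

/-- The divergence `(∇ · H)_γ = g^{αβ} ∇_α H_{βγ}`. -/
def divergence (G H : Field4) (y : Fin 4 → ℝ) (γ : Fin 4) : ℝ :=
  ∑ α, ∑ β, (G y)⁻¹ α β * nabla G H y α β γ

/-- `κ = -2φ - r/6 + μ + ξ²/4`, where `μ = ν + r/4` and `ξ = ∇ · h`. -/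
def kappa (G : Field4) (ν φ : (Fin 4 → ℝ) → ℝ) (y : Fin 4 → ℝ) : ℝ :=
  -2 * φ y - scal G y / 6 + (ν y + scal G y / 4)
    + (1 / 4) * ∑ α, ∑ β, (G y)⁻¹ α β *
        divergence G (hProj G ν) y α * divergence G (hProj G ν) y β

/-- `h(x,x) ≥ 0` for every time-like vector `x`. -/
def IsSpaceLike (G H : Field4) (y : Fin 4 → ℝ) : Prop :=
  ∀ x : Fin 4 → ℝ, x ⬝ᵥ (G y *ᵥ x) < 0 → 0 ≤ x ⬝ᵥ (H y *ᵥ x)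

/-- `2 ∇h = h ⊗̃ ξ` with `ξ = ∇ · h`, that is, `2 ∇_α h_{βγ} = h_{αβ} ξ_γ + h_{αγ} ξ_β`. -/
def WarpedEq (G H : Field4) (y : Fin 4 → ℝ) : Prop :=
  ∀ α β γ, 2 * nabla G H y α β γ = H y α β * divergence G H y γ + H y α γ * divergence G H y β

/-- `dξ = 0` for a 1-form `ξ`. -/
def IsClosedAt (ξ : (Fin 4 → ℝ) → Fin 4 → ℝ) (y : Fin 4 → ℝ) : Prop :=
  ∀ α β, pd α (fun z => ξ z β) y = pd β (fun z => ξ z α) y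

/-- `h(df) = 0`, that is, `h_{αβ} g^{βγ} ∂_γ f = 0`. -/
def KillsDifferential (G H : Field4) (f : (Fin 4 → ℝ) → ℝ) (y : Fin 4 → ℝ) : Prop :=
  ∀ α, ∑ β, ∑ γ, H y α β * (G y)⁻¹ β γ * pd γ f y = 0

/-! ### Lorentzian metrics on a 4-manifold and spherical symmetry -/

/-- The matrix of a field of bilinear forms on the tangent spaces in the chart `e`. -/
def components {M : Type*} [TopologicalSpace M] [ChartedSpace (Fin 4 → ℝ) M]
    (g : ∀ p : M, LinearMap.BilinForm ℝ (TangentSpace 𝓘(ℝ, Fin 4 → ℝ) p))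
    (e : OpenPartialHomeomorph M (Fin 4 → ℝ)) : Field4 :=
  fun y => Matrix.of fun i j =>
    g (e.symm y)
      (mfderiv 𝓘(ℝ, Fin 4 → ℝ) 𝓘(ℝ, Fin 4 → ℝ) e.symm y (Pi.single i 1 : Fin 4 → ℝ))
      (mfderiv 𝓘(ℝ, Fin 4 → ℝ) 𝓘(ℝ, Fin 4 → ℝ) e.symm y (Pi.single j 1 : Fin 4 → ℝ))

/-- A smooth metric of signature `(-,+,+,+)` on a smooth 4-manifold. -/
structure LorentzMetric (M : Type*) [TopologicalSpace M] [ChartedSpace (Fin 4 → ℝ) M]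
    [IsManifold 𝓘(ℝ, Fin 4 → ℝ) ∞ M] where
  toFun : ∀ p : M, LinearMap.BilinForm ℝ (TangentSpace 𝓘(ℝ, Fin 4 → ℝ) p)
  symm : ∀ p u w, toFun p u w = toFun p w u
  signature : ∀ p, ∃ B : Module.Basis (Fin 4) ℝ (TangentSpace 𝓘(ℝ, Fin 4 → ℝ) p),
    ∀ i j, toFun p (B i) (B j) = if i = j then (if i = 0 then -1 else 1) else 0
  smooth : ∀ e ∈ IsManifold.maximalAtlas 𝓘(ℝ, Fin 4 → ℝ) ∞ M, ∀ i j,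
    ContDiffOn ℝ ∞ (fun y => components toFun e y i j) e.target

/-- The first two of four coordinates. -/
def fstPair (y : Fin 4 → ℝ) : Fin 2 → ℝ := ![y 0, y 1]

/-- The last two of four coordinates. -/
def sndPair (y : Fin 4 → ℝ) : Fin 2 → ℝ := ![y 2, y 3]

/-- The metric `v + e^{2λ} ĥ`, where `v` and `λ` depend on the first two coordinates only, `ĥ` depends
on the last two only (so `ĥ(dλ) = 0`), `a = v`, `l = λ` and `s = ĥ` at the point considered. -/
def warpedBlock (a : Matrix (Fin 2) (Fin 2) ℝ) (l : ℝ) (s : Matrix (Fin 2) (Fin 2) ℝ) :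
    Matrix (Fin 4) (Fin 4) ℝ :=
  !![a 0 0, a 0 1, 0, 0;
     a 1 0, a 1 1, 0, 0;
     0, 0, Real.exp (2 * l) * s 0 0, Real.exp (2 * l) * s 0 1;
     0, 0, Real.exp (2 * l) * s 1 0, Real.exp (2 * l) * s 1 1]

/-- Spherical symmetry: around every point there are coordinates in which `g = v + e^{2λ} ĥ` with
`ĥ(dλ) = 0`, where `v` is a 2-dimensional Lorentzian metric and `ĥ` is a 2-dimensional Riemannian
metric of Gauss curvature one. -/
def LorentzMetric.IsSphericallySymmetric {M : Type*} [TopologicalSpace M]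
    [ChartedSpace (Fin 4 → ℝ) M] [IsManifold 𝓘(ℝ, Fin 4 → ℝ) ∞ M] (g : LorentzMetric M) : Prop :=
  ∀ p : M, ∃ e ∈ IsManifold.maximalAtlas 𝓘(ℝ, Fin 4 → ℝ) ∞ M, p ∈ e.source ∧
    ∃ (v : (Fin 2 → ℝ) → Matrix (Fin 2) (Fin 2) ℝ) (lam : (Fin 2 → ℝ) → ℝ)
      (hhat : (Fin 2 → ℝ) → Matrix (Fin 2) (Fin 2) ℝ),
      (∀ i j, ContDiffOn ℝ ∞ (fun z => v z i j) (fstPair '' e.target)) ∧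
      ContDiffOn ℝ ∞ lam (fstPair '' e.target) ∧
      (∀ i j, ContDiffOn ℝ ∞ (fun z => hhat z i j) (sndPair '' e.target)) ∧
      (∀ z ∈ fstPair '' e.target, (v z).IsSymm ∧ (v z).det < 0) ∧
      (∀ z ∈ sndPair '' e.target, (hhat z).PosDef ∧ gaussCurvature hhat z = 1) ∧
      ∀ y ∈ e.target, components g.toFun e y =
        warpedBlock (v (fstPair y)) (lam (fstPair y)) (hhat (sndPair y))

end RicciSph

end

open RicciSph

noncomputable section

namespace RicciSph

open Filter Topology

/-! ### Partial derivatives -/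

section PartialDerivatives

variable {n m p q r : ℕ} {i j : Fin n} {f g : (Fin n → ℝ) → ℝ} {y : Fin n → ℝ}
  {U : Set (Fin n → ℝ)}

/-! In coordinates with `g = v + e^{2λ} ĥ` all curvature quantities are block diagonal. The
traceless Ricci tensor `N` has the double eigenvalue `ν` on the fibres and, having trace zero, the
(possibly complex) eigenvalues `-ν ± √t` on the base. Hence `b = 4ν² + 2t`, `c = -6νt`, `d = 4ν⁴ +
12ν²t + 2t²` and `7b² - 12d = 4(4ν² - t)²`, so that the hypothesis says exactly that `ν` is not an
eigenvalue of the base block. The three equations can be solved for `ν`: rationally if `t ≠ 0`, up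
to sign if `t = 0` (`isNu_of_eigenvalues`). The tensor `P` is the characteristic polynomial of the
base block evaluated at `N`; by Cayley-Hamilton it vanishes on the base, while on the fibres it is
the nonzero multiple `4ν² - t` of the metric. So `h` is the fibre part of the metric, and `ξ = -2
dλ`. The 2-forms pairing base and fibre form a four-dimensional eigenspace of the Weyl tensor
(`IsWarped.weylMap_mixed`), and the combination `κ` is designed to equal `e^{-2λ} K`, where `K` is
the Gauss curvature of the fibre metric (`IsWarped.kappa_eq`).

If the metric is spherically symmetric, these formulas give all conditions in an adapted chart. What
remains is global. The values of `ν` and `φ` must not depend on the adapted chart: two positive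
definite eigenplanes of `N` with different eigenvalues would be orthogonal and make `det g` positive
(`eigenvalue_unique`), and two different double Weyl eigenvalues would need eight dimensions in the
six-dimensional space of 2-forms (`IsDoubleWeylEigenvalue.unique`). The conditions must also pass to
every chart of the atlas (`IsPullback.sphericalConditions`); this rests on the transformation laws
of connection and curvature.

Conversely, `T = G⁻¹ h` is a field of projections of trace two. The equation for `∇h`, together with
the symmetry of the connection, makes kernel and range of `T` involutive (`involutive_ker`,
`involutive_range`), so two applications of the Frobenius theorem give coordinates in which `T` is
constant (`exists_splitting`). The Frobenius theorem is proved from a commuting frame of the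
distribution, whose flow is obtained by the implicit function theorem on the space of continuous
curves (`exists_flow`, `exists_first_integral`). In straightened coordinates the metric is block
diagonal, the base block does not depend on the fibre coordinates, and the fibre block satisfies `∂ᵢ
s = -ξᵢ s` with `ξ` a closed form on the base; on a box this integrates to a warped product
(`IsStraightened.exists_isWarped`). Then `h` selects the right sign of `ν`, uniqueness fixes `φ`,
and `κ = e^{-2λ} K` again. Condition 4 now says that `K` is a positive constant, which a rescaling
of the fibre metric turns into one. -/

theorem pd_congr (h : f =ᶠ[𝓝 y] g) : pd i f y = pd i g y := by
  simp only [pd, h.fderiv_eq]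

theorem pd_congr_of_isOpen (hU : IsOpen U) (hy : y ∈ U) (h : ∀ z ∈ U, f z = g z) :
    pd i f y = pd i g y :=
  pd_congr (Filter.eventuallyEq_of_mem (hU.mem_nhds hy) h)

theorem pd_const (a : ℝ) : pd i (fun _ => a) y = 0 := by
  simp [pd]

theorem pd_add (hf : DifferentiableAt ℝ f y) (hg : DifferentiableAt ℝ g y) :
    pd i (fun z => f z + g z) y = pd i f y + pd i g y := by
  simp [pd, fderiv_fun_add hf hg]

theorem pd_mul (hf : DifferentiableAt ℝ f y) (hg : DifferentiableAt ℝ g y) :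
    pd i (fun z => f z * g z) y = pd i f y * g y + f y * pd i g y := by
  simp [pd, fderiv_fun_mul hf hg]
  ring

theorem pd_const_mul (a : ℝ) (hf : DifferentiableAt ℝ f y) :
    pd i (fun z => a * f z) y = a * pd i f y := by
  rw [pd_mul (differentiableAt_const a) hf, pd_const]
  ring

theorem pd_sum {ι : Type*} (s : Finset ι) {F : ι → (Fin n → ℝ) → ℝ}
    (hF : ∀ k ∈ s, DifferentiableAt ℝ (F k) y) :
    pd i (fun z => ∑ k ∈ s, F k z) y = ∑ k ∈ s, pd i (F k) y := by
  simp only [pd]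
  rw [fderiv_fun_sum hF]
  simp

theorem fderiv_eq_sum_pd (v : Fin n → ℝ) :
    fderiv ℝ f y v = ∑ k, v k * pd k f y := by
  conv_lhs => rw [pi_eq_sum_univ' v]
  rw [map_sum]
  refine Finset.sum_congr rfl fun k _ => ?_
  rw [map_smul, smul_eq_mul, pd]

theorem pd_comp {F : (Fin m → ℝ) → ℝ} {ψ : (Fin n → ℝ) → Fin m → ℝ}
    (hF : DifferentiableAt ℝ F (ψ y)) (hψ : DifferentiableAt ℝ ψ y) :
    pd i (fun z => F (ψ z)) y = ∑ k, pd i (fun z => ψ z k) y * pd k F (ψ y) := by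
  have h1 : fderiv ℝ (fun z => F (ψ z)) y = (fderiv ℝ F (ψ y)).comp (fderiv ℝ ψ y) :=
    fderiv_fun_comp y hF hψ
  rw [pd, h1, ContinuousLinearMap.comp_apply, fderiv_eq_sum_pd]
  refine Finset.sum_congr rfl fun k _ => ?_
  rw [pd, fderiv_pi (fun k => differentiableAt_pi.1 hψ k)]
  simp [pd]

theorem contDiffOn_pd (hU : IsOpen U) (hf : ContDiffOn ℝ ∞ f U) :
    ContDiffOn ℝ ∞ (pd i f) U := by
  have h1 : ContDiffOn ℝ ∞ (fderiv ℝ f) U := hf.fderiv_of_isOpen hU (by simp)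
  exact h1.clm_apply contDiffOn_const

theorem pd_comm (hU : IsOpen U) (hf : ContDiffOn ℝ ∞ f U) (hy : y ∈ U) :
    pd i (pd j f) y = pd j (pd i f) y := by
  have hfa : ContDiffAt ℝ ∞ f y := hf.contDiffAt (hU.mem_nhds hy)
  have hs := (hfa.isSymmSndFDerivAt (by
    rw [minSmoothness_of_isRCLikeNormedField]
    exact ENat.LEInfty.out))
  have h1 : DifferentiableAt ℝ (fderiv ℝ f) y :=
    ((hf.fderiv_of_isOpen hU (m := ∞) (by simp)).contDiffAt (hU.mem_nhds hy)).differentiableAt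
      (by simp)
  have h2 : ∀ k l : Fin n, pd k (pd l f) y =
      fderiv ℝ (fderiv ℝ f) y (Pi.single k 1) (Pi.single l 1) := by
    intro k l
    have : fderiv ℝ (fun z => fderiv ℝ f z (Pi.single l 1)) y =
      (fderiv ℝ (fderiv ℝ f) y).flip (Pi.single l 1) := by
      rw [fderiv_clm_apply h1 (differentiableAt_const _)]
      ext v
      simp
    change fderiv ℝ (fun z => fderiv ℝ f z (Pi.single l 1)) y _ = _
    rw [this]
    rfl
  rw [h2, h2]
  exact hs _ _

theorem _root_.ContDiffOn.diffAt (hf : ContDiffOn ℝ ∞ f U) (hU : IsOpen U) (hy : y ∈ U) :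
    DifferentiableAt ℝ f y :=
  (hf.contDiffAt (hU.mem_nhds hy)).differentiableAt (by simp)

/-! ### Matrix-valued functions -/

/-- Entrywise smoothness of a matrix-valued function on a set. -/
def MatrixSmoothOn {E : Type*} [NormedAddCommGroup E] [NormedSpace ℝ E]
    (A : E → Matrix (Fin p) (Fin q) ℝ) (U : Set E) : Prop :=
  ∀ a b, ContDiffOn ℝ ∞ (fun z => A z a b) U

/-- The entrywise partial derivative of a matrix-valued function. -/
def pdMat (i : Fin n) (A : (Fin n → ℝ) → Matrix (Fin p) (Fin q) ℝ) (y : Fin n → ℝ) :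
    Matrix (Fin p) (Fin q) ℝ :=
  Matrix.of fun a b => pd i (fun z => A z a b) y

variable {A : (Fin n → ℝ) → Matrix (Fin p) (Fin q) ℝ} {B : (Fin n → ℝ) → Matrix (Fin q) (Fin r) ℝ}
  {A' : (Fin n → ℝ) → Matrix (Fin p) (Fin q) ℝ}

theorem pdMat_apply (a : Fin p) (b : Fin q) :
    pdMat i A y a b = pd i (fun z => A z a b) y := rfl

theorem pdMat_congr (h : A =ᶠ[𝓝 y] A') : pdMat i A y = pdMat i A' y := by
  ext a b
  exact pd_congr (h.mono fun z hz => by simp only [hz])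

theorem pdMat_congr_of_isOpen (hU : IsOpen U) (hy : y ∈ U) (h : ∀ z ∈ U, A z = A' z) :
    pdMat i A y = pdMat i A' y :=
  pdMat_congr (Filter.eventuallyEq_of_mem (hU.mem_nhds hy) h)

theorem pdMat_transpose : pdMat i (fun z => (A z)ᵀ) y = (pdMat i A y)ᵀ := rfl

theorem pdMat_add (hU : IsOpen U) (hy : y ∈ U) (hA : MatrixSmoothOn A U)
    (hA' : MatrixSmoothOn A' U) :
    pdMat i (fun z => A z + A' z) y = pdMat i A y + pdMat i A' y := by
  ext a b
  exact pd_add ((hA a b).diffAt hU hy) ((hA' a b).diffAt hU hy)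

theorem pdMat_mul (hU : IsOpen U) (hy : y ∈ U) (hA : MatrixSmoothOn A U)
    (hB : MatrixSmoothOn B U) :
    pdMat i (fun z => A z * B z) y = pdMat i A y * B y + A y * pdMat i B y := by
  ext a b
  simp only [pdMat_apply, Matrix.mul_apply, Matrix.add_apply]
  rw [pd_sum _ fun k _ => ((hA a k).diffAt hU hy).fun_mul ((hB k b).diffAt hU hy),
    ← Finset.sum_add_distrib]
  exact Finset.sum_congr rfl fun k _ => pd_mul ((hA a k).diffAt hU hy) ((hB k b).diffAt hU hy)

theorem pdMat_comm (hU : IsOpen U) (hy : y ∈ U) (hA : MatrixSmoothOn A U) :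
    pdMat i (pdMat j A) y = pdMat j (pdMat i A) y := by
  ext a b
  exact pd_comm hU (hA a b) hy

/-! ### Closure properties of entrywise smoothness -/

section Smooth

variable {E : Type*} [NormedAddCommGroup E] [NormedSpace ℝ E] {V : Set E}
  {A A' : E → Matrix (Fin p) (Fin q) ℝ} {B : E → Matrix (Fin q) (Fin r) ℝ}

theorem MatrixSmoothOn.congr (hA : MatrixSmoothOn A V) (h : ∀ z ∈ V, A' z = A z) :
    MatrixSmoothOn A' V := fun a b => (hA a b).congr fun z hz => by rw [h z hz]

theorem MatrixSmoothOn.mono {V' : Set E} (hA : MatrixSmoothOn A V) (h : V' ⊆ V) :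
    MatrixSmoothOn A V' := fun a b => (hA a b).mono h

theorem MatrixSmoothOn.transpose (hA : MatrixSmoothOn A V) :
    MatrixSmoothOn (fun z => (A z)ᵀ) V := fun a b => hA b a

theorem MatrixSmoothOn.add (hA : MatrixSmoothOn A V) (hA' : MatrixSmoothOn A' V) :
    MatrixSmoothOn (fun z => A z + A' z) V := fun a b => (hA a b).add (hA' a b)

theorem MatrixSmoothOn.sub (hA : MatrixSmoothOn A V) (hA' : MatrixSmoothOn A' V) :
    MatrixSmoothOn (fun z => A z - A' z) V := fun a b => (hA a b).sub (hA' a b)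

theorem MatrixSmoothOn.smul {f : E → ℝ} (hf : ContDiffOn ℝ ∞ f V) (hA : MatrixSmoothOn A V) :
    MatrixSmoothOn (fun z => f z • A z) V := fun a b => hf.mul (hA a b)

theorem MatrixSmoothOn.mul (hA : MatrixSmoothOn A V) (hB : MatrixSmoothOn B V) :
    MatrixSmoothOn (fun z => A z * B z) V := fun a b => by
  simp only [Matrix.mul_apply]
  exact ContDiffOn.sum fun k _ => (hA a k).mul (hB k b)

theorem MatrixSmoothOn.trace {A : E → Matrix (Fin p) (Fin p) ℝ} (hA : MatrixSmoothOn A V) :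
    ContDiffOn ℝ ∞ (fun z => (A z).trace) V := by
  simp only [Matrix.trace, Matrix.diag]
  exact ContDiffOn.sum fun k _ => hA k k

theorem MatrixSmoothOn.det {A : E → Matrix (Fin p) (Fin p) ℝ} (hA : MatrixSmoothOn A V) :
    ContDiffOn ℝ ∞ (fun z => (A z).det) V := by
  simp only [Matrix.det_apply']
  exact ContDiffOn.sum fun σ _ => contDiffOn_const.mul (contDiffOn_prod fun k _ => hA _ _)

theorem MatrixSmoothOn.inv {A : E → Matrix (Fin p) (Fin p) ℝ} (hA : MatrixSmoothOn A V)
    (h : ∀ z ∈ V, (A z).det ≠ 0) : MatrixSmoothOn (fun z => (A z)⁻¹) V := by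
  intro a b
  simp only [Matrix.inv_def, Matrix.smul_apply, smul_eq_mul, Ring.inverse_eq_inv',
    Matrix.adjugate_apply]
  -- Cramer's rule: an entry of the adjugate is the determinant of a matrix in which one row has
  -- been replaced by a constant vector.
  refine (hA.det.inv h).mul (MatrixSmoothOn.det fun c d => ?_)
  by_cases hc : c = b
  · subst hc
    simp only [Matrix.updateRow_self]
    exact contDiffOn_const
  · simp only [Matrix.updateRow_ne hc]
    exact hA c d

end Smooth

theorem MatrixSmoothOn.pdMat (hU : IsOpen U) (hA : MatrixSmoothOn A U) :
    MatrixSmoothOn (pdMat i A) U := fun a b => contDiffOn_pd hU (hA a b)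

end PartialDerivatives

/-! ### The Levi-Civita connection and its curvature -/

section LeviCivita

variable {n : ℕ}

/-- `G` is a smooth pseudo-Riemannian metric on the open set `U`, by components. -/
structure IsMetricOn (G : (Fin n → ℝ) → Matrix (Fin n) (Fin n) ℝ) (U : Set (Fin n → ℝ)) : Prop where
  isOpen : IsOpen U
  smooth : MatrixSmoothOn G U
  symm : ∀ y ∈ U, (G y)ᵀ = G y
  det_ne : ∀ y ∈ U, (G y).det ≠ 0

/-- The matrices `(Γᵃ_{cb})_{ab}` of the Levi-Civita connection. -/
def conn (G : (Fin n → ℝ) → Matrix (Fin n) (Fin n) ℝ) (c : Fin n) (y : Fin n → ℝ) :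
    Matrix (Fin n) (Fin n) ℝ :=
  Matrix.of fun a b => christoffel G y a c b

/-- The matrices `(Rᵃ_{bcd})_{ab}` of the curvature. -/
def curv (G : (Fin n → ℝ) → Matrix (Fin n) (Fin n) ℝ) (y : Fin n → ℝ) (c d : Fin n) :
    Matrix (Fin n) (Fin n) ℝ :=
  pdMat c (conn G d) y - pdMat d (conn G c) y + (conn G c y * conn G d y - conn G d y * conn G c y)

namespace IsMetricOn

variable {G : (Fin n → ℝ) → Matrix (Fin n) (Fin n) ℝ} {U : Set (Fin n → ℝ)} {y : Fin n → ℝ}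

theorem mono {V : Set (Fin n → ℝ)} (hG : IsMetricOn G U) (hV : IsOpen V) (h : V ⊆ U) :
    IsMetricOn G V :=
  ⟨hV, hG.smooth.mono h, fun y hy => hG.symm y (h hy), fun y hy => hG.det_ne y (h hy)⟩

theorem symm_apply (hG : IsMetricOn G U) (hy : y ∈ U) (a b : Fin n) : G y a b = G y b a :=
  congrFun (congrFun (hG.symm y hy).symm a) b

theorem isUnit_det (hG : IsMetricOn G U) (hy : y ∈ U) : IsUnit (G y).det :=
  (hG.det_ne y hy).isUnit

theorem inv_symm (hG : IsMetricOn G U) (hy : y ∈ U) : ((G y)⁻¹)ᵀ = (G y)⁻¹ := by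
  rw [Matrix.transpose_nonsing_inv, hG.symm y hy]

theorem smooth_inv (hG : IsMetricOn G U) : MatrixSmoothOn (fun z => (G z)⁻¹) U :=
  hG.smooth.inv hG.det_ne

theorem pd_symm (hG : IsMetricOn G U) (hy : y ∈ U) (i a b : Fin n) :
    pd i (fun z => G z a b) y = pd i (fun z => G z b a) y :=
  pd_congr_of_isOpen hG.isOpen hy fun _ hz => hG.symm_apply hz a b

theorem christoffel_symm (hG : IsMetricOn G U) (hy : y ∈ U) (k i j : Fin n) :
    christoffel G y k i j = christoffel G y k j i := by
  simp only [christoffel]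
  congr 1
  refine Finset.sum_congr rfl fun l _ => ?_
  rw [hG.pd_symm hy l i j]
  ring

theorem conn_symm (hG : IsMetricOn G U) (hy : y ∈ U) (a b c : Fin n) :
    conn G c y a b = conn G b y a c :=
  hG.christoffel_symm hy a c b

theorem contDiffOn_christoffel (hG : IsMetricOn G U) (k i j : Fin n) :
    ContDiffOn ℝ ∞ (fun z => christoffel G z k i j) U := by
  simp only [christoffel]
  refine contDiffOn_const.mul (ContDiffOn.sum fun l _ => (hG.smooth_inv k l).mul ?_)
  exact ((contDiffOn_pd hG.isOpen (hG.smooth _ _)).add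
    (contDiffOn_pd hG.isOpen (hG.smooth _ _))).sub (contDiffOn_pd hG.isOpen (hG.smooth _ _))

theorem smooth_conn (hG : IsMetricOn G U) (c : Fin n) : MatrixSmoothOn (conn G c) U :=
  fun a b => hG.contDiffOn_christoffel a c b

/-- Lowering the upper index removes the inverse metric, so that compatibility with the metric and
uniqueness of the connection become linear identities between first derivatives. -/
theorem metric_mul_conn (hG : IsMetricOn G U) (hy : y ∈ U) (l c b : Fin n) :
    (G y * conn G c y) l b = (1 / 2) *
      (pd c (fun z => G z b l) y + pd b (fun z => G z c l) y - pd l (fun z => G z c b) y) := by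
  have h : conn G c y = (G y)⁻¹ * Matrix.of fun l b => (1 / 2) *
      (pd c (fun z => G z b l) y + pd b (fun z => G z c l) y - pd l (fun z => G z c b) y) := by
    ext a b
    simp only [conn, christoffel, Matrix.of_apply, Matrix.mul_apply, Finset.mul_sum]
    exact Finset.sum_congr rfl fun _ _ => by ring
  rw [h, Matrix.mul_nonsing_inv_cancel_left _ _ (hG.isUnit_det hy)]
  rfl

theorem pdMat_metric (hG : IsMetricOn G U) (hy : y ∈ U) (c : Fin n) :
    pdMat c G y = G y * conn G c y + (G y * conn G c y)ᵀ := by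
  ext a b
  rw [Matrix.add_apply, Matrix.transpose_apply, hG.metric_mul_conn hy, hG.metric_mul_conn hy,
    pdMat_apply, hG.pd_symm hy c b a]
  ring

/-- The Levi-Civita connection is the only torsion-free metric connection. -/
theorem eq_conn (hG : IsMetricOn G U) (hy : y ∈ U) (A : Fin n → Matrix (Fin n) (Fin n) ℝ)
    (htf : ∀ a b c, A c a b = A b a c)
    (hmet : ∀ c, pdMat c G y = G y * A c + (G y * A c)ᵀ) (c : Fin n) : A c = conn G c y := by
  have hB : ∀ l c b, (G y * A c) l b = (G y * A b) l c := by
    intro l c b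
    simp only [Matrix.mul_apply]
    exact Finset.sum_congr rfl fun k _ => by rw [htf]
  have hm : ∀ c a b, pd c (fun z => G z a b) y = (G y * A c) a b + (G y * A c) b a := by
    intro c a b
    have := congrFun (congrFun (hmet c) a) b
    exact this
  -- Koszul's argument: in the combination `∂_c g_{bl} + ∂_b g_{cl} - ∂_l g_{cb}` the symmetry `hB`
  -- cancels everything except twice one term.
  have h : G y * A c = G y * conn G c y := by
    ext l b
    rw [hG.metric_mul_conn hy, hm, hm, hm]
    rw [hB c l b, hB b l c, hB l b c]
    ring
  rw [← Matrix.nonsing_inv_mul_cancel_left _ (A c) (hG.isUnit_det hy), h,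
    Matrix.nonsing_inv_mul_cancel_left _ _ (hG.isUnit_det hy)]

theorem riemannUp_eq (hG : IsMetricOn G U) (hy : y ∈ U) (a b c d : Fin n) :
    riemannUp G y a b c d = curv G y c d a b := by
  have h : ∀ c d, pd c (fun z => christoffel G z a b d) y = pdMat c (conn G d) y a b := fun c d =>
    pd_congr_of_isOpen hG.isOpen hy fun z hz => hG.christoffel_symm hz a b d
  simp only [riemannUp, curv, Matrix.add_apply, Matrix.sub_apply, Matrix.mul_apply, h,
    ← Finset.sum_sub_distrib]
  congr 1
  refine Finset.sum_congr rfl fun e _ => ?_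
  rw [hG.christoffel_symm hy e b d, hG.christoffel_symm hy e b c]
  rfl

theorem riemann_eq (hG : IsMetricOn G U) (hy : y ∈ U) (a b c d : Fin n) :
    riemann G y a b c d = (G y * curv G y c d) a b := by
  simp only [riemann, Matrix.mul_apply, hG.riemannUp_eq hy]

theorem riemannUp_eq_sum (hG : IsMetricOn G U) (hy : y ∈ U) (a b c d : Fin n) :
    riemannUp G y a b c d = ∑ e, (G y)⁻¹ a e * riemann G y e b c d := by
  have := congrFun (congrFun (Matrix.nonsing_inv_mul_cancel_left _ (curv G y c d)
    (hG.isUnit_det hy)) a) b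
  rw [hG.riemannUp_eq hy, ← this, Matrix.mul_apply]
  simp only [hG.riemann_eq hy]

theorem curv_antisymm (c d : Fin n) : curv G y c d = -curv G y d c := by
  simp only [curv]
  abel

theorem smooth_curv (hG : IsMetricOn G U) (c d : Fin n) :
    MatrixSmoothOn (fun z => curv G z c d) U :=
  (((hG.smooth_conn d).pdMat hG.isOpen).sub ((hG.smooth_conn c).pdMat hG.isOpen)).add
    (((hG.smooth_conn c).mul (hG.smooth_conn d)).sub ((hG.smooth_conn d).mul (hG.smooth_conn c)))

/-- Metric compatibility is differentiated once more; the symmetry of the second partial derivatives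
of `G` leaves exactly the symmetric part of the lowered curvature, which must vanish. -/
theorem metric_mul_curv_transpose (hG : IsMetricOn G U) (hy : y ∈ U) (c d : Fin n) :
    (G y * curv G y c d)ᵀ = -(G y * curv G y c d) := by
  have hd : ∀ c d, pdMat c (pdMat d G) y =
      pdMat c G y * conn G d y + G y * pdMat c (conn G d) y
        + (pdMat c G y * conn G d y + G y * pdMat c (conn G d) y)ᵀ := by
    intro c d
    rw [pdMat_congr_of_isOpen hG.isOpen hy fun z hz => hG.pdMat_metric hz d,
      pdMat_add hG.isOpen hy (hG.smooth.mul (hG.smooth_conn d))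
        (hG.smooth.mul (hG.smooth_conn d)).transpose, pdMat_transpose,
      pdMat_mul hG.isOpen hy hG.smooth (hG.smooth_conn d)]
  have h := pdMat_comm (i := c) (j := d) hG.isOpen hy hG.smooth
  rw [hd, hd, hG.pdMat_metric hy c, hG.pdMat_metric hy d] at h
  simp only [curv, Matrix.transpose_add, Matrix.transpose_mul, Matrix.transpose_sub,
    hG.symm y hy, Matrix.transpose_transpose, Matrix.mul_sub, Matrix.add_mul, Matrix.mul_add,
    Matrix.mul_assoc] at h ⊢
  rw [← sub_eq_zero] at h ⊢
  rw [← h]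
  abel

theorem riemann_antisymm_left (hG : IsMetricOn G U) (hy : y ∈ U) (a b c d : Fin n) :
    riemann G y a b c d = -riemann G y b a c d := by
  rw [hG.riemann_eq hy, hG.riemann_eq hy]
  have := congrFun (congrFun (hG.metric_mul_curv_transpose hy c d) b) a
  exact this

theorem riemann_antisymm_right (hG : IsMetricOn G U) (hy : y ∈ U) (a b c d : Fin n) :
    riemann G y a b c d = -riemann G y a b d c := by
  rw [hG.riemann_eq hy, hG.riemann_eq hy, curv_antisymm c d, Matrix.mul_neg, Matrix.neg_apply]

theorem riemannUp_bianchi (hG : IsMetricOn G U) (hy : y ∈ U) (a b c d : Fin n) :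
    riemannUp G y a b c d + riemannUp G y a c d b + riemannUp G y a d b c = 0 := by
  have h : ∀ b c d, pd c (fun z => christoffel G z a b d) y =
      pd c (fun z => christoffel G z a d b) y :=
    fun b c d => pd_congr_of_isOpen hG.isOpen hy fun z hz => hG.christoffel_symm hz a b d
  simp only [riemannUp]
  rw [h d b c, h d c b, h c d b]
  have h2 : (∑ e, (christoffel G y a c e * christoffel G y e b d
        - christoffel G y a d e * christoffel G y e b c))
      + (∑ e, (christoffel G y a d e * christoffel G y e c b
        - christoffel G y a b e * christoffel G y e c d))
      + (∑ e, (christoffel G y a b e * christoffel G y e d c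
        - christoffel G y a c e * christoffel G y e d b)) = 0 := by
    rw [← Finset.sum_add_distrib, ← Finset.sum_add_distrib]
    refine Finset.sum_eq_zero fun e _ => ?_
    rw [hG.christoffel_symm hy e b d, hG.christoffel_symm hy e c b, hG.christoffel_symm hy e d c]
    ring
  linarith

theorem riemann_bianchi (hG : IsMetricOn G U) (hy : y ∈ U) (a b c d : Fin n) :
    riemann G y a b c d + riemann G y a c d b + riemann G y a d b c = 0 := by
  simp only [riemann, ← Finset.sum_add_distrib, ← mul_add, hG.riemannUp_bianchi hy, mul_zero,
    Finset.sum_const_zero]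

/-- The classical octahedron argument: the Bianchi identities for the four cyclic rotations of the
indices are combined, and the two antisymmetries cancel all other terms. -/
theorem riemann_pair_symm (hG : IsMetricOn G U) (hy : y ∈ U) (a b c d : Fin n) :
    riemann G y a b c d = riemann G y c d a b := by
  have h1 := hG.riemann_bianchi hy a b c d
  have h2 := hG.riemann_bianchi hy b c d a
  have h3 := hG.riemann_bianchi hy c d a b
  have h4 := hG.riemann_bianchi hy d a b c
  have l := hG.riemann_antisymm_left hy
  have r := hG.riemann_antisymm_right hy
  rw [l b c d a, r c b d a, l b d a c, r d b a c, l b a c d] at h2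
  rw [l c a b d, r a c b d, l c b d a] at h3
  rw [l d a b c, r a d b c, l d b c a, l d c a b] at h4
  have e1 := r b d a c
  have e2 := l b d c a
  have e3 := r a c d b
  have e4 := r a d b c
  have e5 := r c d a b
  have e6 := l c b a d
  have e7 := r c b a d
  have e8 := r b c a d
  have e9 := l b c a d
  linarith

theorem ricci_symm (hG : IsMetricOn G U) (hy : y ∈ U) : (ricci G y)ᵀ = ricci G y := by
  ext b d
  simp only [ricci, Matrix.transpose_apply, Matrix.of_apply, hG.riemannUp_eq_sum hy]
  rw [Finset.sum_comm]
  refine Finset.sum_congr rfl fun e _ => Finset.sum_congr rfl fun a _ => ?_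
  rw [← congrFun (congrFun (hG.inv_symm hy) a) e, Matrix.transpose_apply,
    hG.riemann_pair_symm hy e d a b]

theorem smooth_ricci (hG : IsMetricOn G U) : MatrixSmoothOn (ricci G) U := by
  intro b d
  have : ContDiffOn ℝ ∞ (fun z => ∑ a, curv G z a d a b) U :=
    ContDiffOn.sum fun a _ => hG.smooth_curv a d a b
  refine this.congr fun z hz => ?_
  simp only [ricci, Matrix.of_apply, hG.riemannUp_eq hz]

theorem contDiffOn_scal (hG : IsMetricOn G U) : ContDiffOn ℝ ∞ (scal G) U :=
  (hG.smooth_inv.mul hG.smooth_ricci).trace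

end IsMetricOn

end LeviCivita

/-! ### Behaviour under a change of coordinates -/

section Covariance

variable {n : ℕ}

/-- The Jacobian matrix of a map. -/
def jac (ψ : (Fin n → ℝ) → Fin n → ℝ) (y : Fin n → ℝ) : Matrix (Fin n) (Fin n) ℝ :=
  Matrix.of fun a b => pd b (fun z => ψ z a) y

/-- The metric `G` on `U` is the pull-back of the metric `G'` on `U'` under `ψ`. -/
structure IsPullback (G : (Fin n → ℝ) → Matrix (Fin n) (Fin n) ℝ) (U : Set (Fin n → ℝ))
    (G' : (Fin n → ℝ) → Matrix (Fin n) (Fin n) ℝ) (U' : Set (Fin n → ℝ))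
    (ψ : (Fin n → ℝ) → Fin n → ℝ) : Prop where
  left : IsMetricOn G U
  right : IsMetricOn G' U'
  smooth : ContDiffOn ℝ ∞ ψ U
  mapsTo : Set.MapsTo ψ U U'
  metric : ∀ y ∈ U, G y = (jac ψ y)ᵀ * G' (ψ y) * jac ψ y

/-- Contraction of a contravariant against a covariant index is invariant. -/
theorem sum_contraction_eq {J : Matrix (Fin n) (Fin n) ℝ} (hJ : IsUnit J.det)
    (X : Fin n → Matrix (Fin n) (Fin n) ℝ) (c : Fin n) :
    ∑ a, (J⁻¹ * ∑ k, J k a • X k) a c = ∑ k, X k k c := by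
  have h : ∀ k, ∑ a, J k a * (J⁻¹ * X k) a c = X k k c := fun k => by
    have := congrFun (congrFun (Matrix.mul_nonsing_inv_cancel_left _ (X k) hJ) k) c
    rwa [Matrix.mul_apply] at this
  simp only [Matrix.mul_sum, Matrix.sum_apply, Matrix.mul_smul, Matrix.smul_apply, smul_eq_mul]
  rw [Finset.sum_comm]
  exact Finset.sum_congr rfl fun k _ => h k

namespace IsPullback

variable {G G' : (Fin n → ℝ) → Matrix (Fin n) (Fin n) ℝ} {U U' : Set (Fin n → ℝ)}
  {ψ : (Fin n → ℝ) → Fin n → ℝ} {y : Fin n → ℝ}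

theorem isUnit_jac (h : IsPullback G U G' U' ψ) (hy : y ∈ U) : IsUnit (jac ψ y).det := by
  have := h.left.det_ne y hy
  rw [h.metric y hy, Matrix.det_mul] at this
  exact (right_ne_zero_of_mul this).isUnit

theorem differentiableAt (h : IsPullback G U G' U' ψ) (hy : y ∈ U) : DifferentiableAt ℝ ψ y :=
  (h.smooth.contDiffAt (h.left.isOpen.mem_nhds hy)).differentiableAt (by simp)

theorem contDiffOn_comp (h : IsPullback G U G' U' ψ) {f : (Fin n → ℝ) → ℝ}
    (hf : ContDiffOn ℝ ∞ f U') : ContDiffOn ℝ ∞ (fun z => f (ψ z)) U :=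
  hf.comp h.smooth h.mapsTo

theorem smooth_comp (h : IsPullback G U G' U' ψ) {A : (Fin n → ℝ) → Matrix (Fin n) (Fin n) ℝ}
    (hA : MatrixSmoothOn A U') : MatrixSmoothOn (fun z => A (ψ z)) U :=
  fun a b => h.contDiffOn_comp (hA a b)

theorem smooth_apply (h : IsPullback G U G' U' ψ) (a : Fin n) :
    ContDiffOn ℝ ∞ (fun z => ψ z a) U :=
  contDiffOn_pi.1 h.smooth a

theorem smooth_jac (h : IsPullback G U G' U' ψ) : MatrixSmoothOn (jac ψ) U :=
  fun a _ => contDiffOn_pd h.left.isOpen (h.smooth_apply a)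

theorem pdMat_jac_symm (h : IsPullback G U G' U' ψ) (hy : y ∈ U) (a b c : Fin n) :
    pdMat c (jac ψ) y a b = pdMat b (jac ψ) y a c :=
  pd_comm h.left.isOpen (h.smooth_apply a) hy

theorem pd_comp (h : IsPullback G U G' U' ψ) (hy : y ∈ U) {f : (Fin n → ℝ) → ℝ}
    (hf : DifferentiableAt ℝ f (ψ y)) (c : Fin n) :
    pd c (fun z => f (ψ z)) y = ∑ k, jac ψ y k c * pd k f (ψ y) :=
  RicciSph.pd_comp hf (h.differentiableAt hy)

theorem pdMat_comp (h : IsPullback G U G' U' ψ) (hy : y ∈ U)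
    {A : (Fin n → ℝ) → Matrix (Fin n) (Fin n) ℝ} (hA : MatrixSmoothOn A U') (c : Fin n) :
    pdMat c (fun z => A (ψ z)) y = ∑ k, jac ψ y k c • pdMat k A (ψ y) := by
  ext a b
  rw [pdMat_apply, h.pd_comp hy ((hA a b).diffAt h.right.isOpen (h.mapsTo hy)), Matrix.sum_apply]
  rfl

/-- The derivative of a pulled back covariant 2-tensor. -/
theorem pdMat_tensor (h : IsPullback G U G' U' ψ) (hy : y ∈ U)
    {H H' : (Fin n → ℝ) → Matrix (Fin n) (Fin n) ℝ} (hH' : MatrixSmoothOn H' U')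
    (hH : ∀ z ∈ U, H z = (jac ψ z)ᵀ * H' (ψ z) * jac ψ z) (c : Fin n) :
    pdMat c H y = (pdMat c (jac ψ) y)ᵀ * H' (ψ y) * jac ψ y
      + (jac ψ y)ᵀ * (∑ k, jac ψ y k c • pdMat k H' (ψ y)) * jac ψ y
      + (jac ψ y)ᵀ * H' (ψ y) * pdMat c (jac ψ) y := by
  have ho := h.left.isOpen
  rw [pdMat_congr_of_isOpen ho hy hH,
    pdMat_mul ho hy (h.smooth_jac.transpose.mul (h.smooth_comp hH')) h.smooth_jac,
    pdMat_mul ho hy h.smooth_jac.transpose (h.smooth_comp hH'), pdMat_transpose,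
    h.pdMat_comp hy hH', Matrix.add_mul]

/-- The transformation law of the Christoffel symbols. -/
theorem jac_mul_conn (h : IsPullback G U G' U' ψ) (hy : y ∈ U) (c : Fin n) :
    jac ψ y * conn G c y =
      (∑ k, jac ψ y k c • conn G' k (ψ y)) * jac ψ y + pdMat c (jac ψ) y := by
  set J := jac ψ y with hJdef
  have hJ : IsUnit J.det := h.isUnit_jac hy
  have hy' := h.mapsTo hy
  set Ω : Fin n → Matrix (Fin n) (Fin n) ℝ := fun c => ∑ k, J k c • conn G' k (ψ y)
  -- No Christoffel symbol is computed. The transformed connection is checked to be torsion-free and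
  -- metric for `G`, and uniqueness of the Levi-Civita connection does the rest.
  have hA : ∀ c, (J⁻¹ * (Ω c * J + pdMat c (jac ψ) y)) = conn G c y := by
    refine h.left.eq_conn hy (fun c => J⁻¹ * (Ω c * J + pdMat c (jac ψ) y)) ?_ ?_
    · have hs : ∀ a b c, (Ω c * J + pdMat c (jac ψ) y) a b = (Ω b * J + pdMat b (jac ψ) y) a c := by
        intro a b c
        rw [Matrix.add_apply, Matrix.add_apply, h.pdMat_jac_symm hy a b c]
        congr 1
        simp only [Ω, Matrix.mul_apply, Matrix.sum_apply, Matrix.smul_apply, smul_eq_mul,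
          Finset.sum_mul]
        rw [Finset.sum_comm]
        refine Finset.sum_congr rfl fun k _ => Finset.sum_congr rfl fun l _ => ?_
        rw [h.right.conn_symm hy' a l k]
        ring
      intro a b c
      rw [Matrix.mul_apply, Matrix.mul_apply]
      exact Finset.sum_congr rfl fun k _ => by rw [hs]
    · intro c
      have h1 : ∑ k, J k c • pdMat k G' (ψ y) = G' (ψ y) * Ω c + (Ω c)ᵀ * G' (ψ y) := by
        simp only [Ω, Matrix.mul_sum, Matrix.transpose_sum, Matrix.sum_mul,
          ← Finset.sum_add_distrib, Matrix.mul_smul, Matrix.transpose_smul, Matrix.smul_mul,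
          ← smul_add]
        refine Finset.sum_congr rfl fun k _ => ?_
        rw [h.right.pdMat_metric hy', Matrix.transpose_mul, h.right.symm _ hy']
      rw [h.pdMat_tensor hy h.right.smooth h.metric, h.metric y hy, ← hJdef, h1]
      simp only [Matrix.mul_assoc, Matrix.mul_nonsing_inv_cancel_left _ _ hJ]
      simp only [Matrix.transpose_mul, Matrix.transpose_add, h.right.symm _ hy',
        Matrix.transpose_transpose, Matrix.mul_add, Matrix.add_mul, Matrix.mul_assoc]
      abel
  rw [← hA, Matrix.mul_nonsing_inv_cancel_left _ _ hJ]

/-- The transformation law of the curvature. -/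
theorem jac_mul_curv (h : IsPullback G U G' U' ψ) (hy : y ∈ U) (c d : Fin n) :
    jac ψ y * curv G y c d =
      (∑ k, ∑ l, (jac ψ y k c * jac ψ y l d) • curv G' (ψ y) k l) * jac ψ y := by
  have ho := h.left.isOpen
  set Ω : Fin n → (Fin n → ℝ) → Matrix (Fin n) (Fin n) ℝ :=
    fun c z => ∑ k, jac ψ z k c • conn G' k (ψ z) with hΩ
  have hΩs : ∀ c, MatrixSmoothOn (Ω c) U := by
    intro c a b
    simp only [hΩ, Matrix.sum_apply]
    exact ContDiffOn.sum fun k _ => (h.smooth_jac k c).mul (h.smooth_comp (h.right.smooth_conn k) a b)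
  have hD : ∀ c d, pdMat c (Ω d) y = (∑ k, pdMat c (jac ψ) y k d • conn G' k (ψ y)) +
      ∑ k, ∑ l, (jac ψ y k c * jac ψ y l d) • pdMat k (conn G' l) (ψ y) := by
    intro c d
    ext a b
    rw [pdMat_apply]
    simp only [hΩ, Matrix.sum_apply, Matrix.add_apply, Matrix.smul_apply, smul_eq_mul]
    rw [pd_sum _ fun k _ => ((h.smooth_jac k d).diffAt ho hy).fun_mul
      ((h.smooth_comp (h.right.smooth_conn k) a b).diffAt ho hy)]
    rw [Finset.sum_comm (γ := Fin n), ← Finset.sum_add_distrib]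
    refine Finset.sum_congr rfl fun k _ => ?_
    rw [pd_mul ((h.smooth_jac k d).diffAt ho hy)
      ((h.smooth_comp (h.right.smooth_conn k) a b).diffAt ho hy), h.pd_comp hy
      ((h.right.smooth_conn k a b).diffAt h.right.isOpen (h.mapsTo hy)), Finset.mul_sum]
    congr 1
    refine Finset.sum_congr rfl fun l _ => ?_
    rw [pdMat_apply]
    ring
  -- `Ω` is the pull-back of the connection form of `G'`. Its curvature is the pull-back of the
  -- curvature, because the second derivatives of `ψ` enter symmetrically in `c` and `d`.
  have hF : pdMat c (Ω d) y - pdMat d (Ω c) y + (Ω c y * Ω d y - Ω d y * Ω c y) =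
      ∑ k, ∑ l, (jac ψ y k c * jac ψ y l d) • curv G' (ψ y) k l := by
    have e1 : ∑ k, pdMat c (jac ψ) y k d • conn G' k (ψ y) =
        ∑ k, pdMat d (jac ψ) y k c • conn G' k (ψ y) :=
      Finset.sum_congr rfl fun k _ => by rw [h.pdMat_jac_symm hy]
    have e2 : ∑ k, ∑ l, (jac ψ y k d * jac ψ y l c) • pdMat k (conn G' l) (ψ y) =
        ∑ k, ∑ l, (jac ψ y k c * jac ψ y l d) • pdMat l (conn G' k) (ψ y) := by
      rw [Finset.sum_comm]
      exact Finset.sum_congr rfl fun k _ => Finset.sum_congr rfl fun l _ => by rw [mul_comm]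
    have e3 : Ω c y * Ω d y = ∑ k, ∑ l, (jac ψ y k c * jac ψ y l d) •
        (conn G' k (ψ y) * conn G' l (ψ y)) := by
      simp only [hΩ, Finset.sum_mul_sum, Matrix.smul_mul, Matrix.mul_smul, smul_smul]
      exact Finset.sum_congr rfl fun k _ => Finset.sum_congr rfl fun l _ => by rw [mul_comm]
    have e4 : Ω d y * Ω c y = ∑ k, ∑ l, (jac ψ y k c * jac ψ y l d) •
        (conn G' l (ψ y) * conn G' k (ψ y)) := by
      simp only [hΩ, Finset.sum_mul_sum, Matrix.smul_mul, Matrix.mul_smul, smul_smul]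
      rw [Finset.sum_comm]
    rw [hD, hD, e1, e2, e3, e4]
    simp only [curv, smul_add, smul_sub, Finset.sum_add_distrib, Finset.sum_sub_distrib]
    abel
  rw [← hF]
  -- The law for the Christoffel symbols reads `∂_c J = J Γ_c - Ω_c J`. Differentiated once more and
  -- antisymmetrised, it becomes the claim, since the second derivatives of `J` are symmetric.
  have hJ : ∀ c, pdMat c (jac ψ) y = jac ψ y * conn G c y - Ω c y * jac ψ y := fun c => by
    rw [h.jac_mul_conn hy c]
    simp [hΩ]
  have hJJ : ∀ c d, pdMat c (pdMat d (jac ψ)) y =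
      pdMat c (jac ψ) y * conn G d y + jac ψ y * pdMat c (conn G d) y
        - (pdMat c (Ω d) y * jac ψ y + Ω d y * pdMat c (jac ψ) y) := by
    intro c d
    have hs := pdMat_mul (i := c) ho hy h.smooth_jac (h.left.smooth_conn d)
    rw [pdMat_congr_of_isOpen ho hy fun z hz => h.jac_mul_conn hz d,
      pdMat_add ho hy ((hΩs d).mul h.smooth_jac) (h.smooth_jac.pdMat ho),
      pdMat_mul ho hy (hΩs d) h.smooth_jac] at hs
    rw [← hs]
    abel
  have hc := pdMat_comm (i := c) (j := d) ho hy h.smooth_jac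
  rw [hJJ, hJJ, hJ, hJ] at hc
  simp only [curv, Matrix.add_mul, Matrix.sub_mul, Matrix.mul_add, Matrix.mul_sub,
    Matrix.mul_assoc] at hc ⊢
  rw [← sub_eq_zero] at hc ⊢
  rw [← hc]
  abel

theorem inv_metric (h : IsPullback G U G' U' ψ) (hy : y ∈ U) :
    (G y)⁻¹ = (jac ψ y)⁻¹ * (G' (ψ y))⁻¹ * ((jac ψ y)⁻¹)ᵀ := by
  rw [h.metric y hy, Matrix.mul_inv_rev, Matrix.mul_inv_rev, Matrix.transpose_nonsing_inv,
    Matrix.mul_assoc]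

/-- The contracted pair of indices transforms with `J⁻¹` and `J`, which cancel by
`sum_contraction_eq`; the two free indices keep one Jacobian each. -/
theorem ricci_eq (h : IsPullback G U G' U' ψ) (hy : y ∈ U) :
    ricci G y = (jac ψ y)ᵀ * ricci G' (ψ y) * jac ψ y := by
  have hJ := h.isUnit_jac hy
  have hc : ∀ c d, curv G y c d = (jac ψ y)⁻¹ *
      ∑ k, jac ψ y k c • ((∑ l, jac ψ y l d • curv G' (ψ y) k l) * jac ψ y) := by
    intro c d
    rw [← Matrix.nonsing_inv_mul_cancel_left _ (curv G y c d) hJ, h.jac_mul_curv hy]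
    simp only [Matrix.sum_mul, Finset.smul_sum, smul_smul, Matrix.smul_mul]
  ext b d
  simp only [ricci, Matrix.of_apply, h.left.riemannUp_eq hy, h.right.riemannUp_eq (h.mapsTo hy), hc]
  rw [sum_contraction_eq hJ fun k => (∑ l, jac ψ y l d • curv G' (ψ y) k l) * jac ψ y]
  simp only [Matrix.mul_apply, Matrix.sum_apply, Matrix.smul_apply, smul_eq_mul, Finset.sum_mul,
    Matrix.transpose_apply, Matrix.of_apply, Finset.mul_sum]
  rw [Finset.sum_comm]
  conv_rhs => rw [Finset.sum_comm]
  refine Finset.sum_congr rfl fun m _ => ?_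
  rw [Finset.sum_comm]
  exact Finset.sum_congr rfl fun l _ => Finset.sum_congr rfl fun k _ => by ring

theorem tr_eq (h : IsPullback G U G' U' ψ) (hy : y ∈ U) (S : Matrix (Fin n) (Fin n) ℝ) :
    tr G y ((jac ψ y)ᵀ * S * jac ψ y) = tr G' (ψ y) S := by
  have hJ := h.isUnit_jac hy
  rw [tr, tr, h.inv_metric hy, Matrix.transpose_nonsing_inv]
  simp only [Matrix.mul_assoc]
  rw [Matrix.nonsing_inv_mul_cancel_left _ _ (by rwa [Matrix.det_transpose]), Matrix.trace_mul_comm]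
  simp only [Matrix.mul_assoc]
  rw [Matrix.mul_nonsing_inv _ hJ, Matrix.mul_one]

theorem dot_eq (h : IsPullback G U G' U' ψ) (hy : y ∈ U) (S T : Matrix (Fin n) (Fin n) ℝ) :
    dot G y ((jac ψ y)ᵀ * S * jac ψ y) ((jac ψ y)ᵀ * T * jac ψ y) =
      (jac ψ y)ᵀ * dot G' (ψ y) S T * jac ψ y := by
  have hJ := h.isUnit_jac hy
  rw [dot, dot, h.inv_metric hy, Matrix.transpose_nonsing_inv]
  simp only [Matrix.mul_assoc]
  rw [Matrix.nonsing_inv_mul_cancel_left _ _ (by rwa [Matrix.det_transpose]),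
    Matrix.mul_nonsing_inv_cancel_left _ _ hJ]

theorem scal_eq (h : IsPullback G U G' U' ψ) (hy : y ∈ U) : scal G y = scal G' (ψ y) := by
  rw [scal, h.ricci_eq hy, h.tr_eq hy, scal]

end IsPullback

end Covariance

/-! ### Covariance of the four-dimensional concomitants -/

section Covariance4

/-- The conditions on `ν` and `φ` at a point of a coordinate domain. -/
def SphericalConditions (G : Field4) (ν φ : (Fin 4 → ℝ) → ℝ) (y : Fin 4 → ℝ) : Prop :=
  IsNu (bInv G y) (cInv G y) (dInv G y) (ν y) ∧
  IsDoubleWeylEigenvalue G y (φ y) ∧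
  tr G y (P G ν y) ≠ 0 ∧
  dot G y (hProj G ν y) (hProj G ν y) = hProj G ν y ∧
  IsSpaceLike G (hProj G ν) y ∧
  WarpedEq G (hProj G ν) y ∧
  IsClosedAt (divergence G (hProj G ν)) y ∧
  0 < kappa G ν φ y ∧
  KillsDifferential G (hProj G ν) (kappa G ν φ) y

/-- The covariant derivative `(∇_α H_{βγ})_{βγ}` as a matrix. -/
def nablaMat (G H : Field4) (α : Fin 4) (y : Fin 4 → ℝ) : Matrix (Fin 4) (Fin 4) ℝ :=
  pdMat α H y - ((conn G α y)ᵀ * H y + H y * conn G α y)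

theorem nabla_eq (G H : Field4) (y : Fin 4 → ℝ) (α β γ : Fin 4) :
    nabla G H y α β γ = nablaMat G H α y β γ := by
  simp only [nabla, nablaMat, Matrix.sub_apply, Matrix.add_apply, Matrix.mul_apply,
    Finset.sum_add_distrib, pdMat_apply, Matrix.transpose_apply, conn, Matrix.of_apply]
  simp only [mul_comm]

theorem divergence_eq (G H : Field4) (y : Fin 4 → ℝ) (γ : Fin 4) :
    divergence G H y γ = ∑ α, ((G y)⁻¹ * nablaMat G H α y) α γ := by
  simp only [divergence, nabla_eq, Matrix.mul_apply]

theorem kappa_eq (G : Field4) (ν φ : (Fin 4 → ℝ) → ℝ) (y : Fin 4 → ℝ) :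
    kappa G ν φ y = -2 * φ y - scal G y / 6 + (ν y + scal G y / 4) + (1 / 4) *
      (divergence G (hProj G ν) y ⬝ᵥ (G y)⁻¹ *ᵥ divergence G (hProj G ν) y) := by
  simp only [kappa, dotProduct, Matrix.mulVec, Finset.mul_sum]
  congr 1
  exact Finset.sum_congr rfl fun _ _ => Finset.sum_congr rfl fun _ _ => by ring

/-- The Riemann tensor contracted with a contravariant 2-tensor. -/
def riemannContract {n : ℕ} (G : (Fin n → ℝ) → Matrix (Fin n) (Fin n) ℝ) (y : Fin n → ℝ)
    (X : Matrix (Fin n) (Fin n) ℝ) : Matrix (Fin n) (Fin n) ℝ :=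
  ∑ c, ∑ d, X c d • (G y * curv G y c d)

theorem IsPullback.riemannContract_eq {n : ℕ} {G G' : (Fin n → ℝ) → Matrix (Fin n) (Fin n) ℝ}
    {U U' : Set (Fin n → ℝ)} {ψ : (Fin n → ℝ) → Fin n → ℝ} {y : Fin n → ℝ}
    (h : IsPullback G U G' U' ψ) (hy : y ∈ U) (X : Matrix (Fin n) (Fin n) ℝ) :
    riemannContract G y X = (jac ψ y)ᵀ *
      riemannContract G' (ψ y) (jac ψ y * X * (jac ψ y)ᵀ) * jac ψ y := by
  have h1 : riemannContract G y X = (jac ψ y)ᵀ * (G' (ψ y) * (∑ c, ∑ d, X c d •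
      ∑ k, ∑ l, (jac ψ y k c * jac ψ y l d) • curv G' (ψ y) k l)) * jac ψ y := by
    simp only [riemannContract, h.metric y hy, Matrix.mul_assoc, h.jac_mul_curv hy]
    simp only [Matrix.mul_sum, Matrix.sum_mul, Matrix.mul_smul, Matrix.smul_mul]
  rw [h1, riemannContract]
  congr 2
  simp only [Finset.smul_sum, smul_smul]
  have h2 : ∀ k l, (jac ψ y * X * (jac ψ y)ᵀ) k l =
      ∑ c, ∑ d, X c d * (jac ψ y k c * jac ψ y l d) := by
    intro k l
    simp only [Matrix.mul_apply, Matrix.transpose_apply, Finset.sum_mul]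
    rw [Finset.sum_comm]
    exact Finset.sum_congr rfl fun _ _ => Finset.sum_congr rfl fun _ _ => by ring
  simp only [h2, Finset.sum_smul, Matrix.mul_sum, Matrix.mul_smul]
  have e1 : ∀ f : Fin n → Fin n → Fin n → Fin n → Matrix (Fin n) (Fin n) ℝ,
      ∑ c, ∑ d, ∑ k, ∑ l, f c d k l = ∑ k, ∑ l, ∑ c, ∑ d, f c d k l := by
    intro f
    have : ∀ c, ∑ d, ∑ k, ∑ l, f c d k l = ∑ k, ∑ l, ∑ d, f c d k l := fun c => by
      rw [Finset.sum_comm]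
      exact Finset.sum_congr rfl fun _ _ => Finset.sum_comm
    simp only [this]
    rw [Finset.sum_comm]
    exact Finset.sum_congr rfl fun _ _ => Finset.sum_comm
  exact e1 _

/-- In terms of matrix products the transformation law of the Weyl map can be read off from those of
`riemannContract`, `ricci` and `scal`. The antisymmetrisation `X - Xᵀ` comes from the antisymmetry
of each Kulkarni-Nomizu term in its last two indices. -/
theorem weylMap_eq {G : Field4} {U : Set (Fin 4 → ℝ)} {y : Fin 4 → ℝ} (hG : IsMetricOn G U)
    (hy : y ∈ U) (F X : Matrix (Fin 4) (Fin 4) ℝ) (hX : X = (G y)⁻¹ * F * (G y)⁻¹) :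
    weylMap G y F = (1 / 2 : ℝ) • riemannContract G y X
      - (1 / 4 : ℝ) • (G y * (X - Xᵀ) * ricci G y + ricci G y * (X - Xᵀ) * G y)
      + (scal G y / 12) • (G y * (X - Xᵀ) * G y) := by
  have h2 : ∀ A B : Matrix (Fin 4) (Fin 4) ℝ, Bᵀ = B → ∀ a b,
      (A * (X - Xᵀ) * B) a b = ∑ c, ∑ d, (A a c * B b d - A a d * B b c) * X c d := by
    intro A B hB a b
    have hB' : ∀ i j, B i j = B j i := fun i j => congrFun (congrFun hB.symm i) j
    simp only [sub_mul, Finset.sum_sub_distrib, Matrix.mul_sub, Matrix.sub_apply]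
    congr 1
    · simp only [Matrix.mul_apply, Finset.sum_mul]
      rw [Finset.sum_comm]
      exact Finset.sum_congr rfl fun c _ => Finset.sum_congr rfl fun d _ => by rw [hB' d b]; ring
    · simp only [Matrix.mul_apply, Finset.sum_mul, Matrix.transpose_apply]
      exact Finset.sum_congr rfl fun c _ => Finset.sum_congr rfl fun d _ => by rw [hB' c b]; ring
  ext a b
  simp only [weylMap, ← hX, Matrix.of_apply, Matrix.add_apply, Matrix.sub_apply, Matrix.smul_apply,
    smul_eq_mul, h2 _ _ (hG.symm y hy), h2 _ _ (hG.ricci_symm hy)]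
  simp only [riemannContract, Matrix.sum_apply, Matrix.smul_apply, smul_eq_mul,
    ← hG.riemann_eq hy, weyl, Finset.mul_sum, ← Finset.sum_add_distrib, ← Finset.sum_sub_distrib]
  exact Finset.sum_congr rfl fun c _ => Finset.sum_congr rfl fun d _ => by ring

namespace IsPullback

variable {G G' : Field4} {U U' : Set (Fin 4 → ℝ)} {ψ : (Fin 4 → ℝ) → Fin 4 → ℝ} {y : Fin 4 → ℝ}
  {ν ν' φ φ' : (Fin 4 → ℝ) → ℝ}

theorem weylMap_pullback (h : IsPullback G U G' U' ψ) (hy : y ∈ U)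
    (F : Matrix (Fin 4) (Fin 4) ℝ) :
    weylMap G y ((jac ψ y)ᵀ * F * jac ψ y) = (jac ψ y)ᵀ * weylMap G' (ψ y) F * jac ψ y := by
  have hJ := h.isUnit_jac hy
  set J := jac ψ y with hJdef
  set X' := (G' (ψ y))⁻¹ * F * (G' (ψ y))⁻¹ with hX'
  set X := J⁻¹ * X' * (J⁻¹)ᵀ with hX
  have hJT : IsUnit Jᵀ.det := by rwa [Matrix.det_transpose]
  have h1 : X = (G y)⁻¹ * (Jᵀ * F * J) * (G y)⁻¹ := by
    rw [h.inv_metric hy, hX, hX', ← hJdef, Matrix.transpose_nonsing_inv]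
    simp only [Matrix.mul_assoc]
    rw [Matrix.nonsing_inv_mul_cancel_left _ _ hJT, Matrix.mul_nonsing_inv_cancel_left _ _ hJ]
  have h2 : J * X * Jᵀ = X' := by
    rw [hX, Matrix.transpose_nonsing_inv]
    simp only [Matrix.mul_assoc]
    rw [Matrix.nonsing_inv_mul _ hJT, Matrix.mul_one, Matrix.mul_nonsing_inv_cancel_left _ _ hJ]
  have h3 : J * (X - Xᵀ) * Jᵀ = X' - X'ᵀ := by
    rw [← h2]
    simp only [Matrix.mul_sub, Matrix.sub_mul, Matrix.transpose_mul, Matrix.transpose_transpose,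
      Matrix.mul_assoc]
  have h4 : ∀ A B : Matrix (Fin 4) (Fin 4) ℝ, Jᵀ * A * J * (X - Xᵀ) * (Jᵀ * B * J) =
      Jᵀ * (A * (X' - X'ᵀ) * B) * J := by
    intro A B
    rw [← h3]
    simp only [Matrix.mul_assoc]
  rw [weylMap_eq h.left hy _ X h1, weylMap_eq h.right (h.mapsTo hy) F X' rfl,
    h.riemannContract_eq hy, ← hJdef, h2, h.ricci_eq hy, h.metric y hy, h.scal_eq hy, ← hJdef, h4,
    h4, h4]
  simp only [Matrix.mul_add, Matrix.add_mul, Matrix.mul_sub, Matrix.sub_mul, Matrix.mul_smul,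
    Matrix.smul_mul]

/-- Congruence by the invertible Jacobian embeds the eigenspace at `ψ y` into the one at `y`, so the
dimension bound is inherited. -/
theorem isDoubleWeylEigenvalue (h : IsPullback G U G' U' ψ) (hy : y ∈ U) {w : ℝ}
    (hw : IsDoubleWeylEigenvalue G' (ψ y) w) : IsDoubleWeylEigenvalue G y w := by
  have hJ := h.isUnit_jac hy
  have hJT : IsUnit (jac ψ y)ᵀ.det := by rwa [Matrix.det_transpose]
  let f : weylEigenspace G' (ψ y) w →ₗ[ℝ] weylEigenspace G y w :=
    { toFun := fun F => ⟨(jac ψ y)ᵀ * F * jac ψ y, by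
        refine ⟨?_, ?_⟩
        · rw [Matrix.transpose_mul, Matrix.transpose_mul, F.2.1, Matrix.transpose_transpose]
          simp [Matrix.mul_assoc]
        · rw [h.weylMap_pullback hy, F.2.2]
          simp⟩
      map_add' := fun F F' => by
        ext1
        simp [Matrix.mul_add, Matrix.add_mul]
      map_smul' := fun s F => by
        ext1
        simp }
  refine hw.trans (LinearMap.finrank_le_finrank_of_injective (f := f) ?_)
  intro F F' hF
  have h1 : (jac ψ y)ᵀ * F.1 * jac ψ y = (jac ψ y)ᵀ * F'.1 * jac ψ y := congrArg Subtype.val hF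
  have h2 := congrArg (fun A => ((jac ψ y)ᵀ)⁻¹ * A * (jac ψ y)⁻¹) h1
  simp only [Matrix.mul_assoc, Matrix.mul_nonsing_inv _ hJ, Matrix.mul_one,
    Matrix.nonsing_inv_mul_cancel_left _ _ hJT] at h2
  exact Subtype.ext h2

theorem tracelessRicci_eq (h : IsPullback G U G' U' ψ) (hy : y ∈ U) :
    tracelessRicci G y = (jac ψ y)ᵀ * tracelessRicci G' (ψ y) * jac ψ y := by
  rw [tracelessRicci, tracelessRicci, h.ricci_eq hy, h.scal_eq hy]
  conv_lhs => rw [h.metric y hy]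
  simp only [Matrix.mul_sub, Matrix.sub_mul, Matrix.mul_smul, Matrix.smul_mul]

theorem bInv_eq (h : IsPullback G U G' U' ψ) (hy : y ∈ U) : bInv G y = bInv G' (ψ y) := by
  rw [bInv, bInv, h.tracelessRicci_eq hy, h.dot_eq hy, h.tr_eq hy]

theorem cInv_eq (h : IsPullback G U G' U' ψ) (hy : y ∈ U) : cInv G y = cInv G' (ψ y) := by
  rw [cInv, cInv, h.tracelessRicci_eq hy, h.dot_eq hy, h.dot_eq hy, h.tr_eq hy]

theorem dInv_eq (h : IsPullback G U G' U' ψ) (hy : y ∈ U) : dInv G y = dInv G' (ψ y) := by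
  rw [dInv, dInv, h.tracelessRicci_eq hy, h.dot_eq hy, h.dot_eq hy, h.tr_eq hy]

theorem P_eq (h : IsPullback G U G' U' ψ) (hy : y ∈ U) (hν : ν y = ν' (ψ y)) :
    P G ν y = (jac ψ y)ᵀ * P G' ν' (ψ y) * jac ψ y := by
  rw [P, P, h.tracelessRicci_eq hy, h.dot_eq hy, h.bInv_eq hy, hν]
  conv_lhs => rw [h.metric y hy]
  simp only [Matrix.mul_add, Matrix.add_mul, Matrix.mul_smul, Matrix.smul_mul]

theorem tr_P_eq (h : IsPullback G U G' U' ψ) (hy : y ∈ U) (hν : ν y = ν' (ψ y)) :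
    tr G y (P G ν y) = tr G' (ψ y) (P G' ν' (ψ y)) := by
  rw [h.P_eq hy hν, h.tr_eq hy]

theorem hProj_eq (h : IsPullback G U G' U' ψ) (hy : y ∈ U) (hν : ν y = ν' (ψ y)) :
    hProj G ν y = (jac ψ y)ᵀ * hProj G' ν' (ψ y) * jac ψ y := by
  rw [hProj, hProj, h.tr_P_eq hy hν, h.P_eq hy hν]
  simp only [Matrix.mul_smul, Matrix.smul_mul]

/-- The terms with second derivatives of `ψ` that arise from differentiating the pulled back tensor
cancel against the inhomogeneous term in the law for the Christoffel symbols. -/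
theorem nablaMat_eq (h : IsPullback G U G' U' ψ) (hy : y ∈ U) {H H' : Field4}
    (hH' : MatrixSmoothOn H' U') (hH : ∀ z ∈ U, H z = (jac ψ z)ᵀ * H' (ψ z) * jac ψ z)
    (α : Fin 4) : nablaMat G H α y =
      (jac ψ y)ᵀ * (∑ k, jac ψ y k α • nablaMat G' H' k (ψ y)) * jac ψ y := by
  have hc := h.jac_mul_conn hy α
  have hcT := congrArg Matrix.transpose hc
  rw [Matrix.transpose_mul] at hcT
  rw [nablaMat, h.pdMat_tensor hy hH' hH, hH y hy]
  have e1 : (conn G α y)ᵀ * ((jac ψ y)ᵀ * H' (ψ y) * jac ψ y) =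
      ((conn G α y)ᵀ * (jac ψ y)ᵀ) * H' (ψ y) * jac ψ y := by simp only [Matrix.mul_assoc]
  rw [e1, hcT, Matrix.mul_assoc _ (jac ψ y) (conn G α y), hc]
  have e2 : ∑ k, jac ψ y k α • nablaMat G' H' k (ψ y) =
      (∑ k, jac ψ y k α • pdMat k H' (ψ y)) -
      ((∑ k, jac ψ y k α • conn G' k (ψ y))ᵀ * H' (ψ y)
        + H' (ψ y) * ∑ k, jac ψ y k α • conn G' k (ψ y)) := by
    simp only [nablaMat, smul_sub, smul_add, Finset.sum_sub_distrib, Finset.sum_add_distrib,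
      Matrix.transpose_sum, Matrix.sum_mul, Matrix.mul_sum, Matrix.transpose_smul, Matrix.smul_mul,
      Matrix.mul_smul]
  rw [e2]
  simp only [Matrix.mul_sub, Matrix.sub_mul, Matrix.mul_add, Matrix.add_mul, Matrix.transpose_add,
    Matrix.transpose_mul, Matrix.mul_assoc]
  abel

theorem divergence_pullback (h : IsPullback G U G' U' ψ) (hy : y ∈ U) {H H' : Field4}
    (hH' : MatrixSmoothOn H' U') (hH : ∀ z ∈ U, H z = (jac ψ z)ᵀ * H' (ψ z) * jac ψ z) :
    divergence G H y = (jac ψ y)ᵀ *ᵥ divergence G' H' (ψ y) := by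
  have hJ := h.isUnit_jac hy
  have hJT : IsUnit (jac ψ y)ᵀ.det := by rwa [Matrix.det_transpose]
  ext γ
  have e1 : ∀ α, (G y)⁻¹ * nablaMat G H α y = (jac ψ y)⁻¹ * ∑ k, jac ψ y k α •
      ((G' (ψ y))⁻¹ * nablaMat G' H' k (ψ y) * jac ψ y) := by
    intro α
    rw [h.nablaMat_eq hy hH' hH, h.inv_metric hy, Matrix.transpose_nonsing_inv]
    simp only [Matrix.mul_assoc]
    rw [Matrix.nonsing_inv_mul_cancel_left _ _ hJT]
    simp only [Matrix.mul_sum, Matrix.sum_mul, Matrix.smul_mul, Matrix.mul_smul]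
  rw [divergence_eq]
  simp only [e1]
  rw [sum_contraction_eq hJ fun k => (G' (ψ y))⁻¹ * nablaMat G' H' k (ψ y) * jac ψ y]
  simp only [Matrix.mulVec, dotProduct, divergence_eq, Finset.mul_sum, Matrix.transpose_apply]
  rw [Finset.sum_comm]
  refine Finset.sum_congr rfl fun k _ => ?_
  rw [Matrix.mul_apply]
  exact Finset.sum_congr rfl fun _ _ => by ring

/-- The conditions on `ν` and `φ` do not depend on the coordinates. -/
theorem sphericalConditions (h : IsPullback G U G' U' ψ) (hy : y ∈ U)
    (hν : ∀ z ∈ U, ν z = ν' (ψ z)) (hφ : ∀ z ∈ U, φ z = φ' (ψ z))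
    (hh : MatrixSmoothOn (hProj G' ν') U')
    (hξ : ∀ γ, ContDiffOn ℝ ∞ (fun z => divergence G' (hProj G' ν') z γ) U')
    (hκ : ContDiffOn ℝ ∞ (kappa G' ν' φ') U')
    (hc : SphericalConditions G' ν' φ' (ψ y)) : SphericalConditions G ν φ y := by
  obtain ⟨h1, h2, h3, h4, h5, h6, h7, h8, h9⟩ := hc
  have hJ := h.isUnit_jac hy
  have hJT : IsUnit (jac ψ y)ᵀ.det := by rwa [Matrix.det_transpose]
  have hH : ∀ z ∈ U, hProj G ν z = (jac ψ z)ᵀ * hProj G' ν' (ψ z) * jac ψ z :=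
    fun z hz => h.hProj_eq hz (hν z hz)
  have hdiv : ∀ z ∈ U, divergence G (hProj G ν) z =
      (jac ψ z)ᵀ *ᵥ divergence G' (hProj G' ν') (ψ z) :=
    fun z hz => h.divergence_pullback hz hh hH
  have hkap : ∀ z ∈ U, kappa G ν φ z = kappa G' ν' φ' (ψ z) := by
    intro z hz
    have hJz := h.isUnit_jac hz
    rw [kappa_eq, kappa_eq, hdiv z hz, hν z hz, hφ z hz, h.scal_eq hz, h.inv_metric hz]
    congr 2
    rw [Matrix.transpose_nonsing_inv, Matrix.mulVec_transpose, ← Matrix.dotProduct_mulVec,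
      Matrix.mulVec_mulVec, ← Matrix.mulVec_transpose, Matrix.mulVec_mulVec]
    congr 2
    rw [Matrix.mul_assoc, Matrix.mul_assoc, Matrix.mul_assoc, Matrix.nonsing_inv_mul _
      (by rwa [Matrix.det_transpose]), Matrix.mul_one, Matrix.mul_nonsing_inv_cancel_left _ _ hJz]
  refine ⟨?_, ?_, ?_, ?_, ?_, ?_, ?_, ?_, ?_⟩
  · rwa [h.bInv_eq hy, h.cInv_eq hy, h.dInv_eq hy, hν y hy]
  · rw [hφ y hy]
    exact h.isDoubleWeylEigenvalue hy h2
  · rwa [h.tr_P_eq hy (hν y hy)]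
  · rw [hH y hy, h.dot_eq hy, h4]
  · intro x hx
    have e : ∀ A : Matrix (Fin 4) (Fin 4) ℝ, x ⬝ᵥ ((jac ψ y)ᵀ * A * jac ψ y) *ᵥ x =
        (jac ψ y *ᵥ x) ⬝ᵥ A *ᵥ (jac ψ y *ᵥ x) := by
      intro A
      rw [← Matrix.mulVec_mulVec, ← Matrix.mulVec_mulVec, Matrix.dotProduct_mulVec,
        Matrix.vecMul_transpose]
    rw [h.metric y hy, e] at hx
    rw [hH y hy, e]
    exact h5 _ hx
  · intro α β γ
    set ξ' := divergence G' (hProj G' ν') (ψ y)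
    -- Written with rank-one matrices, the right-hand side transforms by applying `Jᵀ` to each
    -- vector factor.
    have e : ∀ k, (2 : ℝ) • nablaMat G' (hProj G' ν') k (ψ y) =
        Matrix.vecMulVec (hProj G' ν' (ψ y) k) ξ' + Matrix.vecMulVec ξ' (hProj G' ν' (ψ y) k) := by
      intro k
      ext b c
      rw [Matrix.smul_apply, smul_eq_mul, ← nabla_eq, h6 k b c]
      simp only [Matrix.add_apply, Matrix.vecMulVec_apply]
      ring
    have e2 : (2 : ℝ) • nablaMat G (hProj G ν) α y =
        Matrix.vecMulVec (hProj G ν y α) ((jac ψ y)ᵀ *ᵥ ξ')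
          + Matrix.vecMulVec ((jac ψ y)ᵀ *ᵥ ξ') (hProj G ν y α) := by
      have e3 : hProj G ν y α = (jac ψ y)ᵀ *ᵥ (∑ k, jac ψ y k α • hProj G' ν' (ψ y) k) := by
        ext β
        rw [hH y hy]
        simp only [Matrix.mul_apply, Matrix.mulVec, dotProduct, Matrix.transpose_apply,
          Finset.sum_apply, Pi.smul_apply, smul_eq_mul]
        exact Finset.sum_congr rfl fun _ _ => by ring
      have e4 : (2 : ℝ) • ∑ k, jac ψ y k α • nablaMat G' (hProj G' ν') k (ψ y) =
          Matrix.vecMulVec (∑ k, jac ψ y k α • hProj G' ν' (ψ y) k) ξ' +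
          Matrix.vecMulVec ξ' (∑ k, jac ψ y k α • hProj G' ν' (ψ y) k) := by
        rw [Finset.smul_sum]
        simp only [smul_comm (2 : ℝ), e]
        ext b c
        simp only [Matrix.sum_apply, Matrix.add_apply, Matrix.smul_apply, Matrix.vecMulVec_apply,
          Finset.sum_apply, Pi.smul_apply, smul_eq_mul, Finset.sum_mul, Finset.mul_sum,
          ← Finset.sum_add_distrib]
        exact Finset.sum_congr rfl fun _ _ => by ring
      rw [h.nablaMat_eq hy hh hH, e3, ← Matrix.smul_mul, ← Matrix.mul_smul, e4, Matrix.mul_add,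
        Matrix.add_mul, Matrix.mul_vecMulVec, Matrix.mul_vecMulVec, Matrix.vecMulVec_mul,
        Matrix.vecMulVec_mul, ← Matrix.mulVec_transpose, ← Matrix.mulVec_transpose]
    have e3 := congrFun (congrFun e2 β) γ
    rw [nabla_eq, hdiv y hy]
    refine (e3.trans ?_)
    simp only [Matrix.add_apply, Matrix.vecMulVec_apply]
    ring
  · have ho := h.left.isOpen
    -- The product rule produces a second derivative of `ψ`, symmetric in `α` and `β`, and a term
    -- quadratic in the Jacobian, symmetric because `ξ'` is closed.
    have e : ∀ α β, pd α (fun z => divergence G (hProj G ν) z β) y =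
        ∑ b, (pdMat α (jac ψ) y b β * divergence G' (hProj G' ν') (ψ y) b +
          jac ψ y b β * ∑ k, jac ψ y k α *
            pd k (fun z => divergence G' (hProj G' ν') z b) (ψ y)) := by
      intro α β
      have e1 : pd α (fun z => divergence G (hProj G ν) z β) y = pd α (fun z => ∑ b,
          jac ψ z b β * divergence G' (hProj G' ν') (ψ z) b) y :=
        pd_congr_of_isOpen ho hy fun z hz => by
          rw [hdiv z hz]
          rfl
      rw [e1, pd_sum _ fun b _ => ((h.smooth_jac b β).diffAt ho hy).fun_mul
        ((h.contDiffOn_comp (hξ b)).diffAt ho hy)]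
      refine Finset.sum_congr rfl fun b _ => ?_
      rw [pd_mul ((h.smooth_jac b β).diffAt ho hy) ((h.contDiffOn_comp (hξ b)).diffAt ho hy),
        h.pd_comp hy ((hξ b).diffAt h.right.isOpen (h.mapsTo hy))]
      rfl
    intro α β
    rw [e, e, Finset.sum_add_distrib, Finset.sum_add_distrib]
    congr 1
    · exact Finset.sum_congr rfl fun b _ => by rw [h.pdMat_jac_symm hy]
    · simp only [Finset.mul_sum]
      rw [Finset.sum_comm]
      refine Finset.sum_congr rfl fun k _ => Finset.sum_congr rfl fun b _ => ?_
      rw [h7 k b]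
      ring
  · rwa [hkap y hy]
  · have e1 : (fun γ => pd γ (kappa G ν φ) y) =
        (jac ψ y)ᵀ *ᵥ fun k => pd k (kappa G' ν' φ') (ψ y) := by
      ext γ
      rw [pd_congr_of_isOpen h.left.isOpen hy hkap,
        h.pd_comp hy (hκ.diffAt h.right.isOpen (h.mapsTo hy))]
      rfl
    have e2 : ∀ (A B : Matrix (Fin 4) (Fin 4) ℝ) (v : Fin 4 → ℝ) α,
        ∑ β, ∑ γ, A α β * B β γ * v γ = ((A * B) *ᵥ v) α := by
      intro A B v α
      simp only [Matrix.mulVec, dotProduct, Matrix.mul_apply, Finset.sum_mul]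
      rw [Finset.sum_comm]
    have e3 : (hProj G' ν' (ψ y) * (G' (ψ y))⁻¹) *ᵥ
        (fun k => pd k (kappa G' ν' φ') (ψ y)) = 0 := by
      ext α
      rw [← e2]
      exact h9 α
    intro α
    rw [e2 _ _ fun γ => pd γ (kappa G ν φ) y, e1, hH y hy, h.inv_metric hy,
      Matrix.transpose_nonsing_inv, Matrix.mulVec_mulVec]
    simp only [Matrix.mul_assoc]
    rw [Matrix.nonsing_inv_mul _ hJT, Matrix.mul_one, Matrix.mul_nonsing_inv_cancel_left _ _ hJ,
      ← Matrix.mulVec_mulVec, e3, Matrix.mulVec_zero]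
    rfl

end IsPullback

end Covariance4

/-! ### Smooth local inverses -/

section Inverse

/-- The inverse function theorem for `C^∞` maps, with smoothness on full domains. -/
theorem exists_smooth_openPartialHomeomorph {E F : Type*} [NormedAddCommGroup E] [NormedSpace ℝ E]
    [CompleteSpace E] [NormedAddCommGroup F] [NormedSpace ℝ F] {f : E → F} {U : Set E} (hU : IsOpen U)
    (hf : ContDiffOn ℝ ∞ f U) {a : E} (ha : a ∈ U) {f' : E ≃L[ℝ] F}
    (hf' : HasFDerivAt f (f' : E →L[ℝ] F) a) :
    ∃ e : OpenPartialHomeomorph E F, a ∈ e.source ∧ e.source ⊆ U ∧ (∀ x, e x = f x) ∧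
      ContDiffOn ℝ ∞ e.symm e.target ∧
      ∀ x ∈ e.source, ∃ A : E ≃L[ℝ] F, HasFDerivAt f (A : E →L[ℝ] F) x ∧
        HasFDerivAt e.symm (A.symm : F →L[ℝ] E) (f x) := by
  have hfa : ContDiffAt ℝ ∞ f a := hf.contDiffAt (hU.mem_nhds ha)
  set e₀ := hfa.toOpenPartialHomeomorph f hf' (by simp) with he₀
  have hcont : ContinuousOn (fderiv ℝ f) U := hf.continuousOn_fderiv_of_isOpen hU (by simp)
  -- The domain is cut down to the open set where the derivative is invertible, so that the inverse
  -- is smooth at every point of its domain and not only at the image of `a`.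
  set V := U ∩ fderiv ℝ f ⁻¹' (Set.range ((↑) : (E ≃L[ℝ] F) → E →L[ℝ] F)) with hV
  have hVo : IsOpen V := hcont.isOpen_inter_preimage hU ContinuousLinearEquiv.isOpen
  have haV : a ∈ V := ⟨ha, ⟨f', hf'.fderiv.symm⟩⟩
  set e := e₀.restrOpen V hVo with he
  have hes : e.source = e₀.source ∩ V := e₀.restrOpen_source V hVo
  have hx : ∀ x ∈ e.source, ∃ A : E ≃L[ℝ] F, HasFDerivAt f (A : E →L[ℝ] F) x := by
    intro x hx
    rw [hes] at hx
    obtain ⟨A, hA⟩ := hx.2.2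
    refine ⟨A, ?_⟩
    rw [hA]
    exact ((hf.contDiffAt (hU.mem_nhds hx.2.1)).differentiableAt (by simp)).hasFDerivAt
  have hef : ∀ x, e x = f x := fun x => rfl
  refine ⟨e, ?_, ?_, hef, ?_, ?_⟩
  · rw [hes]
    exact ⟨hfa.mem_toOpenPartialHomeomorph_source hf' (by simp), haV⟩
  · rw [hes]
    exact fun x hx => hx.2.1
  · intro z hz
    have hz' := e.map_target hz
    obtain ⟨A, hA⟩ := hx _ hz'
    have hU' : e.symm z ∈ U := by
      rw [hes] at hz'
      exact hz'.2.1
    exact (e.contDiffAt_symm hz (f₀' := A) hA (hf.contDiffAt (hU.mem_nhds hU'))).contDiffWithinAt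
  · intro x hxs
    obtain ⟨A, hA⟩ := hx x hxs
    refine ⟨A, hA, ?_⟩
    have := e.hasFDerivAt_symm (a := f x) (f' := A) (e.map_source hxs)
      (by rw [show e.symm (f x) = x from e.left_inv hxs]; exact hA)
    exact this

end Inverse

/-! ### Composition operators and integration on `C([0,1], X)` -/

section CurveSpace

universe u

open unitInterval

variable {X Y Z : Type*} [NormedAddCommGroup X] [NormedSpace ℝ X] [NormedAddCommGroup Y]
  [NormedSpace ℝ Y] [NormedAddCommGroup Z] [NormedSpace ℝ Z] {K : Type*} [TopologicalSpace K]
  [CompactSpace K]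

/-- Pointwise application of a bilinear map to continuous functions. -/
def pointwiseBilin (β : X →L[ℝ] Y →L[ℝ] Z) : C(K, X) →L[ℝ] C(K, Y) →L[ℝ] C(K, Z) :=
  LinearMap.mkContinuous₂
    (LinearMap.mk₂ ℝ (fun (u : C(K, X)) (v : C(K, Y)) =>
        (⟨fun t => β (u t) (v t), by fun_prop⟩ : C(K, Z)))
      (fun _ _ _ => by ext; simp) (fun _ _ _ => by ext; simp) (fun _ _ _ => by ext; simp)
      (fun _ _ _ => by ext; simp)) ‖β‖ (by
    intro u v
    rw [ContinuousMap.norm_le _ (by positivity)]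
    intro t
    refine (β.le_opNorm₂ _ _).trans ?_
    gcongr
    · exact u.norm_coe_le_norm t
    · exact v.norm_coe_le_norm t)

/-- Post-composition with a `C¹` map is differentiable on the space of continuous functions. -/
theorem hasFDerivAt_postcomp {f : X → Y} (hf : ContDiff ℝ 1 f) (u : C(K, X)) :
    HasFDerivAt (fun v : C(K, X) => (⟨f, hf.continuous⟩ : C(X, Y)).comp v)
      (pointwiseBilin (ContinuousLinearMap.id ℝ (X →L[ℝ] Y))
        ((⟨fderiv ℝ f, hf.continuous_fderiv (by simp)⟩ : C(X, X →L[ℝ] Y)).comp u)) u := by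
  set f' : C(X, X →L[ℝ] Y) := ⟨fderiv ℝ f, hf.continuous_fderiv (by simp)⟩
  have hcont : Continuous fun v : C(K, X) => f'.comp v := ContinuousMap.continuous_postcomp f'
  rw [hasFDerivAt_iff_isLittleO, Asymptotics.isLittleO_iff]
  intro ε hε
  -- Continuity of `v ↦ f' ∘ v` in the sup norm supplies a bound on `f'` that is uniform in `t`. It
  -- covers the whole segment from `u t` to `v t`, since each of its points is a value of a curve `u
  -- + θ(v - u)` still within `δ` of `u`.
  obtain ⟨δ, hδ, hδ'⟩ := (Metric.continuous_iff (α := C(K, X)) (β := C(K, X →L[ℝ] Y))).1 hcont u ε hε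
  filter_upwards [Metric.ball_mem_nhds u hδ] with v hv
  rw [ContinuousMap.norm_le _ (by positivity)]
  intro t
  have hseg : ∀ x ∈ segment ℝ (u t) (v t), ‖fderiv ℝ f x - fderiv ℝ f (u t)‖ ≤ ε := by
    intro x hx
    rw [segment_eq_image'] at hx
    obtain ⟨θ, hθ, rfl⟩ := hx
    set w : C(K, X) := u + θ • (v - u)
    have hw : dist w u < δ := by
      rw [dist_eq_norm]
      calc ‖w - u‖ = ‖θ • (v - u)‖ := by simp [w]
        _ ≤ 1 * ‖v - u‖ := by
          rw [norm_smul, Real.norm_of_nonneg hθ.1]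
          gcongr
          exact hθ.2
        _ < δ := by rwa [one_mul, ← dist_eq_norm]
    have h1 := (hδ' w hw).le
    have h2 := ((f'.comp w) - (f'.comp u)).norm_coe_le_norm t
    rw [← dist_eq_norm] at h2
    exact h2.trans h1
  have hm := (convex_segment (𝕜 := ℝ) (u t) (v t)).norm_image_sub_le_of_norm_hasFDerivWithin_le'
    (f := f) (f' := fderiv ℝ f) (φ := fderiv ℝ f (u t)) (C := ε)
    (fun x _ => (hf.differentiable (by simp) x).hasFDerivAt.hasFDerivWithinAt) hseg
    (left_mem_segment ℝ _ _) (right_mem_segment ℝ _ _)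
  refine hm.trans ?_
  gcongr
  exact (v - u).norm_coe_le_norm t

/-- Post-composition with a smooth map is smooth on the space of continuous functions. -/
theorem contDiff_postcomp {X : Type u} [NormedAddCommGroup X] [NormedSpace ℝ X]
    (n : ℕ) : ∀ {Y : Type u} [NormedAddCommGroup Y] [NormedSpace ℝ Y] {f : X → Y}
    (hf : ContDiff ℝ ∞ f),
    ContDiff ℝ n (fun v : C(K, X) => (⟨f, hf.continuous⟩ : C(X, Y)).comp v) := by
  -- The derivative of `f` has values in `X →L[ℝ] Y`, and the induction hypothesis is applied to it.
  -- Hence the target is generalised, and source and target share a universe.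
  induction n with
  | zero =>
    intro Y _ _ f hf
    rw [Nat.cast_zero, contDiff_zero]
    exact ContinuousMap.continuous_postcomp _
  | succ n ih =>
    intro Y _ _ f hf
    have hd := fun u : C(K, X) => hasFDerivAt_postcomp (K := K)
      (hf.of_le (by simp) : ContDiff ℝ 1 f) u
    rw [Nat.cast_succ, contDiff_succ_iff_fderiv]
    refine ⟨fun u => (hd u).differentiableAt, by simp, ?_⟩
    have hf' : ContDiff ℝ ∞ (fderiv ℝ f) := hf.fderiv_right (by simp)
    have := (pointwiseBilin (K := K) (ContinuousLinearMap.id ℝ (X →L[ℝ] Y))).contDiff.comp (ih hf')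
    convert this using 1
    exact funext fun u => (hd u).fderiv

/-- Constant curves. -/
def constCurve : X →L[ℝ] C(I, X) :=
  LinearMap.mkContinuous
    { toFun := fun x => ContinuousMap.const I x
      map_add' := fun _ _ => rfl
      map_smul' := fun _ _ => rfl } 1 (by
    intro x
    rw [one_mul, ContinuousMap.norm_le _ (norm_nonneg x)]
    exact fun _ => le_rfl)

@[simp]
theorem constCurve_apply (x : X) (t : I) : constCurve x t = x := rfl

/-- The primitive of a continuous curve on `[0,1]` that vanishes at `0`. -/
def primitive [CompleteSpace X] : C(I, X) →L[ℝ] C(I, X) :=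
  LinearMap.mkContinuous
    { toFun := fun u => ⟨fun t => ∫ τ in (0 : ℝ)..t, Set.IccExtend zero_le_one u τ, by
        have : Continuous fun t : ℝ => ∫ τ in (0 : ℝ)..t, Set.IccExtend zero_le_one u τ :=
          intervalIntegral.continuous_primitive
            (fun a b => (u.continuous.Icc_extend').intervalIntegrable a b) 0
        exact this.comp continuous_subtype_val⟩
      map_add' := fun u v => by
        ext t
        exact intervalIntegral.integral_add (u.continuous.Icc_extend'.intervalIntegrable _ _)
          (v.continuous.Icc_extend'.intervalIntegrable _ _)
      map_smul' := fun a u => by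
        ext t
        exact intervalIntegral.integral_smul a _ } 1 (by
    intro u
    rw [one_mul, ContinuousMap.norm_le _ (norm_nonneg u)]
    intro t
    refine (intervalIntegral.norm_integral_le_of_norm_le_const (C := ‖u‖)
      fun τ _ => u.norm_coe_le_norm _).trans ?_
    rw [sub_zero, abs_of_nonneg t.2.1]
    exact mul_le_of_le_one_right (norm_nonneg _) t.2.2)

theorem primitive_apply [CompleteSpace X] (u : C(I, X)) (t : I) :
    primitive u t = ∫ τ in (0 : ℝ)..t, Set.IccExtend zero_le_one u τ := rfl

end CurveSpace

/-! ### Integration of commuting frames -/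

section Frobenius

open unitInterval

variable {X : Type*} [NormedAddCommGroup X] [NormedSpace ℝ X] [CompleteSpace X]

/-- The defect of the integral equation `γ(t) = c + ∫₀ᵗ B(γ) s`. -/
def flowDefect (B : C(X, X →L[ℝ] X)) (p : (X × X) × C(I, X)) : C(I, X) :=
  p.2 - constCurve p.1.2 - primitive
    (pointwiseBilin (ContinuousLinearMap.id ℝ (X →L[ℝ] X)) (B.comp p.2) (constCurve p.1.1))

theorem contDiff_flowDefect {B : X → X →L[ℝ] X} (hB : ContDiff ℝ ∞ B) :
    ContDiff ℝ ∞ (flowDefect ⟨B, hB.continuous⟩) := by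
  rw [contDiff_infty]
  intro n
  have h1 : ContDiff ℝ n fun p : (X × X) × C(I, X) =>
      (⟨B, hB.continuous⟩ : C(X, X →L[ℝ] X)).comp p.2 :=
    (contDiff_postcomp (K := I) n hB).comp contDiff_snd
  have h2 : ContDiff ℝ n fun p : (X × X) × C(I, X) => constCurve p.1.1 :=
    (constCurve (X := X)).contDiff.comp (contDiff_fst.comp contDiff_fst)
  have h3 : ContDiff ℝ n fun p : (X × X) × C(I, X) => constCurve p.1.2 :=
    (constCurve (X := X)).contDiff.comp (contDiff_snd.comp contDiff_fst)
  have h4 := (ContinuousLinearMap.contDiff (F := C(I, X) →L[ℝ] C(I, X))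
    (pointwiseBilin (K := I) (ContinuousLinearMap.id ℝ (X →L[ℝ] X)))).comp h1
  exact (contDiff_snd.sub h3).sub ((primitive (X := X)).contDiff.comp (h4.clm_apply h2))

/-- This is the linearised integral equation: the integrand `B(γ) s` varies through the curve and
through the direction `s`, and the initial value contributes a constant curve. -/
theorem fderiv_flowDefect {B : X → X →L[ℝ] X} (hB : ContDiff ℝ ∞ B) (p q : (X × X) × C(I, X)) :
    fderiv ℝ (flowDefect ⟨B, hB.continuous⟩) p q = q.2 - constCurve q.1.2 - primitive
      (⟨fun t => fderiv ℝ B (p.2 t) (q.2 t) p.1.1 + B (p.2 t) q.1.1, by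
        have := hB.continuous
        have := hB.continuous_fderiv (by simp)
        fun_prop⟩) := by
  have h1 := (hasFDerivAt_postcomp (K := I) (hB.of_le (by simp) : ContDiff ℝ 1 B) p.2).comp p
    (hasFDerivAt_snd (𝕜 := ℝ) (E := X × X) (F := C(I, X)))
  have h2 := (constCurve (X := X)).hasFDerivAt.comp p
    ((hasFDerivAt_fst (𝕜 := ℝ) (p := p.1)).comp p (hasFDerivAt_fst (𝕜 := ℝ) (p := p)))
  have h3 := (constCurve (X := X)).hasFDerivAt.comp p
    ((hasFDerivAt_snd (𝕜 := ℝ) (p := p.1)).comp p (hasFDerivAt_fst (𝕜 := ℝ) (p := p)))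
  have h4 := (pointwiseBilin (K := I) (ContinuousLinearMap.id ℝ
    (X →L[ℝ] X))).hasFDerivAt_of_bilinear h1 h2
  have h5 := (((hasFDerivAt_snd (𝕜 := ℝ) (p := p)).sub h3).sub
    ((primitive (X := X)).hasFDerivAt.comp p h4)).fderiv
  have h6 := congrArg (fun A => A q) h5
  refine h6.trans ?_
  change q.2 - constCurve q.1.2 - primitive _ = _
  congr 2
  ext t
  change B (p.2 t) q.1.1 + fderiv ℝ B (p.2 t) (q.2 t) p.1.1 = _
  exact add_comm _ _

/-- A solution of the integral equation is differentiable in the extended parameter. -/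
theorem exists_hasDerivAt_of_flowDefect_eq_zero {B : X → X →L[ℝ] X} (hB : ContDiff ℝ ∞ B)
    {s c : X} {γ : C(I, X)} (hγ : flowDefect ⟨B, hB.continuous⟩ ((s, c), γ) = 0) :
    ∃ g : ℝ → X, (∀ t : I, g t = γ t) ∧ g 0 = c ∧
      ∀ t : ℝ, HasDerivAt g (B (Set.IccExtend zero_le_one γ t) s) t := by
  set u : C(I, X) := pointwiseBilin (ContinuousLinearMap.id ℝ (X →L[ℝ] X))
    ((⟨B, hB.continuous⟩ : C(X, X →L[ℝ] X)).comp γ) (constCurve s) with hu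
  -- With the curve continued by its end values, the right-hand side of the integral equation is
  -- defined for all real `t`. This gives two-sided derivatives also at `0` and `1`.
  refine ⟨fun t => c + ∫ τ in (0 : ℝ)..t, Set.IccExtend zero_le_one u τ, ?_, by simp, ?_⟩
  · intro t
    have h := congrArg (fun w : C(I, X) => w t) hγ
    simp only [flowDefect, ContinuousMap.sub_apply, constCurve_apply, ContinuousMap.zero_apply,
      primitive_apply] at h
    rw [sub_sub, sub_eq_zero] at h
    exact h.symm
  · intro t
    have := (intervalIntegral.integral_hasDerivAt_right
      (u.continuous.Icc_extend'.intervalIntegrable 0 t)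
      (u.continuous.Icc_extend' (h := zero_le_one)).stronglyMeasurable.stronglyMeasurableAtFilter
      (u.continuous.Icc_extend' (h := zero_le_one)).continuousAt).const_add c
    exact this

/-- Integration of a frame of commuting vector fields: `Φ(s, c)` is the point reached from `c` in time
one along the field `B · s`. -/
theorem exists_flow {B : X → X →L[ℝ] X} (hB : ContDiff ℝ ∞ B) {V : Set X} (hV : IsOpen V)
    (hcomm : ∀ y ∈ V, ∀ k l, fderiv ℝ B y (B y k) l = fderiv ℝ B y (B y l) k) {y₀ : X}
    (hy₀ : y₀ ∈ V) :
    ∃ (W : Set (X × X)) (Φ : X × X → X), IsOpen W ∧ (0, y₀) ∈ W ∧ ContDiffOn ℝ ∞ Φ W ∧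
      (∀ c, (0, c) ∈ W → Φ (0, c) = c) ∧
      ∀ p ∈ W, Φ p ∈ V ∧ ∀ k, fderiv ℝ Φ p (k, 0) = B (Φ p) k := by
  set D := flowDefect ⟨B, hB.continuous⟩ with hD
  have hDs : ContDiff ℝ ∞ D := contDiff_flowDefect hB
  -- The equation `D = 0` is solved for the curve as a function of `(s, c)` by inverting the map
  -- that keeps the parameters and records the defect.
  set Θ : (X × X) × C(I, X) → (X × X) × C(I, X) := fun p => (p.1, D p) with hΘ
  have hΘs : ContDiff ℝ ∞ Θ := contDiff_fst.prodMk hDs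
  have hDd : ∀ p, HasFDerivAt D (fderiv ℝ D p) p := fun p =>
    (hDs.differentiable (by simp) p).hasFDerivAt
  have hΘd : ∀ p, HasFDerivAt Θ
      ((ContinuousLinearMap.fst ℝ (X × X) C(I, X)).prod (fderiv ℝ D p)) p := fun p =>
    hasFDerivAt_fst.prodMk (hDd p)
  set a : (X × X) × C(I, X) := ((0, y₀), constCurve y₀) with ha
  have hDa : D a = 0 := by
    simp only [hD, flowDefect, ha, map_zero, sub_self]
  -- At `s = 0` the integrand `B(γ) s` does not react to a variation of the curve, so the partial
  -- derivative in the direction of curves is the identity.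
  have hA : ∀ γ, fderiv ℝ D a (0, γ) = γ := by
    intro γ
    rw [hD, fderiv_flowDefect hB]
    have h0 : ∀ w : C(I, X), (∀ t, w t = 0) → γ - constCurve (0 : X) - primitive w = γ := by
      intro w hw
      rw [show w = 0 from ContinuousMap.ext hw, map_zero, map_zero, sub_zero, sub_zero]
    exact h0 _ fun t => by simp [ha]
  set A₀ := fderiv ℝ D a with hA₀
  have hA' : ∀ q, A₀ q = A₀ (q.1, 0) + q.2 := by
    intro q
    conv_rhs => rw [← hA q.2, ← map_add]
    simp
  let L : ((X × X) × C(I, X)) ≃L[ℝ] ((X × X) × C(I, X)) :=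
    ContinuousLinearEquiv.equivOfInverse
      ((ContinuousLinearMap.fst ℝ (X × X) C(I, X)).prod A₀)
      ((ContinuousLinearMap.fst ℝ (X × X) C(I, X)).prod
        (ContinuousLinearMap.snd ℝ (X × X) C(I, X) - A₀.comp
          ((ContinuousLinearMap.inl ℝ (X × X) C(I, X)).comp
            (ContinuousLinearMap.fst ℝ (X × X) C(I, X)))))
      (fun q => by
        ext1
        · rfl
        · change A₀ q - A₀ (q.1, 0) = q.2
          rw [hA' q]
          abel)
      (fun q => by
        ext1
        · rfl
        · change A₀ (q.1, q.2 - A₀ (q.1, 0)) = q.2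
          rw [hA']
          simp)
  obtain ⟨e, hae, -, hef, hes, hed⟩ := exists_smooth_openPartialHomeomorph isOpen_univ
    hΘs.contDiffOn (Set.mem_univ a) (f' := L) (hΘd a)
  have hinj : Continuous fun p : X × X => (p, (0 : C(I, X))) := by fun_prop
  set T : Set (X × X) := (fun p : X × X => (p, (0 : C(I, X)))) ⁻¹' e.target with hT
  have hTo : IsOpen T := e.open_target.preimage hinj
  set Γ : X × X → C(I, X) := fun p => (e.symm (p, 0)).2 with hΓ
  have hΓs : ContDiffOn ℝ ∞ Γ T := contDiff_snd.comp_contDiffOn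
    (hes.comp (by fun_prop : ContDiff ℝ ∞ fun p : X × X => (p, (0 : C(I, X)))).contDiffOn
      fun p hp => hp)
  have hΘΓ : ∀ p ∈ T, e.symm (p, 0) = (p, Γ p) ∧ D (p, Γ p) = 0 := by
    intro p hp
    have h1 := e.right_inv hp
    rw [hef] at h1
    have h2 : (e.symm (p, 0)).1 = p := congrArg Prod.fst h1
    have h3 : e.symm (p, 0) = (p, Γ p) := Prod.ext h2 rfl
    refine ⟨h3, ?_⟩
    have h4 : D (e.symm (p, 0)) = 0 := congrArg Prod.snd h1
    rwa [h3] at h4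
  -- The commutation hypothesis holds only on `V`. Curves that stay in `V` form an open set in the
  -- compact-open topology, so the parameters can be restricted to those.
  set VV : Set C(I, X) := {γ | Set.MapsTo γ Set.univ V} with hVV
  have hVVo : IsOpen VV := ContinuousMap.isOpen_setOfPred_mapsTo isCompact_univ hV
  have hWo : IsOpen (T ∩ Γ ⁻¹' VV) := hΓs.continuousOn.isOpen_inter_preimage hTo hVVo
  have haT : (0, y₀) ∈ T := by
    have := e.map_source hae
    rw [hef, hΘ] at this
    simp only [hDa] at this
    exact this
  have hΓa : Γ (0, y₀) = constCurve y₀ := by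
    have := e.left_inv hae
    rw [hef, hΘ] at this
    simp only [hDa] at this
    exact congrArg Prod.snd this
  let ev : C(I, X) →L[ℝ] X := ContinuousMap.evalCLM ℝ (1 : I)
  refine ⟨T ∩ Γ ⁻¹' VV, fun p => Γ p 1, hWo, ⟨haT, ?_⟩, ?_, ?_, ?_⟩
  · change Set.MapsTo (Γ (0, y₀)) Set.univ V
    rw [hΓa]
    exact fun t _ => hy₀
  · exact ev.contDiff.comp_contDiffOn (hΓs.mono Set.inter_subset_left)
  · intro c hc
    obtain ⟨g, hg1, hg0, hgd⟩ := exists_hasDerivAt_of_flowDefect_eq_zero hB (hΘΓ _ hc.1).2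
    have h := is_const_of_deriv_eq_zero (fun t => (hgd t).differentiableAt)
      (fun t => by rw [(hgd t).deriv, map_zero]) 1 0
    rw [hg0] at h
    exact (hg1 1).symm.trans h
  · rintro ⟨s, c⟩ hp
    have hγV : ∀ t, Γ (s, c) t ∈ V := fun t => hp.2 (Set.mem_univ t)
    refine ⟨hγV 1, fun k => ?_⟩
    obtain ⟨h1, h2⟩ := hΘΓ _ hp.1
    have hsrc : ((s, c), Γ (s, c)) ∈ e.source := by
      rw [← h1]
      exact e.map_target hp.1
    obtain ⟨A, hA1, hA2⟩ := hed _ hsrc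
    have hΘp : Θ ((s, c), Γ (s, c)) = ((s, c), 0) := by
      simp only [hΘ, h2]
    rw [hΘp] at hA2
    set γ := Γ (s, c) with hγ
    have hBc := hB.continuous
    -- The candidate for the variation of the solution curve when `s` varies in the direction `k`.
    -- For commuting fields the flow of `B · (s + εk)` is the flow of `B · s` followed by that of `B
    -- · k` for time `ε t`, whence the factor `t`.
    let δ : C(I, X) := ⟨fun t => (t : ℝ) • B (γ t) k, by fun_prop⟩
    have hkey : A ((k, 0), δ) = ((k, 0), 0) := by
      have hAeq := hA1.unique (hΘd _)
      change (A : ((X × X) × C(I, X)) →L[ℝ] ((X × X) × C(I, X))) ((k, 0), δ) = _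
      rw [hAeq]
      ext1
      · rfl
      change fderiv ℝ D ((s, c), γ) ((k, 0), δ) = 0
      rw [hD, fderiv_flowDefect hB]
      obtain ⟨g, hg1, hg0, hgd⟩ := exists_hasDerivAt_of_flowDefect_eq_zero hB h2
      ext t
      simp only [map_zero, sub_zero, ContinuousMap.sub_apply, ContinuousMap.zero_apply,
        primitive_apply]
      rw [sub_eq_zero]
      have hBd : Differentiable ℝ B := hB.differentiable (by simp)
      have hgc : Continuous g := continuous_iff_continuousAt.2 fun t => (hgd t).continuousAt
      have hder : ∀ τ : ℝ, HasDerivAt (fun τ => τ • B (g τ) k)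
          (τ • fderiv ℝ B (g τ) (B (Set.IccExtend zero_le_one γ τ) s) k + (1 : ℝ) • B (g τ) k) τ := by
        intro τ
        have e1 := (hBd (g τ)).hasFDerivAt.comp_hasDerivAt τ (hgd τ)
        have e2 := e1.clm_apply (hasDerivAt_const τ k)
        have e3 := (hasDerivAt_id τ).fun_smul e2
        simpa using e3
      have hcont : Continuous fun τ : ℝ =>
          τ • fderiv ℝ B (g τ) (B (Set.IccExtend zero_le_one γ τ) s) k + (1 : ℝ) • B (g τ) k := by
        have e1 := hB.continuous_fderiv (by simp)
        have e2 : Continuous (Set.IccExtend (zero_le_one (α := ℝ)) γ) := γ.continuous.Icc_extend'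
        fun_prop
      have hftc := intervalIntegral.integral_eq_sub_of_hasDerivAt (fun τ _ => hder τ)
        (hcont.intervalIntegrable 0 t)
      simp only [zero_smul, sub_zero] at hftc
      change (t : ℝ) • B (γ t) k = _
      rw [← hg1 t, ← hftc]
      refine intervalIntegral.integral_congr fun τ hτ => ?_
      rw [Set.uIcc_of_le t.2.1] at hτ
      have hτI : τ ∈ I := ⟨hτ.1, hτ.2.trans t.2.2⟩
      have e1 : Set.IccExtend zero_le_one γ τ = γ ⟨τ, hτI⟩ := Set.IccExtend_of_mem _ _ hτI
      have e2 : g τ = γ ⟨τ, hτI⟩ := hg1 ⟨τ, hτI⟩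
      -- Commutation replaces the derivative of `B k` along `B s` by the derivative of `B s` along
      -- `B k`. This is what turns the derivative of `τ B(γ) k` into the integrand of the linearised
      -- equation.
      rw [e1, Set.IccExtend_of_mem _ _ hτI, e2, hcomm _ (hγV _) s k, one_smul]
      change _ = fderiv ℝ B (γ ⟨τ, hτI⟩) (τ • B (γ ⟨τ, hτI⟩) k) s + B (γ ⟨τ, hτI⟩) k
      rw [map_smul]
      rfl
    -- So the derivative of the solution curve in the direction `(k, 0)` is `δ`, whose value at time
    -- one is `B(γ 1) k`.
    have hsymm : A.symm ((k, 0), 0) = ((k, 0), δ) := by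
      rw [← hkey, A.symm_apply_apply]
    have hd1 : HasFDerivAt Γ ((ContinuousLinearMap.snd ℝ (X × X) C(I, X)).comp
        ((A.symm : ((X × X) × C(I, X)) →L[ℝ] ((X × X) × C(I, X))).comp
          (ContinuousLinearMap.inl ℝ (X × X) C(I, X)))) (s, c) :=
      hasFDerivAt_snd.comp (s, c) (hA2.comp (s, c)
        (ContinuousLinearMap.inl ℝ (X × X) C(I, X)).hasFDerivAt)
    have hd2 : HasFDerivAt (fun p => Γ p 1) _ (s, c) := ev.hasFDerivAt.comp (s, c) hd1
    rw [hd2.fderiv]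
    change (A.symm ((k, 0), 0)).2 1 = B (γ 1) k
    rw [hsymm]
    change ((1 : I) : ℝ) • B (γ 1) k = B (γ 1) k
    simp

end Frobenius

/-! ### The Frobenius theorem for projection-valued functions -/

section FrobeniusTheorem

variable {X : Type*} [NormedAddCommGroup X] [NormedSpace ℝ X] [FiniteDimensional ℝ X]

/-- A smooth function near a point can be made globally smooth without changing its germ. -/
theorem exists_contDiff_eq_on_ball {Y : Type*} [NormedAddCommGroup Y] [NormedSpace ℝ Y] {U : Set X}
    (hU : IsOpen U) {f : X → Y} (hf : ContDiffOn ℝ ∞ f U) {a : X} (ha : a ∈ U) :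
    ∃ r > 0, Metric.ball a r ⊆ U ∧ ∃ F : X → Y, ContDiff ℝ ∞ F ∧ ∀ x ∈ Metric.ball a r, F x = f x := by
  obtain ⟨r, hr, hrU⟩ := Metric.nhds_basis_closedBall.mem_iff.1 (hU.mem_nhds ha)
  let χ : ContDiffBump a := ⟨r / 2, r, by positivity, by linarith⟩
  refine ⟨r / 2, by positivity, (Metric.ball_subset_ball (by linarith)).trans
    (Metric.ball_subset_closedBall.trans hrU), fun x => χ x • f x, ?_, ?_⟩
  · rw [contDiff_iff_contDiffAt]
    intro x
    by_cases hx : x ∈ U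
    · exact χ.contDiffAt.smul (hf.contDiffAt (hU.mem_nhds hx))
    · have h1 : (Metric.closedBall a r)ᶜ ∈ 𝓝 x :=
        Metric.isClosed_closedBall.isOpen_compl.mem_nhds fun h => hx (hrU h)
      refine (contDiffAt_const (c := (0 : Y))).congr_of_eventuallyEq ?_
      filter_upwards [h1] with z hz
      have : χ z = 0 := χ.zero_of_le_dist (by
        have := Metric.mem_closedBall.not.1 hz
        exact (not_le.1 this).le)
      rw [this, zero_smul]
  · intro x hx
    change χ x • f x = f x
    rw [χ.one_of_mem_closedBall (Metric.ball_subset_closedBall hx), one_smul]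

/-- First integrals of the involutive distribution `ker Q`, where `Q` is a projection. -/
theorem exists_first_integral {Q : X → X →L[ℝ] X} {U : Set X} (hU : IsOpen U)
    (hQ : ContDiffOn ℝ ∞ Q U) (hproj : ∀ y ∈ U, Q y * Q y = Q y)
    (hint : ∀ y ∈ U, ∀ u w, Q y u = 0 → Q y w = 0 → fderiv ℝ Q y u w = fderiv ℝ Q y w u)
    {y₀ : X} (hy₀ : y₀ ∈ U) :
    ∃ (V : Set X) (f : X → X), IsOpen V ∧ y₀ ∈ V ∧ V ⊆ U ∧ ContDiffOn ℝ ∞ f V ∧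
      (∀ y ∈ V, ∀ w, Q y w = 0 → fderiv ℝ f y w = 0) ∧
      (∀ y ∈ V, ∀ w, Q y₀ (fderiv ℝ f y w) = fderiv ℝ f y w) ∧ fderiv ℝ f y₀ = Q y₀ := by
  have : CompleteSpace X := FiniteDimensional.complete ℝ X
  set Q₀ := Q y₀ with hQ₀
  have hQQ₀ : Q₀ * Q₀ = Q₀ := hproj y₀ hy₀
  -- `T` intertwines the nearby projections: `T Q = Q₀ T`. It is the identity at `y₀`, hence
  -- invertible in a neighbourhood.
  set T : X → X →L[ℝ] X := fun y => Q₀ * Q y + (1 - Q₀) * (1 - Q y) with hT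
  have hTs : ContDiffOn ℝ ∞ T U :=
    (contDiffOn_const.mul hQ).add (contDiffOn_const.mul (contDiffOn_const.sub hQ))
  have hT₀ : T y₀ = 1 := by
    simp only [hT, ← hQ₀, mul_sub, sub_mul, hQQ₀, one_mul, mul_one]
    abel
  set U₁ := U ∩ T ⁻¹' {t | IsUnit t} with hU₁
  have hU₁o : IsOpen U₁ := hTs.continuousOn.isOpen_inter_preimage hU Units.isOpen
  have hy₀₁ : y₀ ∈ U₁ := ⟨hy₀, by
    change IsUnit (T y₀)
    rw [hT₀]
    exact isUnit_one⟩
  -- A frame of `ker Q` parametrised by `ker Q₀`, and zero on the range of `Q₀`. It is the frame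
  -- normalised by `(1 - Q₀) B₀ = 1 - Q₀`, that is, the distribution is written as a graph over `ker
  -- Q₀`.
  set B₀ : X → X →L[ℝ] X := fun y => Ring.inverse (T y) * (1 - Q₀) with hB₀
  have hB₀s : ContDiffOn ℝ ∞ B₀ U₁ := by
    intro y hy
    obtain ⟨t, ht⟩ := hy.2
    have h1 : ContDiffAt ℝ ∞ Ring.inverse (T y) := by
      rw [← ht]
      exact contDiffAt_ringInverse ℝ t
    have h2 := h1.comp y (hTs.contDiffAt (hU.mem_nhds hy.1))
    exact (h2.mul contDiffAt_const).contDiffWithinAt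
  have hTB : ∀ y ∈ U₁, T y * B₀ y = 1 - Q₀ := by
    intro y hy
    rw [hB₀, ← mul_assoc, Ring.mul_inverse_cancel _ hy.2, one_mul]
  have hTinj : ∀ y ∈ U₁, ∀ w, T y w = 0 → w = 0 := by
    intro y hy w hw
    have h1 : (Ring.inverse (T y) * T y) w = w := by
      rw [Ring.inverse_mul_cancel _ hy.2]
      rfl
    rw [← h1]
    change Ring.inverse (T y) (T y w) = 0
    rw [hw, map_zero]
  have hTker : ∀ y w, Q y w = 0 → T y w = (1 - Q₀) w := by
    intro y w hw
    change Q₀ (Q y w) + (1 - Q₀) (w - Q y w) = _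
    rw [hw, map_zero, zero_add, sub_zero]
  have hQB : ∀ y ∈ U₁, Q y * B₀ y = 0 := by
    intro y hy
    have h1 : T y * Q y = Q₀ * T y := by
      simp only [hT, add_mul, mul_add, hproj y hy.1, sub_mul, mul_sub, one_mul, mul_one,
        ← mul_assoc, hQQ₀]
      simp only [mul_assoc, hproj y hy.1]
      abel
    have h2 : T y * (Q y * B₀ y) = 0 := by
      rw [← mul_assoc, h1, mul_assoc, hTB y hy, mul_sub, mul_one, hQQ₀, sub_self]
    ext w
    exact hTinj y hy _ (congrArg (fun A : X →L[ℝ] X => A w) h2)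
  have hQ₀B : ∀ y ∈ U₁, (1 - Q₀) * B₀ y = 1 - Q₀ := by
    intro y hy
    refine Eq.trans ?_ (hTB y hy)
    ext w
    exact (hTker y (B₀ y w) (congrArg (fun A : X →L[ℝ] X => A w) (hQB y hy))).symm
  have hBker : ∀ y ∈ U₁, ∀ w, Q y w = 0 → B₀ y w = w := by
    intro y hy w hw
    rw [← sub_eq_zero]
    refine hTinj y hy _ ?_
    rw [map_sub, hTker y w hw, sub_eq_zero]
    exact congrArg (fun A : X →L[ℝ] X => A w) (hTB y hy)
  -- The bracket of two frame fields lies in `ker Q` by involutivity and is annihilated by `1 - Q₀`,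
  -- because that component of each frame field is constant. On `ker Q` the operator `1 - Q₀` agrees
  -- with the injective `T`, so the bracket vanishes.
  have hcomm : ∀ y ∈ U₁, ∀ k l, fderiv ℝ B₀ y (B₀ y k) l = fderiv ℝ B₀ y (B₀ y l) k := by
    intro y hy k l
    have hBd : DifferentiableAt ℝ B₀ y :=
      (hB₀s.contDiffAt (hU₁o.mem_nhds hy)).differentiableAt (by simp)
    have hQd : DifferentiableAt ℝ Q y :=
      (hQ.contDiffAt (hU.mem_nhds hy.1)).differentiableAt (by simp)
    have h1 : ∀ u, Q y * fderiv ℝ B₀ y u + fderiv ℝ Q y u * B₀ y = 0 := by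
      intro u
      have e1 : (fun z => Q z * B₀ z) =ᶠ[𝓝 y] fun _ => 0 :=
        Filter.eventuallyEq_of_mem (hU₁o.mem_nhds hy) hQB
      have e2 := e1.fderiv_eq (𝕜 := ℝ)
      rw [fderiv_fun_mul' hQd hBd] at e2
      have e3 := congrArg (fun A => A u) e2
      simpa using e3
    have h2 : ∀ u, (1 - Q₀) * fderiv ℝ B₀ y u = 0 := by
      intro u
      have e1 : (fun z => (1 - Q₀) * B₀ z) =ᶠ[𝓝 y] fun _ => 1 - Q₀ :=
        Filter.eventuallyEq_of_mem (hU₁o.mem_nhds hy) hQ₀B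
      have e2 := e1.fderiv_eq (𝕜 := ℝ)
      rw [fderiv_const_mul hBd] at e2
      have e3 := congrArg (fun A => A u) e2
      simpa using e3
    rw [← sub_eq_zero]
    refine hTinj y hy _ ?_
    have hQBk : ∀ k, Q y (B₀ y k) = 0 := fun k =>
      congrArg (fun A : X →L[ℝ] X => A k) (hQB y hy)
    have h3 : ∀ u l, Q y (fderiv ℝ B₀ y u l) = -fderiv ℝ Q y u (B₀ y l) := fun u l =>
      eq_neg_of_add_eq_zero_left (congrArg (fun A : X →L[ℝ] X => A l) (h1 u))
    have h4 : ∀ u l, (1 - Q₀) (fderiv ℝ B₀ y u l) = 0 := fun u l =>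
      congrArg (fun A : X →L[ℝ] X => A l) (h2 u)
    rw [hTker, map_sub, h4, h4, sub_self]
    rw [map_sub, h3, h3, hint y hy.1 _ _ (hQBk k) (hQBk l), sub_self]
  -- The flow was constructed for globally defined fields; the bump function changes nothing near
  -- `y₀`.
  obtain ⟨r, hr, hrU, B, hB, hBB₀⟩ := exists_contDiff_eq_on_ball hU₁o hB₀s hy₀₁
  have hBcomm : ∀ y ∈ Metric.ball y₀ r, ∀ k l, fderiv ℝ B y (B y k) l = fderiv ℝ B y (B y l) k := by
    intro y hy k l
    have : B =ᶠ[𝓝 y] B₀ := Filter.eventuallyEq_of_mem (Metric.isOpen_ball.mem_nhds hy) hBB₀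
    rw [this.fderiv_eq, hBB₀ y hy]
    exact hcomm y (hrU hy) k l
  obtain ⟨W, Φ, hWo, hW₀, hΦs, hΦ0, hΦ⟩ :=
    exists_flow hB Metric.isOpen_ball hBcomm (Metric.mem_ball_self hr)
  -- The point `x` is split into the initial point `y₀ + Q₀(x - y₀)` on a transversal slice and the
  -- flow parameter `(1 - Q₀)(x - y₀)` along the leaf.
  let ℓ : X →L[ℝ] X × X := (1 - Q₀).prod Q₀
  set j : X → X × X := fun x => (0, y₀) + ℓ (x - y₀) with hj
  have hjs : ContDiff ℝ ∞ j := contDiff_const.add (ℓ.contDiff.comp (contDiff_id.sub contDiff_const))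
  have hjd : ∀ x, HasFDerivAt j ℓ x := fun x =>
    (ℓ.hasFDerivAt.comp x ((hasFDerivAt_id x).sub_const y₀)).const_add (0, y₀)
  have hj₀ : j y₀ = (0, y₀) := by simp [hj]
  have hU₂o : IsOpen (j ⁻¹' W) := hWo.preimage hjs.continuous
  have hy₀₂ : y₀ ∈ j ⁻¹' W := by
    change j y₀ ∈ W
    rwa [hj₀]
  set g : X → X := fun x => Φ (j x) with hg
  have hgs : ContDiffOn ℝ ∞ g (j ⁻¹' W) := hΦs.comp hjs.contDiffOn fun x hx => hx
  have hΦd : ∀ p ∈ W, HasFDerivAt Φ (fderiv ℝ Φ p) p := fun p hp =>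
    ((hΦs.contDiffAt (hWo.mem_nhds hp)).differentiableAt (by simp)).hasFDerivAt
  have hgd : ∀ x ∈ j ⁻¹' W, HasFDerivAt g ((fderiv ℝ Φ (j x)).comp ℓ) x := fun x hx =>
    (hΦd _ hx).comp x (hjd x)
  have hg₀ : g y₀ = y₀ := by
    simp only [hg, hj₀]
    exact hΦ0 y₀ hW₀
  -- In the slice directions the derivative is that of `c ↦ Φ(0, c) = c`; in the leaf directions it
  -- is `B₀ y₀ = 1 - Q₀`.
  have hgd₀ : (fderiv ℝ Φ (j y₀)).comp ℓ =
      ((ContinuousLinearEquiv.refl ℝ X : X ≃L[ℝ] X) : X →L[ℝ] X) := by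
    ext w
    have e1 : fderiv ℝ Φ (0, y₀) (0, Q₀ w) = Q₀ w := by
      have e2 : HasFDerivAt (fun c => Φ (0, c)) ((fderiv ℝ Φ (0, y₀)).comp
          (ContinuousLinearMap.inr ℝ X X)) y₀ := by
        have := (hΦd _ hW₀).comp y₀ (hasFDerivAt_prodMk_right (0 : X) y₀)
        exact this
      have e3 : (fun c => Φ (0, c)) =ᶠ[𝓝 y₀] fun c => c := by
        have hc : Continuous fun c : X => ((0 : X), c) := by fun_prop
        filter_upwards [(hWo.preimage hc).mem_nhds hW₀] with c hc
        exact hΦ0 c hc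
      have e4 := (e2.congr_of_eventuallyEq e3.symm).unique (hasFDerivAt_id y₀)
      exact congrArg (fun A : X →L[ℝ] X => A (Q₀ w)) e4
    have e2 : fderiv ℝ Φ (0, y₀) ((1 - Q₀) w, 0) = (1 - Q₀) w := by
      rw [(hΦ _ hW₀).2, hΦ0 y₀ hW₀, hBB₀ y₀ (Metric.mem_ball_self hr)]
      have : B₀ y₀ = 1 - Q₀ := by rw [← hTB y₀ hy₀₁, hT₀, one_mul]
      rw [this]
      change ((1 - Q₀) * (1 - Q₀)) w = _
      congr 1
      simp only [mul_sub, sub_mul, hQQ₀, one_mul, mul_one]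
      abel
    change fderiv ℝ Φ (j y₀) ((1 - Q₀) w, Q₀ w) = w
    have e3 : (((1 - Q₀) w, Q₀ w) : X × X) = ((1 - Q₀) w, 0) + (0, Q₀ w) := by simp
    rw [hj₀, e3, map_add, e1, e2]
    change w - Q₀ w + Q₀ w = w
    abel
  obtain ⟨e, hes, heU, hef, hesm, hed⟩ := exists_smooth_openPartialHomeomorph hU₂o hgs hy₀₂
    (f' := ContinuousLinearEquiv.refl ℝ X) (hgd₀ ▸ hgd y₀ hy₀₂)
  have hball : ∀ y ∈ e.target, y ∈ Metric.ball y₀ r := by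
    intro y hy
    rw [← e.right_inv hy, hef]
    exact (hΦ _ (heU (e.map_target hy))).1
  have hfd : ∀ y ∈ e.target, ∃ A : X ≃L[ℝ] X,
      (A : X →L[ℝ] X) = (fderiv ℝ Φ (j (e.symm y))).comp ℓ ∧
      fderiv ℝ (fun y => Q₀ (e.symm y)) y = Q₀.comp (A.symm : X →L[ℝ] X) := by
    intro y hy
    obtain ⟨A, hA1, hA2⟩ := hed _ (e.map_target hy)
    refine ⟨A, hA1.unique (hgd _ (heU (e.map_target hy))), ?_⟩
    rw [← hef, e.right_inv hy] at hA2
    exact (Q₀.hasFDerivAt.comp y hA2).fderiv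
  -- In the flow-box coordinates the leaves are the fibres of `Q₀`, so the slice component of the
  -- inverse map is constant on them.
  refine ⟨e.target, fun y => Q₀ (e.symm y), e.open_target, ?_, ?_, ?_, ?_, ?_, ?_⟩
  · rw [← hg₀, ← hef]
    exact e.map_source hes
  · exact fun y hy => (hrU (hball y hy)).1
  · exact Q₀.contDiff.comp_contDiffOn hesm
  · intro y hy w hw
    obtain ⟨A, hA1, hA2⟩ := hfd y hy
    rw [hA2]
    have hQk : Q₀ ((1 - Q₀) w) = 0 := by
      change (Q₀ * (1 - Q₀)) w = 0
      rw [mul_sub, mul_one, hQQ₀, sub_self]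
      rfl
    -- A kernel vector `w` of `Q y` is the image of its own leaf component `(1 - Q₀) w`, because `B₀
    -- y` fixes `w` and vanishes on the range of `Q₀`.
    have hAk : A ((1 - Q₀) w) = w := by
      change (A : X →L[ℝ] X) ((1 - Q₀) w) = w
      rw [hA1]
      change fderiv ℝ Φ (j (e.symm y)) ((1 - Q₀) ((1 - Q₀) w), Q₀ ((1 - Q₀) w)) = w
      have e1 : (1 - Q₀) ((1 - Q₀) w) = (1 - Q₀) w := by
        change (1 - Q₀) w - Q₀ ((1 - Q₀) w) = _
        rw [hQk, sub_zero]
      have e2 : Φ (j (e.symm y)) = y := by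
        have := e.right_inv hy
        rwa [hef] at this
      rw [hQk, e1, (hΦ _ (heU (e.map_target hy))).2, e2, hBB₀ y (hball y hy)]
      change B₀ y (w - Q₀ w) = w
      rw [map_sub, hBker y (hrU (hball y hy)) w hw]
      have e3 : B₀ y (Q₀ w) = 0 := by
        change (Ring.inverse (T y) * (1 - Q₀) * Q₀) w = 0
        rw [mul_assoc, sub_mul, one_mul, hQQ₀, sub_self, mul_zero]
        rfl
      rw [e3, sub_zero]
    change Q₀ (A.symm w) = 0
    rw [← hAk, A.symm_apply_apply, hQk]
  · intro y hy w
    obtain ⟨A, hA1, hA2⟩ := hfd y hy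
    rw [hA2]
    exact congrArg (fun C : X →L[ℝ] X => C (A.symm w)) hQQ₀
  · have hy₀t : y₀ ∈ e.target := by
      rw [← hg₀, ← hef]
      exact e.map_source hes
    obtain ⟨A, hA1, hA2⟩ := hfd y₀ hy₀t
    have e1 : e.symm y₀ = y₀ := by
      have := e.left_inv hes
      rwa [hef, hg₀] at this
    rw [e1, hgd₀] at hA1
    rw [hA2]
    ext w
    change Q₀ (A.symm w) = Q₀ w
    have : A w = w := congrArg (fun C : X →L[ℝ] X => C w) hA1
    conv_lhs => rw [← this, A.symm_apply_apply]

end FrobeniusTheorem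

/-! ### Block decompositions -/

section Blocks

/-- The first two indices. -/
def il (i : Fin 2) : Fin 4 := Fin.castAdd 2 i

/-- The last two indices. -/
def ir (i : Fin 2) : Fin 4 := Fin.natAdd 2 i

theorem forall_blocks {p : Fin 4 → Prop} (hl : ∀ i, p (il i)) (hr : ∀ i, p (ir i)) (k : Fin 4) :
    p k :=
  Fin.addCases (m := 2) (n := 2) (motive := p) hl hr k

theorem sum_blocks {E : Type*} [AddCommMonoid E] (f : Fin 4 → E) :
    ∑ k, f k = ∑ i, f (il i) + ∑ i, f (ir i) :=
  Fin.sum_univ_add (a := 2) (b := 2) f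

/-- A `4 × 4` matrix composed of `2 × 2` blocks. -/
def blocks (a b c d : Matrix (Fin 2) (Fin 2) ℝ) : Matrix (Fin 4) (Fin 4) ℝ :=
  (Matrix.fromBlocks a b c d).submatrix (finSumFinEquiv (m := 2) (n := 2)).symm
    (finSumFinEquiv (m := 2) (n := 2)).symm

variable {a b c d a' b' c' d' : Matrix (Fin 2) (Fin 2) ℝ}

@[simp]
theorem blocks_ll (i j : Fin 2) : blocks a b c d (il i) (il j) = a i j := by
  fin_cases i <;> fin_cases j <;> rfl

@[simp]
theorem blocks_lr (i j : Fin 2) : blocks a b c d (il i) (ir j) = b i j := by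
  fin_cases i <;> fin_cases j <;> rfl

@[simp]
theorem blocks_rl (i j : Fin 2) : blocks a b c d (ir i) (il j) = c i j := by
  fin_cases i <;> fin_cases j <;> rfl

@[simp]
theorem blocks_rr (i j : Fin 2) : blocks a b c d (ir i) (ir j) = d i j := by
  fin_cases i <;> fin_cases j <;> rfl

theorem eq_blocks {M : Matrix (Fin 4) (Fin 4) ℝ} (hll : ∀ i j, M (il i) (il j) = a i j)
    (hlr : ∀ i j, M (il i) (ir j) = b i j) (hrl : ∀ i j, M (ir i) (il j) = c i j)
    (hrr : ∀ i j, M (ir i) (ir j) = d i j) : M = blocks a b c d := by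
  ext k l
  induction k using forall_blocks with
  | hl i => induction l using forall_blocks with
    | hl j => rw [hll, blocks_ll]
    | hr j => rw [hlr, blocks_lr]
  | hr i => induction l using forall_blocks with
    | hl j => rw [hrl, blocks_rl]
    | hr j => rw [hrr, blocks_rr]

theorem blocks_mul : blocks a b c d * blocks a' b' c' d' =
    blocks (a * a' + b * c') (a * b' + b * d') (c * a' + d * c') (c * b' + d * d') := by
  rw [blocks, blocks, Matrix.submatrix_mul_equiv, Matrix.fromBlocks_multiply]
  rfl

theorem blocks_add : blocks a b c d + blocks a' b' c' d' =
    blocks (a + a') (b + b') (c + c') (d + d') := by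
  apply eq_blocks <;> simp

theorem blocks_sub : blocks a b c d - blocks a' b' c' d' =
    blocks (a - a') (b - b') (c - c') (d - d') := by
  apply eq_blocks <;> simp

theorem smul_blocks (r : ℝ) : r • blocks a b c d = blocks (r • a) (r • b) (r • c) (r • d) := by
  apply eq_blocks <;> simp

theorem blocks_transpose : (blocks a b c d)ᵀ = blocks aᵀ cᵀ bᵀ dᵀ := by
  apply eq_blocks <;> simp

theorem blocks_trace : (blocks a b c d).trace = a.trace + d.trace := by
  simp [Matrix.trace, sum_blocks]

theorem blocks_det : (blocks a 0 0 d).det = a.det * d.det := by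
  rw [blocks, Matrix.det_submatrix_equiv_self, Matrix.det_fromBlocks_zero₂₁]

theorem blocks_inv (ha : a.det ≠ 0) (hd : d.det ≠ 0) :
    (blocks a 0 0 d)⁻¹ = blocks a⁻¹ 0 0 d⁻¹ := by
  refine Matrix.inv_eq_right_inv ?_
  rw [blocks_mul]
  simp only [Matrix.mul_nonsing_inv _ ha.isUnit, Matrix.mul_nonsing_inv _ hd.isUnit,
    Matrix.zero_mul, Matrix.mul_zero, add_zero, zero_add]
  symm
  apply eq_blocks <;> intro i j <;> fin_cases i <;> fin_cases j <;> rfl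

theorem warpedBlock_eq (l : ℝ) : warpedBlock a l d = blocks a 0 0 (Real.exp (2 * l) • d) := by
  apply eq_blocks <;> intro i j <;> fin_cases i <;> fin_cases j <;> rfl

theorem fstPair_apply (y : Fin 4 → ℝ) (i : Fin 2) : fstPair y i = y (il i) := by
  fin_cases i <;> rfl

theorem sndPair_apply (y : Fin 4 → ℝ) (i : Fin 2) : sndPair y i = y (ir i) := by
  fin_cases i <;> rfl

theorem contDiff_fstPair : ContDiff ℝ ∞ fstPair := by
  rw [contDiff_pi]
  intro i
  simp only [fstPair_apply]
  exact contDiff_apply ℝ ℝ _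

theorem contDiff_sndPair : ContDiff ℝ ∞ sndPair := by
  rw [contDiff_pi]
  intro i
  simp only [sndPair_apply]
  exact contDiff_apply ℝ ℝ _

theorem pd_coord {n : ℕ} (i k : Fin n) (y : Fin n → ℝ) :
    pd i (fun z => z k) y = if i = k then 1 else 0 := by
  have : fderiv ℝ (fun z : Fin n → ℝ => z k) y = ContinuousLinearMap.proj k :=
    (ContinuousLinearMap.proj (R := ℝ) (φ := fun _ : Fin n => ℝ) k).hasFDerivAt.fderiv
  rw [pd, this]
  simp [Pi.single_apply, eq_comm]

theorem il_inj {i j : Fin 2} : il i = il j ↔ i = j :=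
  ⟨fun h => Fin.castAdd_injective 2 2 h, congrArg il⟩

theorem ir_inj {i j : Fin 2} : ir i = ir j ↔ i = j :=
  ⟨fun h => Fin.natAdd_injective 2 2 h, congrArg ir⟩

theorem il_ne_ir (i j : Fin 2) : il i ≠ ir j := by
  intro h
  have := congrArg Fin.val h
  simp only [il, ir, Fin.val_castAdd, Fin.val_natAdd] at this
  omega

variable {f : (Fin 2 → ℝ) → ℝ} {y : Fin 4 → ℝ}

theorem pd_il_fst (hf : DifferentiableAt ℝ f (fstPair y)) (i : Fin 2) :
    pd (il i) (fun z => f (fstPair z)) y = pd i f (fstPair y) := by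
  rw [pd_comp hf (contDiff_fstPair.differentiable (by simp) y)]
  simp [fstPair_apply, pd_coord, il_inj]

theorem pd_ir_fst (hf : DifferentiableAt ℝ f (fstPair y)) (i : Fin 2) :
    pd (ir i) (fun z => f (fstPair z)) y = 0 := by
  rw [pd_comp hf (contDiff_fstPair.differentiable (by simp) y)]
  simp [fstPair_apply, pd_coord, (il_ne_ir _ _).symm]

theorem pd_ir_snd (hf : DifferentiableAt ℝ f (sndPair y)) (i : Fin 2) :
    pd (ir i) (fun z => f (sndPair z)) y = pd i f (sndPair y) := by
  rw [pd_comp hf (contDiff_sndPair.differentiable (by simp) y)]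
  simp [sndPair_apply, pd_coord, ir_inj]

theorem pd_il_snd (hf : DifferentiableAt ℝ f (sndPair y)) (i : Fin 2) :
    pd (il i) (fun z => f (sndPair z)) y = 0 := by
  rw [pd_comp hf (contDiff_sndPair.differentiable (by simp) y)]
  simp [sndPair_apply, pd_coord, il_ne_ir]

theorem pdMat_blocks {A B C D : (Fin 4 → ℝ) → Matrix (Fin 2) (Fin 2) ℝ} (k : Fin 4) :
    pdMat k (fun z => blocks (A z) (B z) (C z) (D z)) y =
      blocks (pdMat k A y) (pdMat k B y) (pdMat k C y) (pdMat k D y) := by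
  apply eq_blocks <;> intro i j <;> simp [pdMat_apply]

/-- A 2-dimensional curvature tensor is determined by the Gauss curvature. -/
theorem IsMetricOn.riemann_eq_gaussCurvature {v : (Fin 2 → ℝ) → Matrix (Fin 2) (Fin 2) ℝ}
    {A : Set (Fin 2 → ℝ)} {z : Fin 2 → ℝ} (hv : IsMetricOn v A) (hz : z ∈ A) (i j k l : Fin 2) :
    riemann v z i j k l = gaussCurvature v z * (v z i k * v z j l - v z i l * v z j k) := by
  have hd := hv.det_ne z hz
  have h0 : riemann v z 0 1 0 1 = gaussCurvature v z * (v z 0 0 * v z 1 1 - v z 0 1 * v z 1 0) := by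
    rw [gaussCurvature, ← Matrix.det_fin_two, div_mul_cancel₀ _ hd]
  have hl := hv.riemann_antisymm_left hz
  have hr := hv.riemann_antisymm_right hz
  have l0 : ∀ k l, riemann v z 0 0 k l = 0 := fun k l => by linarith [hl 0 0 k l]
  have l1 : ∀ k l, riemann v z 1 1 k l = 0 := fun k l => by linarith [hl 1 1 k l]
  have r0 : ∀ k l, riemann v z k l 0 0 = 0 := fun k l => by linarith [hr k l 0 0]
  have r1 : ∀ k l, riemann v z k l 1 1 = 0 := fun k l => by linarith [hr k l 1 1]
  have s := hv.symm_apply hz 1 0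
  fin_cases i <;> fin_cases j <;> fin_cases k <;> fin_cases l <;>
    simp only [Fin.zero_eta, Fin.mk_one, Fin.isValue, l0, l1, r0, r1] <;>
    first
    | ring1
    | exact h0
    | (rw [hr 0 1 1 0, h0]; ring1)
    | (rw [hl 1 0 0 1, h0]; ring1)
    | (rw [hl 1 0 1 0, hr 0 1 1 0, h0]; ring1)

end Blocks

/-! ### Curvature of a warped product -/

section Warped

/-- On `U`, the metric `G` is the warped product `v + e^{2λ} s`. -/
structure IsWarped (G : Field4) (U : Set (Fin 4 → ℝ)) (v : (Fin 2 → ℝ) → Matrix (Fin 2) (Fin 2) ℝ)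
    (lam : (Fin 2 → ℝ) → ℝ) (s : (Fin 2 → ℝ) → Matrix (Fin 2) (Fin 2) ℝ)
    (A B : Set (Fin 2 → ℝ)) : Prop where
  isOpen : IsOpen U
  base : IsMetricOn v A
  smooth : ContDiffOn ℝ ∞ lam A
  fiber : IsMetricOn s B
  mapsTo_fst : Set.MapsTo fstPair U A
  mapsTo_snd : Set.MapsTo sndPair U B
  metric : ∀ y ∈ U, G y = warpedBlock (v (fstPair y)) (lam (fstPair y)) (s (sndPair y))

/-- The differential of a function of two variables. -/
def grad2 (lam : (Fin 2 → ℝ) → ℝ) (z : Fin 2 → ℝ) : Fin 2 → ℝ := fun i => pd i lam z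

/-- `-(∇_i ∇_j λ + ∂_i λ ∂_j λ)`, the mixed part of the curvature of a warped product. -/
def warpHess (v : (Fin 2 → ℝ) → Matrix (Fin 2) (Fin 2) ℝ) (lam : (Fin 2 → ℝ) → ℝ)
    (z : Fin 2 → ℝ) : Matrix (Fin 2) (Fin 2) ℝ :=
  Matrix.of fun i j => -(pd i (pd j lam) z + pd i lam z * pd j lam z
    - ∑ k, conn v i z k j * pd k lam z)

/-- The square norm of `dλ`. -/
def gradSq (v : (Fin 2 → ℝ) → Matrix (Fin 2) (Fin 2) ℝ) (lam : (Fin 2 → ℝ) → ℝ)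
    (z : Fin 2 → ℝ) : ℝ :=
  grad2 lam z ⬝ᵥ (v z)⁻¹ *ᵥ grad2 lam z

/-- The connection matrices of a warped product. -/
def warpConn (v : (Fin 2 → ℝ) → Matrix (Fin 2) (Fin 2) ℝ) (lam : (Fin 2 → ℝ) → ℝ)
    (s : (Fin 2 → ℝ) → Matrix (Fin 2) (Fin 2) ℝ) (y : Fin 4 → ℝ) (c : Fin 4) :
    Matrix (Fin 4) (Fin 4) ℝ :=
  Fin.addCases (m := 2) (n := 2) (motive := fun _ => Matrix (Fin 4) (Fin 4) ℝ)
    (fun i => blocks (conn v i (fstPair y)) 0 0 (pd i lam (fstPair y) • 1))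
    (fun C => blocks 0
      (Matrix.vecMulVec (-((v (fstPair y))⁻¹ *ᵥ grad2 lam (fstPair y)))
        (Real.exp (2 * lam (fstPair y)) • s (sndPair y) C))
      (Matrix.vecMulVec (Pi.single C 1) (grad2 lam (fstPair y)))
      (conn s C (sndPair y))) c

variable {G : Field4} {U : Set (Fin 4 → ℝ)} {v s : (Fin 2 → ℝ) → Matrix (Fin 2) (Fin 2) ℝ}
  {lam : (Fin 2 → ℝ) → ℝ} {A B : Set (Fin 2 → ℝ)} {y : Fin 4 → ℝ}

theorem warpConn_il (i : Fin 2) : warpConn v lam s y (il i) =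
    blocks (conn v i (fstPair y)) 0 0 (pd i lam (fstPair y) • 1) :=
  Fin.addCases_left (m := 2) (n := 2) i

theorem warpConn_ir (C : Fin 2) : warpConn v lam s y (ir C) =
    blocks 0
      (Matrix.vecMulVec (-((v (fstPair y))⁻¹ *ᵥ grad2 lam (fstPair y)))
        (Real.exp (2 * lam (fstPair y)) • s (sndPair y) C))
      (Matrix.vecMulVec (Pi.single C 1) (grad2 lam (fstPair y)))
      (conn s C (sndPair y)) :=
  Fin.addCases_right (m := 2) (n := 2) C

theorem pdMat_il_fst {M : (Fin 2 → ℝ) → Matrix (Fin 2) (Fin 2) ℝ} (hA : IsOpen A)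
    (hM : MatrixSmoothOn M A) (hy : fstPair y ∈ A) (i : Fin 2) :
    pdMat (il i) (fun z => M (fstPair z)) y = pdMat i M (fstPair y) := by
  ext a b
  exact pd_il_fst ((hM a b).diffAt hA hy) i

theorem pdMat_ir_fst {M : (Fin 2 → ℝ) → Matrix (Fin 2) (Fin 2) ℝ} (hA : IsOpen A)
    (hM : MatrixSmoothOn M A) (hy : fstPair y ∈ A) (i : Fin 2) :
    pdMat (ir i) (fun z => M (fstPair z)) y = 0 := by
  ext a b
  exact pd_ir_fst ((hM a b).diffAt hA hy) i

theorem pdMat_ir_snd {M : (Fin 2 → ℝ) → Matrix (Fin 2) (Fin 2) ℝ} (hA : IsOpen A)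
    (hM : MatrixSmoothOn M A) (hy : sndPair y ∈ A) (i : Fin 2) :
    pdMat (ir i) (fun z => M (sndPair z)) y = pdMat i M (sndPair y) := by
  ext a b
  exact pd_ir_snd ((hM a b).diffAt hA hy) i

theorem pdMat_il_snd {M : (Fin 2 → ℝ) → Matrix (Fin 2) (Fin 2) ℝ} (hA : IsOpen A)
    (hM : MatrixSmoothOn M A) (hy : sndPair y ∈ A) (i : Fin 2) :
    pdMat (il i) (fun z => M (sndPair z)) y = 0 := by
  ext a b
  exact pd_il_snd ((hM a b).diffAt hA hy) i

theorem pdMat_zero {n p q : ℕ} {z : Fin n → ℝ} (k : Fin n) :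
    pdMat k (fun _ => (0 : Matrix (Fin p) (Fin q) ℝ)) z = 0 := by
  ext a b
  exact pd_const 0

namespace IsWarped

theorem metric_eq (h : IsWarped G U v lam s A B) (hy : y ∈ U) :
    G y = blocks (v (fstPair y)) 0 0 (Real.exp (2 * lam (fstPair y)) • s (sndPair y)) := by
  rw [h.metric y hy, warpedBlock_eq]

theorem smooth_fst (h : IsWarped G U v lam s A B) {f : (Fin 2 → ℝ) → ℝ} (hf : ContDiffOn ℝ ∞ f A) :
    ContDiffOn ℝ ∞ (fun z => f (fstPair z)) U :=
  hf.comp contDiff_fstPair.contDiffOn h.mapsTo_fst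

theorem smooth_snd (h : IsWarped G U v lam s A B) {f : (Fin 2 → ℝ) → ℝ} (hf : ContDiffOn ℝ ∞ f B) :
    ContDiffOn ℝ ∞ (fun z => f (sndPair z)) U :=
  hf.comp contDiff_sndPair.contDiffOn h.mapsTo_snd

theorem smooth_exp (h : IsWarped G U v lam s A B) :
    ContDiffOn ℝ ∞ (fun z => Real.exp (2 * lam (fstPair z))) U :=
  (contDiffOn_const.mul (h.smooth_fst h.smooth)).exp

theorem diff_lam (h : IsWarped G U v lam s A B) (hy : y ∈ U) : DifferentiableAt ℝ lam (fstPair y) :=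
  h.smooth.diffAt h.base.isOpen (h.mapsTo_fst hy)

theorem pd_il_exp (h : IsWarped G U v lam s A B) (hy : y ∈ U) (i : Fin 2) :
    pd (il i) (fun z => Real.exp (2 * lam (fstPair z))) y =
      2 * pd i lam (fstPair y) * Real.exp (2 * lam (fstPair y)) := by
  have h1 : DifferentiableAt ℝ (fun z => 2 * lam z) (fstPair y) := (h.diff_lam hy).const_mul 2
  have h2 := pd_il_fst (f := fun z => Real.exp (2 * lam z)) h1.exp i
  rw [h2, pd, fderiv_exp h1]
  have h3 := pd_const_mul (i := i) 2 (h.diff_lam hy)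
  rw [pd] at h3
  simp only [_root_.smul_apply, h3, smul_eq_mul]
  ring

theorem pd_ir_exp (h : IsWarped G U v lam s A B) (hy : y ∈ U) (i : Fin 2) :
    pd (ir i) (fun z => Real.exp (2 * lam (fstPair z))) y = 0 := by
  have h1 : DifferentiableAt ℝ (fun z => 2 * lam z) (fstPair y) := (h.diff_lam hy).const_mul 2
  exact pd_ir_fst (f := fun z => Real.exp (2 * lam z)) h1.exp i

theorem isMetricOn (h : IsWarped G U v lam s A B) : IsMetricOn G U where
  isOpen := h.isOpen
  smooth := by
    have h0 : MatrixSmoothOn (fun z => blocks (v (fstPair z)) 0 0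
        (Real.exp (2 * lam (fstPair z)) • s (sndPair z))) U := by
      intro a b
      induction a using forall_blocks with
      | hl i => induction b using forall_blocks with
        | hl j => simpa using h.smooth_fst (h.base.smooth i j)
        | hr j => simpa using contDiffOn_const
      | hr i => induction b using forall_blocks with
        | hl j => simpa using contDiffOn_const
        | hr j => simpa using h.smooth_exp.mul (h.smooth_snd (h.fiber.smooth i j))
    exact h0.congr fun z hz => h.metric_eq hz
  symm := fun y hy => by
    rw [h.metric_eq hy, blocks_transpose, h.base.symm _ (h.mapsTo_fst hy), Matrix.transpose_smul,
      h.fiber.symm _ (h.mapsTo_snd hy), Matrix.transpose_zero]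
  det_ne := fun y hy => by
    rw [h.metric_eq hy, blocks_det, Matrix.det_smul]
    exact mul_ne_zero (h.base.det_ne _ (h.mapsTo_fst hy))
      (mul_ne_zero (pow_ne_zero _ (Real.exp_ne_zero _)) (h.fiber.det_ne _ (h.mapsTo_snd hy)))

theorem pdMat_il_metric (h : IsWarped G U v lam s A B) (hy : y ∈ U) (i : Fin 2) :
    pdMat (il i) G y = blocks (pdMat i v (fstPair y)) 0 0
      ((2 * pd i lam (fstPair y) * Real.exp (2 * lam (fstPair y))) • s (sndPair y)) := by
  rw [pdMat_congr_of_isOpen h.isOpen hy fun z hz => h.metric_eq hz, pdMat_blocks,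
    pdMat_il_fst h.base.isOpen h.base.smooth (h.mapsTo_fst hy), pdMat_zero]
  congr 1
  ext a b
  rw [pdMat_apply]
  simp only [Matrix.smul_apply, smul_eq_mul]
  have hs := h.smooth_snd (h.fiber.smooth a b)
  rw [pd_mul (h.smooth_exp.diffAt h.isOpen hy) (hs.diffAt h.isOpen hy), h.pd_il_exp hy,
    pd_il_snd (f := fun z => s z a b) ((h.fiber.smooth a b).diffAt h.fiber.isOpen (h.mapsTo_snd hy))]
  ring

theorem pdMat_ir_metric (h : IsWarped G U v lam s A B) (hy : y ∈ U) (i : Fin 2) :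
    pdMat (ir i) G y = blocks 0 0 0
      (Real.exp (2 * lam (fstPair y)) • pdMat i s (sndPair y)) := by
  rw [pdMat_congr_of_isOpen h.isOpen hy fun z hz => h.metric_eq hz, pdMat_blocks,
    pdMat_ir_fst h.base.isOpen h.base.smooth (h.mapsTo_fst hy), pdMat_zero]
  congr 1
  ext a b
  rw [pdMat_apply]
  simp only [Matrix.smul_apply, smul_eq_mul]
  have hs := h.smooth_snd (h.fiber.smooth a b)
  rw [pd_mul (h.smooth_exp.diffAt h.isOpen hy) (hs.diffAt h.isOpen hy), h.pd_ir_exp hy,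
    pd_ir_snd (f := fun z => s z a b) ((h.fiber.smooth a b).diffAt h.fiber.isOpen (h.mapsTo_snd hy)),
    pdMat_apply]
  ring

/-- The matrices of `warpConn` are torsion-free and compatible with the metric, and only one
connection has both properties; no Christoffel symbol has to be expanded. -/
theorem conn_eq (h : IsWarped G U v lam s A B) (hy : y ∈ U) (c : Fin 4) :
    conn G c y = warpConn v lam s y c := by
  have hf := h.mapsTo_fst hy
  have hs := h.mapsTo_snd hy
  symm
  refine h.isMetricOn.eq_conn hy (warpConn v lam s y) ?_ ?_ c
  · intro a b c
    induction a using forall_blocks with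
    | hl k => induction b using forall_blocks with
      | hl i => induction c using forall_blocks with
        | hl j => simp only [warpConn_il, blocks_ll, h.base.conn_symm hf k i j]
        | hr j => simp [warpConn_il, warpConn_ir]
      | hr i => induction c using forall_blocks with
        | hl j => simp [warpConn_il, warpConn_ir]
        | hr j => simp only [warpConn_ir, blocks_lr, Matrix.vecMulVec_apply, Pi.smul_apply,
            smul_eq_mul, h.fiber.symm_apply hs i j]
    | hr k => induction b using forall_blocks with
      | hl i => induction c using forall_blocks with
        | hl j => simp [warpConn_il]
        | hr j => simp [warpConn_il, warpConn_ir, Matrix.vecMulVec_apply, grad2, Matrix.one_apply,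
            Pi.single_apply]
      | hr i => induction c using forall_blocks with
        | hl j => simp [warpConn_il, warpConn_ir, Matrix.vecMulVec_apply, grad2, Matrix.one_apply,
            Pi.single_apply]
        | hr j => simp only [warpConn_ir, blocks_rr, h.fiber.conn_symm hs k i j]
  · intro c
    induction c using forall_blocks with
    | hl i =>
      rw [h.pdMat_il_metric hy, h.metric_eq hy, warpConn_il, blocks_mul, blocks_transpose,
        blocks_add, h.base.pdMat_metric hf]
      simp only [Matrix.mul_zero, Matrix.zero_mul, add_zero, zero_add, Matrix.transpose_zero,
        Matrix.mul_smul, Matrix.mul_one, Matrix.transpose_smul, h.fiber.symm _ hs, smul_zero]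
      refine congrArg _ ?_
      ext a b
      simp only [Matrix.add_apply, Matrix.smul_apply, smul_eq_mul]
      ring
    | hr C =>
      have hv1 : v (fstPair y) *ᵥ -((v (fstPair y))⁻¹ *ᵥ grad2 lam (fstPair y)) =
          -grad2 lam (fstPair y) := by
        rw [Matrix.mulVec_neg, Matrix.mulVec_mulVec, Matrix.mul_nonsing_inv _ (h.base.isUnit_det hf),
          Matrix.one_mulVec]
      have hs1 : (Real.exp (2 * lam (fstPair y)) • s (sndPair y)) *ᵥ Pi.single C 1 =
          Real.exp (2 * lam (fstPair y)) • s (sndPair y) C := by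
        ext a
        simp [h.fiber.symm_apply hs a C]
      rw [h.pdMat_ir_metric hy, h.metric_eq hy, warpConn_ir, blocks_mul, blocks_transpose,
        blocks_add, h.fiber.pdMat_metric hs]
      simp only [Matrix.mul_zero, Matrix.zero_mul, add_zero, zero_add, Matrix.mul_vecMulVec, hv1, hs1,
        Matrix.zero_mulVec, Matrix.zero_vecMulVec, Matrix.transpose_zero]
      simp only [Matrix.transpose_vecMulVec, Matrix.neg_vecMulVec, neg_add_cancel,
        Matrix.transpose_neg, add_neg_cancel, Matrix.smul_mul, Matrix.transpose_smul, smul_add]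

end IsWarped

end Warped

/-! ### Curvature components of a warped product -/

section WarpedCurvature

variable {G : Field4} {U : Set (Fin 4 → ℝ)} {v s : (Fin 2 → ℝ) → Matrix (Fin 2) (Fin 2) ℝ}
  {lam : (Fin 2 → ℝ) → ℝ} {A B : Set (Fin 2 → ℝ)} {y : Fin 4 → ℝ}

/-- The upper right block of a curvature matrix carries no additional information: after lowering an
index it is minus the transpose of the lower left block. The existential quantifier spares its
computation. -/
theorem exists_blocks_eq {a b c d a' c' d' : Matrix (Fin 2) (Fin 2) ℝ} (ha : a = a') (hc : c = c')
    (hd : d = d') : ∃ X, blocks a b c d = blocks a' X c' d' :=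
  ⟨b, by rw [ha, hc, hd]⟩

namespace IsWarped

theorem pdMat_conn_il (h : IsWarped G U v lam s A B) (hy : y ∈ U) (k : Fin 4) (i : Fin 2) :
    pdMat k (conn G (il i)) y = blocks (pdMat k (fun z => conn v i (fstPair z)) y) 0 0
      (pdMat k (fun z => pd i lam (fstPair z) • (1 : Matrix (Fin 2) (Fin 2) ℝ)) y) := by
  rw [pdMat_congr_of_isOpen h.isOpen hy fun z hz => (h.conn_eq hz (il i)).trans (warpConn_il i),
    pdMat_blocks, pdMat_zero]

theorem pdMat_conn_ir (h : IsWarped G U v lam s A B) (hy : y ∈ U) (k : Fin 4) (C : Fin 2) :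
    ∃ X, pdMat k (conn G (ir C)) y = blocks 0 X
      (pdMat k (fun z => Matrix.vecMulVec (Pi.single C 1) (grad2 lam (fstPair z))) y)
      (pdMat k (fun z => conn s C (sndPair z)) y) := by
  rw [pdMat_congr_of_isOpen h.isOpen hy fun z hz => (h.conn_eq hz (ir C)).trans (warpConn_ir C),
    pdMat_blocks, pdMat_zero]
  exact ⟨_, rfl⟩

theorem contDiffOn_pd_lam (h : IsWarped G U v lam s A B) (i : Fin 2) :
    ContDiffOn ℝ ∞ (pd i lam) A :=
  contDiffOn_pd h.base.isOpen h.smooth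

theorem pdMat_il_smul_one (h : IsWarped G U v lam s A B) (hy : y ∈ U) (i j : Fin 2) :
    pdMat (il i) (fun z => pd j lam (fstPair z) • (1 : Matrix (Fin 2) (Fin 2) ℝ)) y =
      pd i (pd j lam) (fstPair y) • 1 := by
  have hd := (h.contDiffOn_pd_lam j).diffAt h.base.isOpen (h.mapsTo_fst hy)
  ext a b
  rw [pdMat_apply]
  simp only [Matrix.smul_apply, smul_eq_mul, mul_comm _ ((1 : Matrix (Fin 2) (Fin 2) ℝ) a b)]
  rw [pd_const_mul _ (((h.smooth_fst (h.contDiffOn_pd_lam j)).diffAt h.isOpen hy)), pd_il_fst hd]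

theorem pdMat_ir_smul_one (h : IsWarped G U v lam s A B) (hy : y ∈ U) (i j : Fin 2) :
    pdMat (ir i) (fun z => pd j lam (fstPair z) • (1 : Matrix (Fin 2) (Fin 2) ℝ)) y = 0 := by
  have hd := (h.contDiffOn_pd_lam j).diffAt h.base.isOpen (h.mapsTo_fst hy)
  ext a b
  rw [pdMat_apply]
  simp only [Matrix.smul_apply, smul_eq_mul, mul_comm _ ((1 : Matrix (Fin 2) (Fin 2) ℝ) a b)]
  rw [pd_const_mul _ (((h.smooth_fst (h.contDiffOn_pd_lam j)).diffAt h.isOpen hy)), pd_ir_fst hd,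
    mul_zero, Matrix.zero_apply]

theorem pdMat_il_vecMulVec (h : IsWarped G U v lam s A B) (hy : y ∈ U) (i C a j : Fin 2) :
    pdMat (il i) (fun z => Matrix.vecMulVec (Pi.single C 1) (grad2 lam (fstPair z))) y a j =
      (Pi.single C 1 : Fin 2 → ℝ) a * pd i (pd j lam) (fstPair y) := by
  have hd := (h.contDiffOn_pd_lam j).diffAt h.base.isOpen (h.mapsTo_fst hy)
  rw [pdMat_apply]
  simp only [Matrix.vecMulVec_apply, grad2]
  rw [pd_const_mul _ (((h.smooth_fst (h.contDiffOn_pd_lam j)).diffAt h.isOpen hy)), pd_il_fst hd]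

theorem pdMat_ir_vecMulVec (h : IsWarped G U v lam s A B) (hy : y ∈ U) (i C : Fin 2) :
    pdMat (ir i) (fun z => Matrix.vecMulVec (Pi.single C 1) (grad2 lam (fstPair z))) y = 0 := by
  ext a j
  have hd := (h.contDiffOn_pd_lam j).diffAt h.base.isOpen (h.mapsTo_fst hy)
  rw [pdMat_apply]
  simp only [Matrix.vecMulVec_apply, grad2]
  rw [pd_const_mul _ (((h.smooth_fst (h.contDiffOn_pd_lam j)).diffAt h.isOpen hy)), pd_ir_fst hd,
    mul_zero, Matrix.zero_apply]

/-- Along the base the connection acts on the fibre block by the scalars `∂ᵢλ`. Scalars commute and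
`dλ` is closed, so this block contributes no curvature. -/
theorem curv_il_il (h : IsWarped G U v lam s A B) (hy : y ∈ U) (i j : Fin 2) :
    curv G y (il i) (il j) = blocks (curv v (fstPair y) i j) 0 0 0 := by
  have hf := h.mapsTo_fst hy
  rw [curv, h.pdMat_conn_il hy, h.pdMat_conn_il hy, h.conn_eq hy, h.conn_eq hy, warpConn_il,
    warpConn_il, blocks_mul, blocks_mul, blocks_sub, blocks_sub, blocks_add,
    h.pdMat_il_smul_one hy, h.pdMat_il_smul_one hy,
    pdMat_il_fst h.base.isOpen (h.base.smooth_conn j) hf,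
    pdMat_il_fst h.base.isOpen (h.base.smooth_conn i) hf,
    pd_comm h.base.isOpen h.smooth hf (i := i) (j := j)]
  simp [curv, mul_comm, smul_smul]

/-- This is the Gauss equation: the intrinsic curvature of the fibre is corrected by its second
fundamental form, which is pure trace and contributes the square norm of `dλ`. -/
theorem curv_ir_ir (h : IsWarped G U v lam s A B) (hy : y ∈ U) (C D : Fin 2) :
    ∃ X, curv G y (ir C) (ir D) = blocks 0 X 0 (curv s (sndPair y) C D
      - (gradSq v lam (fstPair y) * Real.exp (2 * lam (fstPair y))) •
        (Matrix.vecMulVec (Pi.single C 1) (s (sndPair y) D)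
          - Matrix.vecMulVec (Pi.single D 1) (s (sndPair y) C))) := by
  have hs := h.mapsTo_snd hy
  obtain ⟨X₁, h₁⟩ := h.pdMat_conn_ir hy (ir C) D
  obtain ⟨X₂, h₂⟩ := h.pdMat_conn_ir hy (ir D) C
  rw [curv, h₁, h₂, h.conn_eq hy, h.conn_eq hy, warpConn_ir, warpConn_ir, blocks_mul, blocks_mul,
    blocks_sub, blocks_sub, blocks_add, h.pdMat_ir_vecMulVec hy, h.pdMat_ir_vecMulVec hy,
    pdMat_ir_snd h.fiber.isOpen (h.fiber.smooth_conn D) hs,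
    pdMat_ir_snd h.fiber.isOpen (h.fiber.smooth_conn C) hs]
  refine exists_blocks_eq ?_ ?_ ?_
  · rw [Matrix.vecMulVec_mul_vecMulVec, Matrix.vecMulVec_mul_vecMulVec, dotProduct_single,
      dotProduct_single, Pi.smul_apply, Pi.smul_apply, h.fiber.symm_apply hs C D]
    simp only [Matrix.mul_zero, zero_add, sub_self, add_zero]
  · ext a j
    simp [Matrix.mul_vecMulVec, Matrix.vecMulVec_apply, h.fiber.conn_symm hs a D C]
  · rw [curv, Matrix.vecMulVec_mul_vecMulVec, Matrix.vecMulVec_mul_vecMulVec]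
    have : grad2 lam (fstPair y) ⬝ᵥ -((v (fstPair y))⁻¹ *ᵥ grad2 lam (fstPair y)) =
      -gradSq v lam (fstPair y) := by rw [dotProduct_neg, gradSq]
    rw [this]
    ext a b
    simp only [Matrix.add_apply, Matrix.sub_apply, Matrix.smul_apply, Matrix.vecMulVec_apply,
      Pi.smul_apply, smul_eq_mul]
    ring

theorem curv_il_ir (h : IsWarped G U v lam s A B) (hy : y ∈ U) (i C : Fin 2) :
    ∃ X, curv G y (il i) (ir C) = blocks 0 X
      (-Matrix.vecMulVec (Pi.single C 1) (warpHess v lam (fstPair y) i)) 0 := by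
  have hf := h.mapsTo_fst hy
  have hs := h.mapsTo_snd hy
  obtain ⟨X₁, h₁⟩ := h.pdMat_conn_ir hy (il i) C
  rw [curv, h₁, h.pdMat_conn_il hy, h.conn_eq hy, h.conn_eq hy, warpConn_il, warpConn_ir, blocks_mul,
    blocks_mul, blocks_sub, blocks_sub, blocks_add, h.pdMat_ir_smul_one hy,
    pdMat_il_snd h.fiber.isOpen (h.fiber.smooth_conn C) hs,
    pdMat_ir_fst h.base.isOpen (h.base.smooth_conn i) hf]
  refine exists_blocks_eq ?_ ?_ ?_
  · simp
  · ext a j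
    simp only [Matrix.add_apply, Matrix.sub_apply, h.pdMat_il_vecMulVec hy, Matrix.neg_apply,
      Matrix.vecMulVec_apply, Matrix.mul_zero, Matrix.zero_apply,
      Matrix.vecMulVec_mul, warpHess, Matrix.of_apply, Matrix.smul_mul, Matrix.one_mul,
      Matrix.smul_apply, smul_eq_mul, Matrix.vecMul, dotProduct, grad2, Fin.sum_univ_two]
    ring
  · simp

/-- The value of the sectional curvature of the fibres in a warped product. -/
def fiberSec (v : (Fin 2 → ℝ) → Matrix (Fin 2) (Fin 2) ℝ) (lam : (Fin 2 → ℝ) → ℝ)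
    (s : (Fin 2 → ℝ) → Matrix (Fin 2) (Fin 2) ℝ) (y : Fin 4 → ℝ) : ℝ :=
  Real.exp (-2 * lam (fstPair y)) * gaussCurvature s (sndPair y) - gradSq v lam (fstPair y)

theorem riemann_llll (h : IsWarped G U v lam s A B) (hy : y ∈ U) (i j k l : Fin 2) :
    riemann G y (il i) (il j) (il k) (il l) = gaussCurvature v (fstPair y) *
      (v (fstPair y) i k * v (fstPair y) j l - v (fstPair y) i l * v (fstPair y) j k) := by
  rw [h.isMetricOn.riemann_eq hy, h.curv_il_il hy, h.metric_eq hy, blocks_mul, blocks_ll,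
    ← h.base.riemann_eq_gaussCurvature (h.mapsTo_fst hy), h.base.riemann_eq (h.mapsTo_fst hy)]
  simp

theorem riemann_rrrr (h : IsWarped G U v lam s A B) (hy : y ∈ U) (a b c d : Fin 2) :
    riemann G y (ir a) (ir b) (ir c) (ir d) = fiberSec v lam s y *
      (G y (ir a) (ir c) * G y (ir b) (ir d) - G y (ir a) (ir d) * G y (ir b) (ir c)) := by
  have hs := h.mapsTo_snd hy
  obtain ⟨X, hX⟩ := h.curv_ir_ir hy c d
  have hR := h.fiber.riemann_eq_gaussCurvature hs a b c d
  rw [h.fiber.riemann_eq hs] at hR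
  rw [h.isMetricOn.riemann_eq hy, hX, h.metric_eq hy, blocks_mul, blocks_rr, Matrix.mul_sub,
    Matrix.smul_mul, Matrix.mul_smul, Matrix.smul_mul, Matrix.mul_sub, Matrix.mul_vecMulVec,
    Matrix.mul_vecMulVec]
  simp only [Matrix.zero_mul, zero_add, Matrix.sub_apply, Matrix.smul_apply, hR, blocks_rr,
    smul_eq_mul, Matrix.vecMulVec_apply, Matrix.mulVec_single_one, Matrix.col_apply, fiberSec]
  rw [h.fiber.symm_apply hs d b, h.fiber.symm_apply hs c b]
  have e : Real.exp (-2 * lam (fstPair y)) * Real.exp (2 * lam (fstPair y)) = 1 := by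
    rw [← Real.exp_add]
    simp
  linear_combination (-gaussCurvature s (sndPair y) * Real.exp (2 * lam (fstPair y)) *
    (s (sndPair y) a c * s (sndPair y) b d - s (sndPair y) a d * s (sndPair y) b c)) * e

theorem riemann_rlrl (h : IsWarped G U v lam s A B) (hy : y ∈ U) (a j c i : Fin 2) :
    riemann G y (ir a) (il j) (ir c) (il i) =
      G y (ir a) (ir c) * warpHess v lam (fstPair y) i j := by
  obtain ⟨X, hX⟩ := h.curv_il_ir hy i c
  rw [h.isMetricOn.riemann_antisymm_right hy, h.isMetricOn.riemann_eq hy, hX, h.metric_eq hy,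
    blocks_mul, blocks_rl, Matrix.mul_neg, Matrix.smul_mul, Matrix.mul_vecMulVec]
  simp [Matrix.vecMulVec_apply]
  ring

theorem riemann_rlll (h : IsWarped G U v lam s A B) (hy : y ∈ U) (a j k l : Fin 2) :
    riemann G y (ir a) (il j) (il k) (il l) = 0 := by
  rw [h.isMetricOn.riemann_eq hy, h.curv_il_il hy, h.metric_eq hy, blocks_mul, blocks_rl]
  simp

theorem riemann_rlrr (h : IsWarped G U v lam s A B) (hy : y ∈ U) (a j c d : Fin 2) :
    riemann G y (ir a) (il j) (ir c) (ir d) = 0 := by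
  obtain ⟨X, hX⟩ := h.curv_ir_ir hy c d
  rw [h.isMetricOn.riemann_eq hy, hX, h.metric_eq hy, blocks_mul, blocks_rl]
  simp

end IsWarped

end WarpedCurvature

/-! ### Ricci and Weyl tensor of a warped product -/

section WarpedRicci

variable {G : Field4} {U : Set (Fin 4 → ℝ)} {v s : (Fin 2 → ℝ) → Matrix (Fin 2) (Fin 2) ℝ}
  {lam : (Fin 2 → ℝ) → ℝ} {A B : Set (Fin 2 → ℝ)} {y : Fin 4 → ℝ}

/-- The fibre part of a warped product metric. -/
def fiberMetric (lam : (Fin 2 → ℝ) → ℝ) (s : (Fin 2 → ℝ) → Matrix (Fin 2) (Fin 2) ℝ)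
    (y : Fin 4 → ℝ) : Matrix (Fin 2) (Fin 2) ℝ :=
  Real.exp (2 * lam (fstPair y)) • s (sndPair y)

/-- The trace of the mixed part of the curvature of a warped product. -/
def warpLap (v : (Fin 2 → ℝ) → Matrix (Fin 2) (Fin 2) ℝ) (lam : (Fin 2 → ℝ) → ℝ)
    (z : Fin 2 → ℝ) : ℝ :=
  ((v z)⁻¹ * warpHess v lam z).trace

theorem neg_blocks {a b c d : Matrix (Fin 2) (Fin 2) ℝ} :
    -blocks a b c d = blocks (-a) (-b) (-c) (-d) := by
  apply eq_blocks <;> simp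

theorem blocks_congr {a b c d a' b' c' d' : Matrix (Fin 2) (Fin 2) ℝ} (ha : a = a') (hb : b = b')
    (hc : c = c') (hd : d = d') : blocks a b c d = blocks a' b' c' d' := by
  rw [ha, hb, hc, hd]

theorem sum_inv_mul_eq_trace (X Y : Matrix (Fin 2) (Fin 2) ℝ) :
    ∑ i, ∑ k, X i k * Y k i = (X * Y).trace := by
  simp only [Matrix.trace, Matrix.diag, Matrix.mul_apply]

theorem trace_contraction {V : Matrix (Fin 2) (Fin 2) ℝ} (hV : V.det ≠ 0)
    (j l : Fin 2) : ∑ i, ∑ k, V⁻¹ i k * (V k i * V j l - V k l * V j i) = V j l := by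
  have h1 : ∑ i, ∑ k, V⁻¹ i k * V k i = 2 := by
    rw [sum_inv_mul_eq_trace, Matrix.nonsing_inv_mul _ hV.isUnit]
    simp
  have h2 : ∑ i, ∑ k, V⁻¹ i k * V k l * V j i = V j l := by
    have : ∀ i, ∑ k, V⁻¹ i k * V k l * V j i = V j i * (V⁻¹ * V) i l := fun i => by
      rw [Matrix.mul_apply, Finset.mul_sum]
      exact Finset.sum_congr rfl fun _ _ => by ring
    simp only [this]
    rw [← Matrix.mul_apply, Matrix.nonsing_inv_mul _ hV.isUnit, Matrix.mul_one]
  have h3 : ∑ i, ∑ k, V⁻¹ i k * (V k i * V j l - V k l * V j i) =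
      (∑ i, ∑ k, V⁻¹ i k * V k i) * V j l - ∑ i, ∑ k, V⁻¹ i k * V k l * V j i := by
    simp only [Finset.sum_mul, ← Finset.sum_sub_distrib]
    exact Finset.sum_congr rfl fun _ _ => Finset.sum_congr rfl fun _ _ => by ring
  rw [h3, h1, h2]
  ring

namespace IsWarped

theorem metric_eq' (h : IsWarped G U v lam s A B) (hy : y ∈ U) :
    G y = blocks (v (fstPair y)) 0 0 (fiberMetric lam s y) :=
  h.metric_eq hy

theorem det_base (h : IsWarped G U v lam s A B) (hy : y ∈ U) : (v (fstPair y)).det ≠ 0 :=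
  h.base.det_ne _ (h.mapsTo_fst hy)

theorem det_fiber (h : IsWarped G U v lam s A B) (hy : y ∈ U) : (fiberMetric lam s y).det ≠ 0 := by
  rw [fiberMetric, Matrix.det_smul]
  exact mul_ne_zero (pow_ne_zero _ (Real.exp_ne_zero _)) (h.fiber.det_ne _ (h.mapsTo_snd hy))

theorem fiber_symm (h : IsWarped G U v lam s A B) (hy : y ∈ U) :
    (fiberMetric lam s y)ᵀ = fiberMetric lam s y := by
  rw [fiberMetric, Matrix.transpose_smul, h.fiber.symm _ (h.mapsTo_snd hy)]

theorem inv_eq (h : IsWarped G U v lam s A B) (hy : y ∈ U) :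
    (G y)⁻¹ = blocks (v (fstPair y))⁻¹ 0 0 (fiberMetric lam s y)⁻¹ := by
  rw [h.metric_eq' hy, blocks_inv (h.det_base hy) (h.det_fiber hy)]

theorem warpHess_symm (h : IsWarped G U v lam s A B) (hy : y ∈ U) :
    (warpHess v lam (fstPair y))ᵀ = warpHess v lam (fstPair y) := by
  ext i j
  simp only [warpHess, Matrix.transpose_apply, Matrix.of_apply]
  rw [pd_comm h.base.isOpen h.smooth (h.mapsTo_fst hy) (i := j) (j := i)]
  simp only [h.base.conn_symm (h.mapsTo_fst hy) _ i j]
  ring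

theorem ricci_eq (h : IsWarped G U v lam s A B) (hy : y ∈ U) :
    ricci G y = blocks
      (gaussCurvature v (fstPair y) • v (fstPair y) + (2 : ℝ) • warpHess v lam (fstPair y)) 0 0
      ((fiberSec v lam s y + warpLap v lam (fstPair y)) • fiberMetric lam s y) := by
  have hG := h.isMetricOn
  have hl := hG.riemann_antisymm_left hy
  have hr := hG.riemann_antisymm_right hy
  have hS : ∀ i j, warpHess v lam (fstPair y) i j = warpHess v lam (fstPair y) j i := fun i j =>
    congrFun (congrFun (h.warpHess_symm hy).symm i) j
  have hric : ∀ b d, ricci G y b d = (∑ i, ∑ k, (v (fstPair y))⁻¹ i k *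
      riemann G y (il k) b (il i) d) + ∑ a, ∑ c, (fiberMetric lam s y)⁻¹ a c *
      riemann G y (ir c) b (ir a) d := by
    intro b d
    simp only [ricci, Matrix.of_apply, hG.riemannUp_eq_sum hy, h.inv_eq hy]
    simp [sum_blocks]
  have hlr : ∀ j d, ricci G y (il j) (ir d) = 0 := by
    intro j d
    rw [hric]
    simp only [h.riemann_rlrr hy, mul_zero, Finset.sum_const_zero, add_zero]
    refine Finset.sum_eq_zero fun i _ => Finset.sum_eq_zero fun k _ => ?_
    rw [hG.riemann_pair_symm hy, hl, h.riemann_rlll hy, neg_zero, mul_zero]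
  apply eq_blocks
  · intro j l
    rw [hric]
    simp only [h.riemann_llll hy, h.riemann_rlrl hy]
    rw [Matrix.add_apply, Matrix.smul_apply, Matrix.smul_apply, smul_eq_mul, smul_eq_mul]
    congr 1
    · have e := trace_contraction (h.det_base hy) j l
      conv_rhs => rw [← e, Finset.mul_sum]
      refine Finset.sum_congr rfl fun _ _ => ?_
      rw [Finset.mul_sum]
      exact Finset.sum_congr rfl fun _ _ => by ring
    · have e : ∑ a, ∑ c, (fiberMetric lam s y)⁻¹ a c * fiberMetric lam s y c a = 2 := by
        rw [sum_inv_mul_eq_trace, Matrix.nonsing_inv_mul _ (h.det_fiber hy).isUnit]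
        simp
      rw [← e, Finset.sum_mul, hS j l]
      refine Finset.sum_congr rfl fun _ _ => ?_
      rw [Finset.sum_mul]
      refine Finset.sum_congr rfl fun _ _ => ?_
      rw [h.metric_eq' hy, blocks_rr]
      ring
  · intro j d
    rw [hlr, Matrix.zero_apply]
  · intro b l
    rw [← congrFun (congrFun (hG.ricci_symm hy) (ir b)) (il l), Matrix.transpose_apply, hlr,
      Matrix.zero_apply]
  · intro b d
    rw [hric]
    simp only [h.riemann_rrrr hy]
    rw [Matrix.smul_apply, smul_eq_mul, add_mul, add_comm]
    congr 1
    · have e := trace_contraction (h.det_fiber hy) b d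
      simp only [h.metric_eq' hy, blocks_rr]
      conv_rhs => rw [← e, Finset.mul_sum]
      refine Finset.sum_congr rfl fun _ _ => ?_
      rw [Finset.mul_sum]
      exact Finset.sum_congr rfl fun _ _ => by ring
    · rw [warpLap, ← sum_inv_mul_eq_trace, Finset.sum_mul]
      refine Finset.sum_congr rfl fun i _ => ?_
      rw [Finset.sum_mul]
      refine Finset.sum_congr rfl fun k _ => ?_
      rw [hl, hr, neg_neg, h.riemann_rlrl hy, h.metric_eq' hy, blocks_rr, hS i k]
      ring

theorem scal_eq (h : IsWarped G U v lam s A B) (hy : y ∈ U) :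
    scal G y = 2 * gaussCurvature v (fstPair y) + 4 * warpLap v lam (fstPair y)
      + 2 * fiberSec v lam s y := by
  rw [scal, tr, h.ricci_eq hy, h.inv_eq hy, blocks_mul, blocks_trace]
  simp only [Matrix.mul_zero, add_zero, Matrix.mul_add, Matrix.mul_smul, zero_add,
    Matrix.nonsing_inv_mul _ (h.det_base hy).isUnit,
    Matrix.nonsing_inv_mul _ (h.det_fiber hy).isUnit, Matrix.trace_add, Matrix.trace_smul,
    Matrix.trace_one, Fintype.card_fin, smul_eq_mul, warpLap]
  push_cast
  ring

/-- The double eigenvalue of the Weyl tensor of a warped product. -/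
def weylValue (v : (Fin 2 → ℝ) → Matrix (Fin 2) (Fin 2) ℝ) (lam : (Fin 2 → ℝ) → ℝ)
    (s : (Fin 2 → ℝ) → Matrix (Fin 2) (Fin 2) ℝ) (y : Fin 4 → ℝ) : ℝ :=
  (warpLap v lam (fstPair y) - fiberSec v lam s y - gaussCurvature v (fstPair y)) / 6

/-- The Ricci eigenvalue of the fibres, minus a quarter of the scalar curvature. -/
def fiberNu (v : (Fin 2 → ℝ) → Matrix (Fin 2) (Fin 2) ℝ) (lam : (Fin 2 → ℝ) → ℝ)
    (s : (Fin 2 → ℝ) → Matrix (Fin 2) (Fin 2) ℝ) (y : Fin 4 → ℝ) : ℝ :=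
  (fiberSec v lam s y - gaussCurvature v (fstPair y)) / 2

/-- Components of the Riemann tensor with an odd number of fibre indices vanish. Hence a form that
pairs base with fibre meets only the mixed components, which are governed by `warpHess`. -/
theorem riemannContract_mixed (h : IsWarped G U v lam s A B) (hy : y ∈ U)
    (β : Matrix (Fin 2) (Fin 2) ℝ) :
    riemannContract G y (blocks 0 β (-βᵀ) 0) =
      blocks 0 ((2 : ℝ) • (warpHess v lam (fstPair y) * β * fiberMetric lam s y))
        (-((2 : ℝ) • (warpHess v lam (fstPair y) * β * fiberMetric lam s y))ᵀ) 0 := by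
  have hG := h.isMetricOn
  have hl := hG.riemann_antisymm_left hy
  have hr := hG.riemann_antisymm_right hy
  have hS : ∀ i j, warpHess v lam (fstPair y) i j = warpHess v lam (fstPair y) j i := fun i j =>
    congrFun (congrFun (h.warpHess_symm hy).symm i) j
  have hent : ∀ a b, riemannContract G y (blocks 0 β (-βᵀ) 0) a b =
      ∑ i, ∑ C, 2 * β i C * riemann G y a b (il i) (ir C) := by
    intro a b
    simp only [riemannContract, Matrix.sum_apply, Matrix.smul_apply, smul_eq_mul,
      ← hG.riemann_eq hy]
    simp only [sum_blocks, blocks_ll, blocks_lr, blocks_rl, blocks_rr, Matrix.zero_apply, zero_mul,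
      Finset.sum_const_zero, zero_add, add_zero, Matrix.neg_apply, Matrix.transpose_apply]
    rw [Finset.sum_comm (f := fun (x : Fin 2) x_1 => -β x_1 x * _), ← Finset.sum_add_distrib]
    refine Finset.sum_congr rfl fun i _ => ?_
    rw [← Finset.sum_add_distrib]
    refine Finset.sum_congr rfl fun C _ => ?_
    rw [hr a b (ir C) (il i)]
    ring
  have hlr : ∀ j a, riemannContract G y (blocks 0 β (-βᵀ) 0) (il j) (ir a) =
      ((2 : ℝ) • (warpHess v lam (fstPair y) * β * fiberMetric lam s y)) j a := by
    intro j a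
    rw [hent, Matrix.smul_apply, smul_eq_mul, Matrix.mul_assoc, Matrix.mul_apply, Finset.mul_sum]
    refine Finset.sum_congr rfl fun i _ => ?_
    rw [Matrix.mul_apply, Finset.mul_sum, Finset.mul_sum]
    refine Finset.sum_congr rfl fun C _ => ?_
    rw [hl, hr, neg_neg, h.riemann_rlrl hy, h.metric_eq' hy, blocks_rr, hS i j,
      ← congrFun (congrFun (h.fiber_symm hy) a) C, Matrix.transpose_apply]
    ring
  apply eq_blocks
  · intro i j
    rw [hent]
    refine Finset.sum_eq_zero fun k _ => Finset.sum_eq_zero fun C _ => ?_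
    rw [hG.riemann_pair_symm hy, hl, h.riemann_rlll hy, neg_zero, mul_zero]
  · exact hlr
  · intro a j
    rw [Matrix.neg_apply, Matrix.transpose_apply, ← hlr, hent, hent, ← Finset.sum_neg_distrib]
    refine Finset.sum_congr rfl fun _ _ => ?_
    rw [← Finset.sum_neg_distrib]
    refine Finset.sum_congr rfl fun _ _ => ?_
    rw [hl]
    ring
  · intro a b
    rw [hent]
    refine Finset.sum_eq_zero fun k _ => Finset.sum_eq_zero fun C _ => ?_
    rw [hG.riemann_pair_symm hy, hl, h.riemann_rlrr hy, neg_zero, mul_zero]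

/-- `warpHess` enters once through the Riemann tensor and once, with opposite sign, through the base
block of the Ricci tensor. The two contributions cancel and a multiple of the identity remains. -/
theorem weylMap_mixed (h : IsWarped G U v lam s A B) (hy : y ∈ U) (b : Matrix (Fin 2) (Fin 2) ℝ) :
    weylMap G y (blocks 0 b (-bᵀ) 0) = weylValue v lam s y • blocks 0 b (-bᵀ) 0 := by
  set V := v (fstPair y) with hV
  set H := fiberMetric lam s y with hH
  set S := warpHess v lam (fstPair y) with hS
  have hVi : (V⁻¹)ᵀ = V⁻¹ := h.base.inv_symm (h.mapsTo_fst hy)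
  have hHi : (H⁻¹)ᵀ = H⁻¹ := by rw [Matrix.transpose_nonsing_inv, h.fiber_symm hy]
  have hVT : Vᵀ = V := h.base.symm _ (h.mapsTo_fst hy)
  have hHT : Hᵀ = H := h.fiber_symm hy
  have hST : Sᵀ = S := h.warpHess_symm hy
  set β := V⁻¹ * b * H⁻¹ with hβ
  have hX : blocks 0 β (-βᵀ) 0 = (G y)⁻¹ * blocks 0 b (-bᵀ) 0 * (G y)⁻¹ := by
    rw [h.inv_eq hy, blocks_mul, blocks_mul, ← hV, ← hH]
    simp only [Matrix.mul_zero, Matrix.zero_mul, add_zero, zero_add, hβ, Matrix.transpose_mul, hVi,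
      hHi, Matrix.mul_neg, Matrix.neg_mul, Matrix.mul_assoc, neg_zero]
  have hXT : blocks 0 β (-βᵀ) 0 - (blocks 0 β (-βᵀ) 0)ᵀ = (2 : ℝ) • blocks 0 β (-βᵀ) 0 := by
    rw [blocks_transpose, blocks_sub, smul_blocks]
    simp [two_smul, sub_eq_add_neg]
  have hb : V * β * H = b := by
    rw [hβ]
    simp only [Matrix.mul_assoc]
    rw [Matrix.nonsing_inv_mul _ (h.det_fiber hy).isUnit, Matrix.mul_one,
      Matrix.mul_nonsing_inv_cancel_left _ _ (h.det_base hy).isUnit]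
  have hbT : H * βᵀ * V = bᵀ := by
    rw [← hb]
    simp only [Matrix.transpose_mul, hVT, hHT, Matrix.mul_assoc]
  rw [weylMap_eq h.isMetricOn hy _ _ hX, hXT, h.riemannContract_mixed hy, h.ricci_eq hy,
    h.scal_eq hy, h.metric_eq' hy]
  simp only [Matrix.mul_smul, Matrix.smul_mul, blocks_mul, smul_blocks, blocks_add, blocks_sub,
    Matrix.mul_zero, Matrix.zero_mul, add_zero, zero_add, smul_zero, sub_zero, ← hV, ← hH, ← hS,
    Matrix.mul_neg, Matrix.neg_mul, Matrix.add_mul, Matrix.mul_add, hb, hbT, Matrix.transpose_smul,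
    Matrix.transpose_mul, hHT, hST, smul_neg, smul_add]
  simp only [← Matrix.mul_assoc, weylValue]
  refine blocks_congr ?_ ?_ ?_ ?_
  · simp
  · module
  · module
  · simp

/-- The forms pairing base and fibre are parametrised by arbitrary `2 × 2` matrices, hence fill the
four dimensions. -/
theorem isDoubleWeylEigenvalue (h : IsWarped G U v lam s A B) (hy : y ∈ U) :
    IsDoubleWeylEigenvalue G y (weylValue v lam s y) := by
  let f : Matrix (Fin 2) (Fin 2) ℝ →ₗ[ℝ] weylEigenspace G y (weylValue v lam s y) :=
    { toFun := fun b => ⟨blocks 0 b (-bᵀ) 0, by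
        refine ⟨?_, h.weylMap_mixed hy b⟩
        rw [blocks_transpose, neg_blocks, neg_zero, neg_neg, Matrix.transpose_neg,
          Matrix.transpose_transpose, Matrix.transpose_zero]⟩
      map_add' := fun b b' => by
        ext1
        change blocks 0 (b + b') (-(b + b')ᵀ) 0 = blocks 0 b (-bᵀ) 0 + blocks 0 b' (-b'ᵀ) 0
        rw [blocks_add, Matrix.transpose_add, neg_add, add_zero]
      map_smul' := fun r b => by
        ext1
        change blocks 0 (r • b) (-(r • b)ᵀ) 0 = r • blocks 0 b (-bᵀ) 0
        rw [smul_blocks, Matrix.transpose_smul, smul_neg, smul_zero] }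
  have h4 : Module.finrank ℝ (Matrix (Fin 2) (Fin 2) ℝ) = 4 := by
    simp [Module.finrank_matrix]
  refine h4.ge.trans ?_
  refine LinearMap.finrank_le_finrank_of_injective (f := f) fun b b' hbb => ?_
  have h1 : blocks 0 b (-bᵀ) 0 = blocks 0 b' (-b'ᵀ) 0 := congrArg Subtype.val hbb
  ext i j
  have h2 := congrFun (congrFun h1 (il i)) (ir j)
  rwa [blocks_lr, blocks_lr] at h2

end IsWarped

/-- A double eigenvalue of the Weyl tensor is unique. -/
theorem IsDoubleWeylEigenvalue.unique {G : Field4} {y : Fin 4 → ℝ} {φ ψ : ℝ}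
    (hφ : IsDoubleWeylEigenvalue G y φ) (hψ : IsDoubleWeylEigenvalue G y ψ) : φ = ψ := by
  by_contra hne
  let W : Submodule ℝ (Matrix (Fin 4) (Fin 4) ℝ) :=
    { carrier := {F | Fᵀ = -F}
      zero_mem' := by simp
      add_mem' := fun {F F'} h1 h2 => by
        change (F + F')ᵀ = -(F + F')
        rw [Matrix.transpose_add, h1, h2, neg_add]
      smul_mem' := fun s F h1 => by
        change (s • F)ᵀ = -(s • F)
        rw [Matrix.transpose_smul, h1, smul_neg] }
  have hW : Module.finrank ℝ W ≤ 6 := by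
    let f : W →ₗ[ℝ] (Fin 6 → ℝ) :=
      { toFun := fun F => ![F.1 0 1, F.1 0 2, F.1 0 3, F.1 1 2, F.1 1 3, F.1 2 3]
        map_add' := fun F F' => by
          ext i
          fin_cases i <;> rfl
        map_smul' := fun s F => by
          ext i
          fin_cases i <;> rfl }
    have hf : Function.Injective f := by
      rw [← LinearMap.ker_eq_bot, LinearMap.ker_eq_bot']
      intro F hF
      have hs : ∀ i j, F.1 j i = -F.1 i j := fun i j => congrFun (congrFun F.2 i) j
      have e : ∀ k, f F k = 0 := fun k => by rw [hF]; rfl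
      have e01 : F.1 0 1 = 0 := e 0
      have e02 : F.1 0 2 = 0 := e 1
      have e03 : F.1 0 3 = 0 := e 2
      have e12 : F.1 1 2 = 0 := e 3
      have e13 : F.1 1 3 = 0 := e 4
      have e23 : F.1 2 3 = 0 := e 5
      have ed : ∀ i, F.1 i i = 0 := fun i => by linarith [hs i i]
      apply Subtype.ext
      ext i j
      fin_cases i <;> fin_cases j <;>
        simp [ed, e01, e02, e03, e12, e13, e23, hs 0 1, hs 0 2, hs 0 3, hs 1 2, hs 1 3, hs 2 3]
    simpa using LinearMap.finrank_le_finrank_of_injective hf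
  have h1 : weylEigenspace G y φ ≤ W := fun F hF => hF.1
  have h2 : weylEigenspace G y ψ ≤ W := fun F hF => hF.1
  have hinf : weylEigenspace G y φ ⊓ weylEigenspace G y ψ = ⊥ := by
    rw [eq_bot_iff]
    rintro F ⟨⟨-, ha⟩, ⟨-, hb⟩⟩
    have : (φ - ψ) • F = 0 := by rw [sub_smul, ← ha, ← hb, sub_self]
    exact (smul_eq_zero.1 this).resolve_left (sub_ne_zero.2 hne)
  -- Eigenspaces of different eigenvalues meet in zero, but `4 + 4 > 6`.
  have h3 := Submodule.finrank_sup_add_finrank_inf_eq (weylEigenspace G y φ) (weylEigenspace G y ψ)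
  rw [hinf, finrank_bot] at h3
  have h4 := Submodule.finrank_mono (sup_le h1 h2)
  unfold IsDoubleWeylEigenvalue at hφ hψ
  omega

end WarpedRicci

/-! ### The invariants of a traceless tensor with a double eigenvalue -/

section Invariants

/-- The values of `tr N²`, `tr N³`, `tr N⁴` for eigenvalues `ν, ν, -ν ± √t` determine `ν`. -/
theorem isNu_of_eigenvalues {b c d ν t : ℝ} (hb : b = 4 * ν ^ 2 + 2 * t) (hc : c = -6 * ν * t)
    (hd : d = 4 * ν ^ 4 + 12 * ν ^ 2 * t + 2 * t ^ 2) (ht : t ≠ 4 * ν ^ 2) : IsNu b c d ν := by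
  have ht' : 4 * ν ^ 2 - t ≠ 0 := fun h => ht (by linarith)
  unfold IsNu
  -- For `t = 0` one has `b = 4ν²`, `c = 0` and `b² = 4d`, so only the absolute value of `ν` can be
  -- recovered.
  by_cases h0 : t = 0
  · have hbd : b ^ 2 = 4 * d ∧ 0 ≤ b := by
      rw [hb, hd, h0]
      exact ⟨by ring, by positivity⟩
    rw [if_pos hbd]
    have hsq : √b = 2 * |ν| := by
      rw [hb, h0, show 4 * ν ^ 2 + 2 * 0 = (2 * |ν|) ^ 2 by rw [mul_pow, sq_abs]; ring,
        Real.sqrt_sq (by positivity)]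
    rw [hsq]
    rcases abs_choice ν with h | h
    · left
      rw [h]
      ring
    · right
      rw [h]
      ring
  · have hden : b * (b ^ 2 - 4 * d) + 4 * c ^ 2 = -8 * t * (4 * ν ^ 2 - t) ^ 2 := by
      rw [hb, hc, hd]
      ring
    have hne : b * (b ^ 2 - 4 * d) + 4 * c ^ 2 ≠ 0 := by
      rw [hden]
      positivity
    -- Since `b² - 4d = -4t(8ν² + t)`, the equality `b² = 4d` also occurs for `t = -8ν²`; there `b =
    -- -12ν²`, and the condition `0 ≤ b` excludes this case unless `ν = t = 0`.
    have hbd : ¬(b ^ 2 = 4 * d ∧ 0 ≤ b) := by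
      rintro ⟨h1, h2⟩
      have h3 : t * (8 * ν ^ 2 + t) = 0 := by
        rw [hb, hd] at h1
        linarith
      have h4 : t = -8 * ν ^ 2 := by
        have := (mul_eq_zero.1 h3).resolve_left h0
        linarith
      have h5 : ν ^ 2 = 0 := by
        rw [hb, h4] at h2
        nlinarith [sq_nonneg ν]
      exact h0 (by rw [h4, h5]; ring)
    rw [if_neg hbd]
    refine ⟨hne, ?_⟩
    rw [hden]
    have : c * (7 * b ^ 2 - 12 * d) = 3 * (-8 * t * (4 * ν ^ 2 - t) ^ 2) * ν := by
      rw [hb, hc, hd]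
      ring
    rw [this, mul_div_cancel_left₀]
    positivity

/-- The possible values of `ν` for eigenvalues `ν₀, ν₀, -ν₀ ± √t`. -/
theorem eq_or_eq_neg_of_isNu {b c d ν₀ ν t : ℝ} (hb : b = 4 * ν₀ ^ 2 + 2 * t)
    (hc : c = -6 * ν₀ * t) (hd : d = 4 * ν₀ ^ 4 + 12 * ν₀ ^ 2 * t + 2 * t ^ 2)
    (ht : t ≠ 4 * ν₀ ^ 2) (hν : IsNu b c d ν) : ν = ν₀ ∨ (t = 0 ∧ ν = -ν₀) := by
  have h₀ := isNu_of_eigenvalues hb hc hd ht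
  unfold IsNu at h₀ hν
  split_ifs at h₀ hν with h
  · have hs : b = 4 * ν₀ ^ 2 := by
      have := Real.sq_sqrt h.2
      rcases h₀ with h1 | h1 <;> rw [h1] <;> linear_combination -this
    have ht0 : t = 0 := by linarith
    rcases h₀ with h1 | h1 <;> rcases hν with h2 | h2
    · left; rw [h1, h2]
    · right; exact ⟨ht0, by rw [h1, h2]⟩
    · right; exact ⟨ht0, by rw [h1, h2, neg_neg]⟩
    · left; rw [h1, h2]
  · left
    rw [h₀.2, hν.2]

variable {G : Field4} {y : Fin 4 → ℝ} {V H N : Matrix (Fin 2) (Fin 2) ℝ} {ν₀ : ℝ}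

/-- The discriminant of the base part of a traceless tensor. -/
def discr (V N : Matrix (Fin 2) (Fin 2) ℝ) (ν₀ : ℝ) : ℝ := ν₀ ^ 2 - (V⁻¹ * N).det

/-- Cayley-Hamilton for the base block. It makes all traces of powers polynomials in `ν₀` and
`discr`, so that the possibly complex eigenvalues `-ν₀ ± √discr` are never needed. -/
theorem sq_of_trace {X : Matrix (Fin 2) (Fin 2) ℝ} (hX : X.trace = -2 * ν₀) :
    X * X = (-2 * ν₀) • X - X.det • (1 : Matrix (Fin 2) (Fin 2) ℝ) := by
  rw [← hX]
  ext i j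
  fin_cases i <;> fin_cases j <;>
    simp [Matrix.mul_apply, Fin.sum_univ_two, Matrix.trace_fin_two, Matrix.det_fin_two] <;> ring

/-- A 2-tensor `N` in block form with respect to the metric `blocks V 0 0 H`. -/
structure IsBlockTraceless (G : Field4) (y : Fin 4 → ℝ) (V H N : Matrix (Fin 2) (Fin 2) ℝ)
    (ν₀ : ℝ) : Prop where
  metric : G y = blocks V 0 0 H
  det_base : V.det ≠ 0
  det_fiber : H.det ≠ 0
  tensor : tracelessRicci G y = blocks N 0 0 (ν₀ • H)
  trace : (V⁻¹ * N).trace = -2 * ν₀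

namespace IsBlockTraceless

theorem inv_eq (h : IsBlockTraceless G y V H N ν₀) : (G y)⁻¹ = blocks V⁻¹ 0 0 H⁻¹ := by
  rw [h.metric, blocks_inv h.det_base h.det_fiber]

theorem tr_blocks (h : IsBlockTraceless G y V H N ν₀) (X : Matrix (Fin 2) (Fin 2) ℝ) (r : ℝ) :
    tr G y (blocks (V * X) 0 0 (r • H)) = X.trace + 2 * r := by
  rw [tr, h.inv_eq, blocks_mul, blocks_trace]
  simp only [Matrix.zero_mul, add_zero, zero_add, Matrix.mul_smul,
    Matrix.nonsing_inv_mul_cancel_left _ _ h.det_base.isUnit,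
    Matrix.nonsing_inv_mul _ h.det_fiber.isUnit, Matrix.trace_smul, Matrix.trace_one,
    Fintype.card_fin, smul_eq_mul]
  push_cast
  ring

theorem dot_blocks (h : IsBlockTraceless G y V H N ν₀) (X Y : Matrix (Fin 2) (Fin 2) ℝ) (r q : ℝ) :
    dot G y (blocks (V * X) 0 0 (r • H)) (blocks (V * Y) 0 0 (q • H)) =
      blocks (V * (X * Y)) 0 0 ((r * q) • H) := by
  rw [dot, h.inv_eq, blocks_mul, blocks_mul]
  refine blocks_congr ?_ ?_ ?_ ?_
  · simp only [Matrix.mul_zero, add_zero]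
    rw [Matrix.mul_assoc, Matrix.nonsing_inv_mul_cancel_left _ _ h.det_base.isUnit, Matrix.mul_assoc]
  · simp
  · simp
  · simp only [Matrix.zero_mul, Matrix.mul_zero, zero_add, Matrix.smul_mul, Matrix.mul_smul,
      Matrix.mul_nonsing_inv _ h.det_fiber.isUnit, Matrix.one_mul, smul_smul]
    rw [mul_comm]

theorem tensor' (h : IsBlockTraceless G y V H N ν₀) :
    tracelessRicci G y = blocks (V * (V⁻¹ * N)) 0 0 (ν₀ • H) := by
  rw [h.tensor, Matrix.mul_nonsing_inv_cancel_left _ _ h.det_base.isUnit]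

theorem bInv_eq (h : IsBlockTraceless G y V H N ν₀) :
    bInv G y = 4 * ν₀ ^ 2 + 2 * discr V N ν₀ := by
  rw [bInv, h.tensor', h.dot_blocks, h.tr_blocks, sq_of_trace h.trace]
  simp only [Matrix.trace_sub, Matrix.trace_smul, h.trace, Matrix.trace_one, Fintype.card_fin,
    smul_eq_mul, discr]
  push_cast
  ring

theorem cInv_eq (h : IsBlockTraceless G y V H N ν₀) :
    cInv G y = -6 * ν₀ * discr V N ν₀ := by
  rw [cInv, h.tensor', h.dot_blocks, h.dot_blocks, h.tr_blocks, sq_of_trace h.trace]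
  simp only [Matrix.sub_mul, Matrix.smul_mul, Matrix.one_mul, sq_of_trace h.trace]
  simp only [Matrix.trace_sub, Matrix.trace_smul, h.trace, Matrix.trace_one, Fintype.card_fin,
    smul_eq_mul, discr]
  push_cast
  ring

theorem dInv_eq (h : IsBlockTraceless G y V H N ν₀) :
    dInv G y = 4 * ν₀ ^ 4 + 12 * ν₀ ^ 2 * discr V N ν₀ + 2 * discr V N ν₀ ^ 2 := by
  rw [dInv, h.tensor', h.dot_blocks, h.dot_blocks, h.tr_blocks, sq_of_trace h.trace]
  simp only [Matrix.sub_mul, Matrix.smul_mul, Matrix.one_mul, Matrix.mul_sub, Matrix.mul_smul,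
    Matrix.mul_one, sq_of_trace h.trace]
  simp only [Matrix.trace_sub, Matrix.trace_smul, h.trace, Matrix.trace_one, Fintype.card_fin,
    smul_eq_mul, discr]
  push_cast
  ring

/-- The reason is the identity `7b² - 12d = 4(4ν₀² - t)²` with `t = discr V N ν₀`. The conclusion
means that `ν₀` is not an eigenvalue of the base block. -/
theorem discr_ne (h : IsBlockTraceless G y V H N ν₀) (hs : 7 * bInv G y ^ 2 ≠ 12 * dInv G y) :
    discr V N ν₀ ≠ 4 * ν₀ ^ 2 := by
  intro ht
  apply hs
  rw [h.bInv_eq, h.dInv_eq, ht]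
  ring

/-- Stated for an arbitrary value of `ν`, since the wrong sign `-ν₀` has to be tested as well. -/
theorem P_eq (h : IsBlockTraceless G y V H N ν₀) (ν : (Fin 4 → ℝ) → ℝ) :
    P G ν y = blocks (V * ((2 * (ν y - ν₀)) • (V⁻¹ * N)
        + (3 * ν y ^ 2 - 3 * ν₀ ^ 2) • (1 : Matrix (Fin 2) (Fin 2) ℝ)))
      0 0 ((3 * ν y ^ 2 + 2 * ν y * ν₀ - ν₀ ^ 2 - discr V N ν₀) • H) := by
  rw [P, h.tensor', h.dot_blocks, h.bInv_eq, h.metric, smul_blocks, smul_blocks, blocks_add,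
    blocks_add, sq_of_trace h.trace]
  refine blocks_congr ?_ (by simp) (by simp) ?_
  · rw [discr]
    simp only [Matrix.mul_add, Matrix.mul_sub, Matrix.mul_smul, Matrix.mul_one]
    module
  · module

theorem isNu (h : IsBlockTraceless G y V H N ν₀) (hs : 7 * bInv G y ^ 2 ≠ 12 * dInv G y) :
    IsNu (bInv G y) (cInv G y) (dInv G y) ν₀ :=
  isNu_of_eigenvalues h.bInv_eq h.cInv_eq h.dInv_eq (h.discr_ne hs)

/-- For the right `ν` the constant `3ν² - b/2` equals `ν² - t`. So `P` is the characteristic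
polynomial of the base block evaluated at `N`: zero on the base, and `4ν₀² - t` times the metric on
the fibre. -/
theorem P_self (h : IsBlockTraceless G y V H N ν₀) {ν : (Fin 4 → ℝ) → ℝ} (hν : ν y = ν₀) :
    P G ν y = blocks (V * 0) 0 0 ((4 * ν₀ ^ 2 - discr V N ν₀) • H) := by
  rw [h.P_eq, hν]
  refine blocks_congr ?_ rfl rfl ?_
  · simp
  · congr 1
    ring

theorem tr_P_self (h : IsBlockTraceless G y V H N ν₀) {ν : (Fin 4 → ℝ) → ℝ} (hν : ν y = ν₀) :
    tr G y (P G ν y) = 2 * (4 * ν₀ ^ 2 - discr V N ν₀) := by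
  rw [h.P_self hν, h.tr_blocks, Matrix.trace_zero, zero_add]

theorem hProj_self (h : IsBlockTraceless G y V H N ν₀) (hs : 7 * bInv G y ^ 2 ≠ 12 * dInv G y)
    {ν : (Fin 4 → ℝ) → ℝ} (hν : ν y = ν₀) : hProj G ν y = blocks 0 0 0 H := by
  have hne : 4 * ν₀ ^ 2 - discr V N ν₀ ≠ 0 := sub_ne_zero.2 (h.discr_ne hs).symm
  rw [hProj, h.tr_P_self hν, h.P_self hν, smul_blocks, smul_smul]
  refine blocks_congr (by simp) (by simp) (by simp) ?_
  rw [show 2 / (2 * (4 * ν₀ ^ 2 - discr V N ν₀)) * (4 * ν₀ ^ 2 - discr V N ν₀) = 1 by field_simp,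
    one_smul]

/-- If `h` is the projection onto the second block, then `ν` is the eigenvalue of that block. -/
theorem nu_eq (h : IsBlockTraceless G y V H N ν₀) (hs : 7 * bInv G y ^ 2 ≠ 12 * dInv G y)
    {ν : (Fin 4 → ℝ) → ℝ} (hν : IsNu (bInv G y) (cInv G y) (dInv G y) (ν y))
    (hh : hProj G ν y = blocks 0 0 0 H) : ν y = ν₀ := by
  rcases eq_or_eq_neg_of_isNu h.bInv_eq h.cInv_eq h.dInv_eq (h.discr_ne hs) hν with h1 | ⟨h0, h1⟩
  · exact h1
  · exfalso
    -- With `t = 0` and the wrong sign, the coefficient of the fibre block is `(3 - 2 - 1) ν₀² = 0`.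
    -- Then `P` has no fibre part, and neither has `h`.
    have hz : 3 * ν y ^ 2 + 2 * ν y * ν₀ - ν₀ ^ 2 - discr V N ν₀ = 0 := by
      rw [h1, h0]
      ring
    rw [hProj, h.P_eq, hz, smul_blocks, zero_smul, smul_zero] at hh
    have hH : H = 0 := by
      ext i j
      have := congrFun (congrFun hh (ir i)) (ir j)
      rw [blocks_rr, blocks_rr] at this
      exact this.symm
    exact h.det_fiber (by rw [hH]; simp)

end IsBlockTraceless

end Invariants

/-! ### The fibre projection of a warped product -/

section WarpedProjection

variable {G H : Field4} {U : Set (Fin 4 → ℝ)} {v s : (Fin 2 → ℝ) → Matrix (Fin 2) (Fin 2) ℝ}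
  {lam : (Fin 2 → ℝ) → ℝ} {A B : Set (Fin 2 → ℝ)} {y : Fin 4 → ℝ} {ν φ : (Fin 4 → ℝ) → ℝ}

namespace IsWarped

theorem isBlockTraceless (h : IsWarped G U v lam s A B) (hy : y ∈ U) :
    IsBlockTraceless G y (v (fstPair y)) (fiberMetric lam s y)
      (gaussCurvature v (fstPair y) • v (fstPair y) + (2 : ℝ) • warpHess v lam (fstPair y)
        - (scal G y / 4) • v (fstPair y)) (fiberNu v lam s y) where
  metric := h.metric_eq' hy
  det_base := h.det_base hy
  det_fiber := h.det_fiber hy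
  tensor := by
    rw [tracelessRicci, h.ricci_eq hy]
    conv_lhs => rw [h.metric_eq' hy, smul_blocks, blocks_sub]
    refine blocks_congr rfl (by simp) (by simp) ?_
    rw [h.scal_eq hy, fiberNu, ← sub_smul]
    congr 1
    ring
  trace := by
    rw [h.scal_eq hy, fiberNu]
    simp only [Matrix.mul_add, Matrix.mul_sub, Matrix.mul_smul, Matrix.trace_add, Matrix.trace_sub,
      Matrix.trace_smul, Matrix.nonsing_inv_mul _ (h.det_base hy).isUnit, Matrix.trace_one,
      Fintype.card_fin, smul_eq_mul]
    rw [← warpLap]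
    push_cast
    ring

theorem smooth_fiberMetric (h : IsWarped G U v lam s A B) :
    MatrixSmoothOn (fiberMetric lam s) U :=
  fun a b => h.smooth_exp.mul (h.smooth_snd (h.fiber.smooth a b))

theorem pdMat_il_fiberMetric (h : IsWarped G U v lam s A B) (hy : y ∈ U) (i : Fin 2) :
    pdMat (il i) (fiberMetric lam s) y =
      (2 * pd i lam (fstPair y)) • fiberMetric lam s y := by
  have h1 := h.pdMat_il_metric hy i
  rw [pdMat_congr_of_isOpen h.isOpen hy fun z hz => h.metric_eq' hz, pdMat_blocks] at h1
  ext a b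
  have h2 := congrFun (congrFun h1 (ir a)) (ir b)
  rw [blocks_rr, blocks_rr, ← smul_smul] at h2
  exact h2

theorem pdMat_ir_fiberMetric (h : IsWarped G U v lam s A B) (hy : y ∈ U) (C : Fin 2) :
    pdMat (ir C) (fiberMetric lam s) y = (conn s C (sndPair y))ᵀ * fiberMetric lam s y
      + fiberMetric lam s y * conn s C (sndPair y) := by
  have h1 := h.pdMat_ir_metric hy C
  rw [pdMat_congr_of_isOpen h.isOpen hy fun z hz => h.metric_eq' hz, pdMat_blocks] at h1
  have h3 := h.fiber.pdMat_metric (h.mapsTo_snd hy) C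
  rw [h3] at h1
  ext a b
  have h2 := congrFun (congrFun h1 (ir a)) (ir b)
  rw [blocks_rr, blocks_rr] at h2
  refine h2.trans ?_
  rw [Matrix.transpose_mul, h.fiber.symm _ (h.mapsTo_snd hy), fiberMetric, Matrix.mul_smul,
    Matrix.smul_mul, ← smul_add, add_comm]

/-- The growth `2 ∂ᵢλ` of the fibre metric is compensated by the two connection terms, each of which
contributes `∂ᵢλ`. -/
theorem nablaMat_il (h : IsWarped G U v lam s A B)
    (hH : ∀ z ∈ U, H z = blocks 0 0 0 (fiberMetric lam s z)) (hy : y ∈ U) (i : Fin 2) :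
    nablaMat G H (il i) y = 0 := by
  rw [nablaMat, pdMat_congr_of_isOpen h.isOpen hy hH, pdMat_blocks, pdMat_zero,
    h.conn_eq hy, warpConn_il, hH y hy, blocks_transpose, blocks_mul, blocks_mul, blocks_add,
    blocks_sub]
  have : (0 : Matrix (Fin 4) (Fin 4) ℝ) = blocks 0 0 0 0 := by apply eq_blocks <;> simp
  rw [this]
  refine blocks_congr (by simp) (by simp) (by simp) ?_
  have e := h.pdMat_il_fiberMetric hy i
  rw [show pdMat (il i) (fun z => fiberMetric lam s z) y = _ from e]
  simp only [Matrix.transpose_smul, Matrix.transpose_one, Matrix.smul_mul, Matrix.mul_smul,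
    Matrix.one_mul, Matrix.mul_one, Matrix.mul_zero, zero_add]
  module

theorem nablaMat_ir (h : IsWarped G U v lam s A B)
    (hH : ∀ z ∈ U, H z = blocks 0 0 0 (fiberMetric lam s z)) (hy : y ∈ U) (C : Fin 2) :
    nablaMat G H (ir C) y = blocks 0
      (-Matrix.vecMulVec (grad2 lam (fstPair y)) (fiberMetric lam s y C))
      (-Matrix.vecMulVec (fiberMetric lam s y C) (grad2 lam (fstPair y))) 0 := by
  have hs : fiberMetric lam s y *ᵥ Pi.single C 1 = fiberMetric lam s y C := by
    ext a
    rw [Matrix.mulVec_single_one]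
    exact congrFun (congrFun (h.fiber_symm hy) C) a
  rw [nablaMat, pdMat_congr_of_isOpen h.isOpen hy hH, pdMat_blocks, pdMat_zero,
    h.conn_eq hy, warpConn_ir, hH y hy, blocks_transpose, blocks_mul, blocks_mul, blocks_add,
    blocks_sub]
  refine blocks_congr (by simp) ?_ ?_ ?_
  · simp only [Matrix.transpose_vecMulVec, Matrix.vecMulVec_mul, Matrix.mul_zero, Matrix.zero_mul,
      add_zero, zero_add, zero_sub]
    rw [← Matrix.mulVec_transpose, h.fiber_symm hy, hs]
  · simp only [Matrix.mul_zero, add_zero, zero_add, zero_sub, Matrix.mul_vecMulVec, hs]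
  · have e := h.pdMat_ir_fiberMetric hy C
    rw [show pdMat (ir C) (fun z => fiberMetric lam s z) y = _ from e]
    simp

theorem divergence_il (h : IsWarped G U v lam s A B)
    (hH : ∀ z ∈ U, H z = blocks 0 0 0 (fiberMetric lam s z)) (hy : y ∈ U) (i : Fin 2) :
    divergence G H y (il i) = -2 * pd i lam (fstPair y) := by
  have hs : ∀ C, (fiberMetric lam s y)⁻¹ *ᵥ fiberMetric lam s y C = Pi.single C 1 := by
    intro C
    have : fiberMetric lam s y C = fiberMetric lam s y *ᵥ Pi.single C 1 := by
      ext a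
      rw [Matrix.mulVec_single_one]
      exact (congrFun (congrFun (h.fiber_symm hy) C) a).symm
    rw [this, Matrix.mulVec_mulVec, Matrix.nonsing_inv_mul _ (h.det_fiber hy).isUnit,
      Matrix.one_mulVec]
  rw [divergence_eq, sum_blocks]
  simp only [h.nablaMat_il hH hy, h.nablaMat_ir hH hy, h.inv_eq hy, blocks_mul, blocks_rl,
    Matrix.mul_zero, Matrix.zero_apply, Finset.sum_const_zero, zero_add, Matrix.mul_neg,
    Matrix.mul_vecMulVec, hs, Matrix.neg_apply, Matrix.vecMulVec_apply, Fin.sum_univ_two,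
    Pi.single_eq_same, grad2]
  ring

theorem divergence_ir (h : IsWarped G U v lam s A B)
    (hH : ∀ z ∈ U, H z = blocks 0 0 0 (fiberMetric lam s z)) (hy : y ∈ U) (C : Fin 2) :
    divergence G H y (ir C) = 0 := by
  rw [divergence_eq, sum_blocks]
  simp only [h.nablaMat_il hH hy, h.nablaMat_ir hH hy, h.inv_eq hy, blocks_mul, blocks_rr,
    Matrix.mul_zero, Matrix.zero_mul, Matrix.zero_apply, Finset.sum_const_zero, zero_add]

theorem warpedEq (h : IsWarped G U v lam s A B)
    (hH : ∀ z ∈ U, H z = blocks 0 0 0 (fiberMetric lam s z)) (hy : y ∈ U) : WarpedEq G H y := by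
  have hsy : ∀ a b, fiberMetric lam s y a b = fiberMetric lam s y b a := fun a b =>
    congrFun (congrFun (h.fiber_symm hy).symm a) b
  intro α β γ
  rw [nabla_eq, hH y hy]
  induction α using forall_blocks with
  | hl i =>
    rw [h.nablaMat_il hH hy]
    induction β using forall_blocks <;> induction γ using forall_blocks <;> simp
  | hr C =>
    rw [h.nablaMat_ir hH hy]
    induction β using forall_blocks with
    | hl i => induction γ using forall_blocks with
      | hl j => simp
      | hr D =>
        simp only [blocks_lr, blocks_rl, blocks_rr, Matrix.neg_apply, Matrix.vecMulVec_apply,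
          h.divergence_il hH hy, h.divergence_ir hH hy, grad2]
        ring
    | hr D => induction γ using forall_blocks with
      | hl j =>
        simp only [blocks_rl, blocks_rr, Matrix.neg_apply, Matrix.vecMulVec_apply,
          h.divergence_il hH hy, h.divergence_ir hH hy, grad2]
        ring
      | hr E => simp [h.divergence_ir hH hy]

theorem contDiffOn_divergence (h : IsWarped G U v lam s A B)
    (hH : ∀ z ∈ U, H z = blocks 0 0 0 (fiberMetric lam s z)) (γ : Fin 4) :
    ContDiffOn ℝ ∞ (fun z => divergence G H z γ) U := by
  induction γ using forall_blocks with
  | hl i =>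
    exact (contDiffOn_const.mul (h.smooth_fst (h.contDiffOn_pd_lam i))).congr
      fun z hz => h.divergence_il hH hz i
  | hr C => exact contDiffOn_const.congr fun z hz => h.divergence_ir hH hz C

theorem isClosedAt (h : IsWarped G U v lam s A B)
    (hH : ∀ z ∈ U, H z = blocks 0 0 0 (fiberMetric lam s z)) (hy : y ∈ U) :
    IsClosedAt (divergence G H) y := by
  have hd : ∀ j, DifferentiableAt ℝ (pd j lam) (fstPair y) := fun j =>
    (h.contDiffOn_pd_lam j).diffAt h.base.isOpen (h.mapsTo_fst hy)
  have hd' : ∀ j, DifferentiableAt ℝ (fun z => pd j lam (fstPair z)) y := fun j =>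
    (h.smooth_fst (h.contDiffOn_pd_lam j)).diffAt h.isOpen hy
  have hl : ∀ α j, pd α (fun z => divergence G H z (il j)) y =
      -2 * pd α (fun z => pd j lam (fstPair z)) y := fun α j => by
    rw [pd_congr_of_isOpen h.isOpen hy fun z hz => h.divergence_il hH hz j,
      pd_const_mul _ (hd' j)]
  have hr : ∀ α C, pd α (fun z => divergence G H z (ir C)) y = 0 := fun α C => by
    rw [pd_congr_of_isOpen h.isOpen hy fun z hz => h.divergence_ir hH hz C, pd_const]
  intro α β
  induction α using forall_blocks with
  | hl i => induction β using forall_blocks with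
    | hl j =>
      rw [hl, hl, pd_il_fst (hd j), pd_il_fst (hd i),
        pd_comm h.base.isOpen h.smooth (h.mapsTo_fst hy)]
    | hr D => rw [hl, hr, pd_ir_fst (hd i), mul_zero]
  | hr C => induction β using forall_blocks with
    | hl j => rw [hl, hr, pd_ir_fst (hd j), mul_zero]
    | hr D => rw [hr, hr]

theorem divergence_sq (h : IsWarped G U v lam s A B)
    (hH : ∀ z ∈ U, H z = blocks 0 0 0 (fiberMetric lam s z)) (hy : y ∈ U) :
    divergence G H y ⬝ᵥ (G y)⁻¹ *ᵥ divergence G H y = 4 * gradSq v lam (fstPair y) := by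
  rw [h.inv_eq hy, gradSq]
  simp only [dotProduct, Matrix.mulVec, sum_blocks, blocks_ll, blocks_rl,
    h.divergence_il hH hy, h.divergence_ir hH hy, grad2, mul_zero, zero_mul,
    Finset.sum_const_zero, add_zero, Fin.sum_univ_two]
  ring

/-- This explains the coefficients in `κ`: with the values of `φ`, `r` and `ν` the curvature terms
add up to `fiberSec`, and `ξ²/4 = |dλ|²` undoes the Gauss equation. -/
theorem kappa_eq (h : IsWarped G U v lam s A B) (hy : y ∈ U)
    (hh : ∀ z ∈ U, hProj G ν z = blocks 0 0 0 (fiberMetric lam s z))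
    (hν : ν y = fiberNu v lam s y) (hφ : φ y = weylValue v lam s y) :
    kappa G ν φ y = Real.exp (-2 * lam (fstPair y)) * gaussCurvature s (sndPair y) := by
  rw [RicciSph.kappa_eq, h.divergence_sq hh hy, hν, hφ, h.scal_eq hy, fiberNu, weylValue, fiberSec]
  ring

theorem killsDifferential_iff (h : IsWarped G U v lam s A B) (hy : y ∈ U)
    (hH : H y = blocks 0 0 0 (fiberMetric lam s y)) {f : (Fin 4 → ℝ) → ℝ} :
    KillsDifferential G H f y ↔ ∀ C, pd (ir C) f y = 0 := by
  have e : ∀ α, ∑ β, ∑ γ, H y α β * (G y)⁻¹ β γ * pd γ f y =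
      ∑ γ, (H y * (G y)⁻¹) α γ * pd γ f y := fun α => by
    simp only [Matrix.mul_apply, Finset.sum_mul]
    rw [Finset.sum_comm]
  have e2 : H y * (G y)⁻¹ = blocks 0 0 0 1 := by
    rw [hH, h.inv_eq hy, blocks_mul]
    refine blocks_congr (by simp) (by simp) (by simp) ?_
    rw [Matrix.mul_nonsing_inv _ (h.det_fiber hy).isUnit, Matrix.zero_mul, zero_add]
  simp only [KillsDifferential, e, e2]
  constructor
  · intro h1 C
    simpa [sum_blocks, Matrix.one_apply] using h1 (ir C)
  · intro h1 α
    induction α using forall_blocks with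
    | hl i => simp [sum_blocks]
    | hr C => simp [sum_blocks, h1]

theorem dot_self (h : IsWarped G U v lam s A B) (hy : y ∈ U)
    (hH : H y = blocks 0 0 0 (fiberMetric lam s y)) : dot G y (H y) (H y) = H y := by
  rw [dot, hH, h.inv_eq hy, blocks_mul, blocks_mul]
  refine blocks_congr (by simp) (by simp) (by simp) ?_
  simp [Matrix.mul_nonsing_inv _ (h.det_fiber hy).isUnit]

theorem isSpaceLike (hH : H y = blocks 0 0 0 (fiberMetric lam s y))
    (hs : (s (sndPair y)).PosDef) : IsSpaceLike G H y := by
  intro x _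
  have h1 : x ⬝ᵥ H y *ᵥ x = (x ∘ ir) ⬝ᵥ fiberMetric lam s y *ᵥ (x ∘ ir) := by
    rw [hH]
    simp [dotProduct, Matrix.mulVec, sum_blocks]
  rw [h1, fiberMetric, Matrix.smul_mulVec, dotProduct_smul, smul_eq_mul]
  have h2 := hs.posSemidef.dotProduct_mulVec_nonneg (x ∘ ir)
  rw [star_trivial] at h2
  exact mul_nonneg (Real.exp_pos _).le h2

/-- A warped product with fibres of Gauss curvature one satisfies the conditions on `ν` and `φ`. -/
theorem sphericalConditions (h : IsWarped G U v lam s A B)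
    (hstrict : ∀ z ∈ U, 7 * bInv G z ^ 2 ≠ 12 * dInv G z)
    (hν : ∀ z ∈ U, ν z = fiberNu v lam s z) (hφ : ∀ z ∈ U, φ z = weylValue v lam s z)
    (hs : ∀ z ∈ B, (s z).PosDef ∧ gaussCurvature s z = 1) (hy : y ∈ U) :
    SphericalConditions G ν φ y ∧ MatrixSmoothOn (hProj G ν) U ∧
      (∀ γ, ContDiffOn ℝ ∞ (fun z => divergence G (hProj G ν) z γ) U) ∧
      ContDiffOn ℝ ∞ (kappa G ν φ) U := by
  have hh : ∀ z ∈ U, hProj G ν z = blocks 0 0 0 (fiberMetric lam s z) := fun z hz =>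
    (h.isBlockTraceless hz).hProj_self (hstrict z hz) (hν z hz)
  have hκ : ∀ z ∈ U, kappa G ν φ z = Real.exp (-2 * lam (fstPair z)) := fun z hz => by
    rw [h.kappa_eq hz hh (hν z hz) (hφ z hz), (hs _ (h.mapsTo_snd hz)).2, mul_one]
  have hκd : ContDiffOn ℝ ∞ (fun z => Real.exp (-2 * lam z)) A :=
    (contDiffOn_const.mul h.smooth).exp
  have hb := h.isBlockTraceless hy
  refine ⟨⟨?_, ?_, ?_, h.dot_self hy (hh y hy), isSpaceLike (hh y hy) (hs _ (h.mapsTo_snd hy)).1,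
    h.warpedEq hh hy, h.isClosedAt hh hy, ?_, ?_⟩, ?_, h.contDiffOn_divergence hh, ?_⟩
  · rw [hν y hy]
    exact hb.isNu (hstrict y hy)
  · rw [hφ y hy]
    exact h.isDoubleWeylEigenvalue hy
  · rw [hb.tr_P_self (hν y hy)]
    exact mul_ne_zero two_ne_zero (sub_ne_zero.2 (hb.discr_ne (hstrict y hy)).symm)
  · rw [hκ y hy]
    exact Real.exp_pos _
  · rw [h.killsDifferential_iff hy (hh y hy)]
    intro C
    rw [pd_congr_of_isOpen h.isOpen hy hκ]
    exact pd_ir_fst (hκd.diffAt h.base.isOpen (h.mapsTo_fst hy)) C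
  · intro a b
    refine ContDiffOn.congr (f := fun z => blocks 0 0 0 (fiberMetric lam s z) a b) ?_
      fun z hz => by rw [hh z hz]
    induction a using forall_blocks with
    | hl i => induction b using forall_blocks <;> simpa using contDiffOn_const
    | hr i => induction b using forall_blocks with
      | hl j => simpa using contDiffOn_const
      | hr j => simpa using h.smooth_fiberMetric i j
  · exact (h.smooth_fst hκd).congr hκ

theorem contDiffOn_gaussCurvature {B : Set (Fin 2 → ℝ)} (hs : IsMetricOn s B) :
    ContDiffOn ℝ ∞ (gaussCurvature s) B := by
  have h1 : ContDiffOn ℝ ∞ (fun z => (s z * curv s z 0 1) 0 1) B :=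
    (hs.smooth.mul (hs.smooth_curv 0 1)) 0 1
  refine (h1.div hs.smooth.det hs.det_ne).congr fun z hz => ?_
  rw [gaussCurvature, hs.riemann_eq hz]
  rfl

theorem contDiffOn_fiberNu (h : IsWarped G U v lam s A B) :
    ContDiffOn ℝ ∞ (fiberNu v lam s) U := by
  have hg : ContDiffOn ℝ ∞ (gradSq v lam) A := by
    unfold gradSq dotProduct Matrix.mulVec dotProduct
    exact ContDiffOn.sum fun i _ => (h.contDiffOn_pd_lam i).mul
      (ContDiffOn.sum fun j _ => (h.base.smooth_inv i j).mul (h.contDiffOn_pd_lam j))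
  have he : ContDiffOn ℝ ∞ (fun z => Real.exp (-2 * lam z)) A :=
    (contDiffOn_const.mul h.smooth).exp
  exact ((((h.smooth_fst he).mul (h.smooth_snd (contDiffOn_gaussCurvature h.fiber))).sub
    (h.smooth_fst hg)).sub (h.smooth_fst (contDiffOn_gaussCurvature h.base))).div_const 2

end IsWarped

end WarpedProjection

/-! ### Uniqueness of the fibre eigenvalue -/

section Uniqueness

/-- The inclusion of the last two coordinates. -/
def fiberIncl : Matrix (Fin 4) (Fin 2) ℝ :=
  Matrix.of fun k j => if k = ir j then 1 else 0

/-- Two positive definite two-dimensional eigenspaces of a symmetric form with respect to a form of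
negative determinant in dimension four belong to the same eigenvalue. -/
theorem eigenvalue_unique {g N : Matrix (Fin 4) (Fin 4) ℝ} {X Y : Matrix (Fin 4) (Fin 2) ℝ}
    {ν ν' : ℝ} (hg : gᵀ = g) (hN : Nᵀ = N) (hdet : g.det < 0) (hX : N * X = ν • (g * X))
    (hY : N * Y = ν' • (g * Y)) (hXd : 0 < (Xᵀ * g * X).det) (hYd : 0 < (Yᵀ * g * Y).det) :
    ν = ν' := by
  by_contra hne
  -- Eigenspaces of a symmetric form with different eigenvalues are orthogonal.
  have h1 : Xᵀ * g * Y = 0 := by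
    have e1 : Xᵀ * N * Y = ν • (Xᵀ * g * Y) := by
      have := congrArg Matrix.transpose hX
      rw [Matrix.transpose_mul, Matrix.transpose_smul, Matrix.transpose_mul, hN, hg] at this
      rw [this, Matrix.smul_mul]
    have e2 : Xᵀ * N * Y = ν' • (Xᵀ * g * Y) := by
      rw [Matrix.mul_assoc, hY, Matrix.mul_smul, Matrix.mul_assoc]
    have e3 : (ν - ν') • (Xᵀ * g * Y) = 0 := by rw [sub_smul, ← e1, ← e2, sub_self]
    exact (smul_eq_zero.1 e3).resolve_left (sub_ne_zero.2 hne)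
  have h2 : Yᵀ * g * X = 0 := by
    have := congrArg Matrix.transpose h1
    rw [Matrix.transpose_mul, Matrix.transpose_mul, hg, Matrix.transpose_transpose,
      Matrix.transpose_zero] at this
    rw [Matrix.mul_assoc, this]
  -- In the combined system of four vectors the Gram determinant is the product of the two positive
  -- ones, but it also equals `(det Z)² det g ≤ 0`.
  let Z : Matrix (Fin 4) (Fin 4) ℝ :=
    (Matrix.fromCols X Y).submatrix id (finSumFinEquiv (m := 2) (n := 2)).symm
  have h3 : Zᵀ * g * Z = blocks (Xᵀ * g * X) 0 0 (Yᵀ * g * Y) := by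
    have e1 : Zᵀ = (Matrix.fromRows Xᵀ Yᵀ).submatrix (finSumFinEquiv (m := 2) (n := 2)).symm id := by
      change ((Matrix.fromCols X Y).submatrix _ _)ᵀ = _
      rw [Matrix.transpose_submatrix, Matrix.transpose_fromCols]
    have e2 : Zᵀ * g = (Matrix.fromRows Xᵀ Yᵀ * g).submatrix
        (finSumFinEquiv (m := 2) (n := 2)).symm id := by
      rw [e1]
      rfl
    have e3 : Zᵀ * g * Z = (Matrix.fromRows Xᵀ Yᵀ * g * Matrix.fromCols X Y).submatrix
        (finSumFinEquiv (m := 2) (n := 2)).symm (finSumFinEquiv (m := 2) (n := 2)).symm := by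
      rw [e2]
      rfl
    rw [e3, Matrix.fromRows_mul, Matrix.fromRows_mul_fromCols, h1, h2]
    rfl
  have h4 : (Zᵀ * g * Z).det = Z.det ^ 2 * g.det := by
    rw [Matrix.det_mul, Matrix.det_mul, Matrix.det_transpose]
    ring
  rw [h3, blocks_det] at h4
  nlinarith [mul_pos hXd hYd, sq_nonneg Z.det]

theorem IsBlockTraceless.mul_fiberIncl {G : Field4} {y : Fin 4 → ℝ}
    {V H N : Matrix (Fin 2) (Fin 2) ℝ} {ν₀ : ℝ} (h : IsBlockTraceless G y V H N ν₀) :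
    tracelessRicci G y * fiberIncl = ν₀ • (G y * fiberIncl) := by
  rw [h.tensor, h.metric]
  ext k j
  induction k using forall_blocks <;> simp [Matrix.mul_apply, fiberIncl]

theorem IsBlockTraceless.fiberIncl_mul_mul {G : Field4} {y : Fin 4 → ℝ}
    {V H N : Matrix (Fin 2) (Fin 2) ℝ} {ν₀ : ℝ} (h : IsBlockTraceless G y V H N ν₀) :
    fiberInclᵀ * G y * fiberIncl = H := by
  rw [h.metric]
  ext k j
  simp [Matrix.mul_apply, fiberIncl]

theorem IsMetricOn.tracelessRicci_symm {G : Field4} {U : Set (Fin 4 → ℝ)} {y : Fin 4 → ℝ}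
    (h : IsMetricOn G U) (hy : y ∈ U) : (tracelessRicci G y)ᵀ = tracelessRicci G y := by
  rw [tracelessRicci, Matrix.transpose_sub, Matrix.transpose_smul, h.ricci_symm hy, h.symm y hy]

/-- The fibre eigenvalue does not depend on the coordinates. -/
theorem IsPullback.fiberNu_unique {G G' : Field4} {U U' : Set (Fin 4 → ℝ)}
    {ψ : (Fin 4 → ℝ) → Fin 4 → ℝ} {y : Fin 4 → ℝ} {V H N V' H' N' : Matrix (Fin 2) (Fin 2) ℝ}
    {ν₀ ν₀' : ℝ} (hp : IsPullback G U G' U' ψ) (hy : y ∈ U) (hdet : (G y).det < 0)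
    (h : IsBlockTraceless G y V H N ν₀) (h' : IsBlockTraceless G' (ψ y) V' H' N' ν₀')
    (hH : 0 < H.det) (hH' : 0 < H'.det) : ν₀ = ν₀' := by
  have hJ := hp.isUnit_jac hy
  set J := jac ψ y with hJdef
  have hc : ∀ S : Matrix (Fin 4) (Fin 4) ℝ, Jᵀ * S * J * (J⁻¹ * fiberIncl) =
      Jᵀ * (S * fiberIncl) := by
    intro S
    simp only [Matrix.mul_assoc]
    rw [Matrix.mul_nonsing_inv_cancel_left _ _ hJ]
  have hJT : IsUnit Jᵀ.det := by rwa [Matrix.det_transpose]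
  refine eigenvalue_unique (X := fiberIncl) (Y := J⁻¹ * fiberIncl) (hp.left.symm y hy)
    (hp.left.tracelessRicci_symm hy) hdet h.mul_fiberIncl ?_ ?_ ?_
  · rw [hp.tracelessRicci_eq hy, hp.metric y hy, ← hJdef, hc, hc, h'.mul_fiberIncl, Matrix.mul_smul]
  · rwa [h.fiberIncl_mul_mul]
  · rw [Matrix.mul_assoc, hp.metric y hy, ← hJdef, hc, Matrix.transpose_mul,
      Matrix.transpose_nonsing_inv, Matrix.mul_assoc, Matrix.nonsing_inv_mul_cancel_left _ _ hJT,
      ← Matrix.mul_assoc, h'.fiberIncl_mul_mul]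
    exact hH'

end Uniqueness

/-! ### The metric in the charts of the maximal atlas -/

section Charts

variable {M : Type*} [TopologicalSpace M]

/-- The domain of the transition map between two charts. -/
def overlap (e e' : OpenPartialHomeomorph M (Fin 4 → ℝ)) : Set (Fin 4 → ℝ) :=
  e.target ∩ e.symm ⁻¹' e'.source

theorem isOpen_overlap (e e' : OpenPartialHomeomorph M (Fin 4 → ℝ)) : IsOpen (overlap e e') :=
  e.symm.isOpen_inter_preimage e'.open_source

variable [ChartedSpace (Fin 4 → ℝ) M]

theorem mdifferentiable_of_mem_maximalAtlas {e : OpenPartialHomeomorph M (Fin 4 → ℝ)}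
    (he : e ∈ IsManifold.maximalAtlas 𝓘(ℝ, Fin 4 → ℝ) ∞ M) :
    e.MDifferentiable 𝓘(ℝ, Fin 4 → ℝ) 𝓘(ℝ, Fin 4 → ℝ) :=
  ⟨(contMDiffOn_of_mem_maximalAtlas he).mdifferentiableOn (by simp),
    (contMDiffOn_symm_of_mem_maximalAtlas he).mdifferentiableOn (by simp)⟩

theorem contDiffOn_transition {e e' : OpenPartialHomeomorph M (Fin 4 → ℝ)}
    (he : e ∈ IsManifold.maximalAtlas 𝓘(ℝ, Fin 4 → ℝ) ∞ M)
    (he' : e' ∈ IsManifold.maximalAtlas 𝓘(ℝ, Fin 4 → ℝ) ∞ M) :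
    ContDiffOn ℝ ∞ (e' ∘ e.symm) (overlap e e') := by
  rw [← contMDiffOn_iff_contDiffOn]
  exact (contMDiffOn_of_mem_maximalAtlas he').comp
    ((contMDiffOn_symm_of_mem_maximalAtlas he).mono Set.inter_subset_left) fun _ h => h.2

theorem mfderiv_symm_eq {e e' : OpenPartialHomeomorph M (Fin 4 → ℝ)}
    (he : e ∈ IsManifold.maximalAtlas 𝓘(ℝ, Fin 4 → ℝ) ∞ M)
    (he' : e' ∈ IsManifold.maximalAtlas 𝓘(ℝ, Fin 4 → ℝ) ∞ M) {y : Fin 4 → ℝ}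
    (hy : y ∈ overlap e e') (u : Fin 4 → ℝ) :
    (mfderiv 𝓘(ℝ, Fin 4 → ℝ) 𝓘(ℝ, Fin 4 → ℝ) e.symm y u : Fin 4 → ℝ) =
      (mfderiv 𝓘(ℝ, Fin 4 → ℝ) 𝓘(ℝ, Fin 4 → ℝ) e'.symm (e' (e.symm y))
        (fderiv ℝ (e' ∘ e.symm) y u : Fin 4 → ℝ) : Fin 4 → ℝ) := by
  have h1 : e.symm =ᶠ[𝓝 y] e'.symm ∘ (e' ∘ e.symm) := by
    filter_upwards [(isOpen_overlap e e').mem_nhds hy] with z hz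
    exact (e'.left_inv hz.2).symm
  have hd : DifferentiableAt ℝ (e' ∘ e.symm) y :=
    ((contDiffOn_transition he he').contDiffAt ((isOpen_overlap e e').mem_nhds hy)).differentiableAt
      (by simp)
  have h2 := mfderiv_comp (I := 𝓘(ℝ, Fin 4 → ℝ)) (I' := 𝓘(ℝ, Fin 4 → ℝ))
    (I'' := 𝓘(ℝ, Fin 4 → ℝ)) y (g := e'.symm) (f := e' ∘ e.symm)
    ((mdifferentiable_of_mem_maximalAtlas he').mdifferentiableAt_symm (e'.map_source hy.2))
    hd.mdifferentiableAt
  have h3 := h1.mfderiv_eq (I := 𝓘(ℝ, Fin 4 → ℝ)) (I' := 𝓘(ℝ, Fin 4 → ℝ))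
  have h4 : ∀ u : Fin 4 → ℝ, (mfderiv 𝓘(ℝ, Fin 4 → ℝ) 𝓘(ℝ, Fin 4 → ℝ) e.symm y u : Fin 4 → ℝ) =
      (mfderiv 𝓘(ℝ, Fin 4 → ℝ) 𝓘(ℝ, Fin 4 → ℝ) (e'.symm ∘ (e' ∘ e.symm)) y u : Fin 4 → ℝ) := by
    intro u
    rw [h3]
    rfl
  rw [h4, h2, mfderiv_eq_fderiv]
  rfl

namespace LorentzMetric

variable [IsManifold 𝓘(ℝ, Fin 4 → ℝ) ∞ M]

variable (g : LorentzMetric M) {e e' : OpenPartialHomeomorph M (Fin 4 → ℝ)}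

/-- A change of basis multiplies the determinant by a square. The sign of the determinant is all
that the proof extracts from the signature. -/
theorem det_components_neg (he : e ∈ IsManifold.maximalAtlas 𝓘(ℝ, Fin 4 → ℝ) ∞ M)
    {y : Fin 4 → ℝ} (hy : y ∈ e.target) : (components g.toFun e y).det < 0 := by
  obtain ⟨b, hb⟩ := g.signature (e.symm y)
  let A := (mdifferentiable_of_mem_maximalAtlas he).symm.mfderiv (x := y) hy
  let c : Module.Basis (Fin 4) ℝ (TangentSpace 𝓘(ℝ, Fin 4 → ℝ) (e.symm y)) :=
    (Pi.basisFun ℝ (Fin 4)).map A.toLinearEquiv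
  have h1 := LinearMap.BilinForm.toMatrix_mul_basis_toMatrix b c (g.toFun (e.symm y))
  have h2 : LinearMap.BilinForm.toMatrix c (g.toFun (e.symm y)) = components g.toFun e y := by
    ext i j
    have hc : ∀ i, c i = A (Pi.single i 1 : Fin 4 → ℝ) := fun i => by
      change A (Pi.basisFun ℝ (Fin 4) i : Fin 4 → ℝ) = _
      rw [Pi.basisFun_apply]
    rw [LinearMap.BilinForm.toMatrix_apply, hc, hc]
    rfl
  have h3 : LinearMap.BilinForm.toMatrix b (g.toFun (e.symm y)) =
      Matrix.diagonal fun i : Fin 4 => if i = 0 then (-1 : ℝ) else 1 := by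
    ext i j
    rw [LinearMap.BilinForm.toMatrix_apply, hb, Matrix.diagonal_apply]
  rw [← h2, ← h1, h3, Matrix.det_mul, Matrix.det_mul, Matrix.det_transpose, Matrix.det_diagonal]
  have h4 : (b.toMatrix c).det ≠ 0 := by
    have := Module.Basis.isUnit_det b c
    exact this.ne_zero
  have h5 : ∏ i : Fin 4, (if i = 0 then (-1 : ℝ) else 1) = -1 := by simp
  rw [h5]
  have := sq_pos_of_ne_zero h4
  nlinarith

theorem isMetricOn (he : e ∈ IsManifold.maximalAtlas 𝓘(ℝ, Fin 4 → ℝ) ∞ M) :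
    IsMetricOn (components g.toFun e) e.target where
  isOpen := e.open_target
  smooth := g.smooth e he
  symm := fun y _ => by
    ext i j
    exact g.symm _ _ _
  det_ne := fun _ hy => (g.det_components_neg he hy).ne

/-- All tangent spaces are the same vector space `Fin 4 → ℝ`, so vectors can be kept while the base
point is replaced by an equal one, without rewriting in dependent types. -/
theorem toFun_congr {p q : M} (h : p = q) (u w : Fin 4 → ℝ) :
    g.toFun p (u : TangentSpace 𝓘(ℝ, Fin 4 → ℝ) p) (w : TangentSpace 𝓘(ℝ, Fin 4 → ℝ) p) =
      g.toFun q (u : TangentSpace 𝓘(ℝ, Fin 4 → ℝ) q) (w : TangentSpace 𝓘(ℝ, Fin 4 → ℝ) q) := by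
  subst h
  rfl

theorem isPullback (he : e ∈ IsManifold.maximalAtlas 𝓘(ℝ, Fin 4 → ℝ) ∞ M)
    (he' : e' ∈ IsManifold.maximalAtlas 𝓘(ℝ, Fin 4 → ℝ) ∞ M) :
    IsPullback (components g.toFun e) (overlap e e') (components g.toFun e') e'.target
      (e' ∘ e.symm) where
  left := (g.isMetricOn he).mono (isOpen_overlap e e') Set.inter_subset_left
  right := g.isMetricOn he'
  smooth := contDiffOn_transition he he'
  mapsTo := fun _ hy => e'.map_source hy.2
  metric := fun y hy => by
    have hd : DifferentiableAt ℝ (e' ∘ e.symm) y :=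
      ((contDiffOn_transition he he').contDiffAt
        ((isOpen_overlap e e').mem_nhds hy)).differentiableAt (by simp)
    have h1 : ∀ i, fderiv ℝ (e' ∘ e.symm) y (Pi.single i 1) =
        ∑ a, jac (e' ∘ e.symm) y a i • (Pi.single a 1 : Fin 4 → ℝ) := by
      intro i
      ext k
      have : pd i (fun z => (e' ∘ e.symm) z k) y = fderiv ℝ (e' ∘ e.symm) y (Pi.single i 1) k := by
        rw [pd, fderiv_apply hd]
        rfl
      simp [jac, ← this, Finset.sum_apply, Pi.single_apply]
    let A : (Fin 4 → ℝ) →L[ℝ] (Fin 4 → ℝ) :=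
      mfderiv 𝓘(ℝ, Fin 4 → ℝ) 𝓘(ℝ, Fin 4 → ℝ) e'.symm (e' (e.symm y))
    let β : LinearMap.BilinForm ℝ (Fin 4 → ℝ) := g.toFun (e'.symm (e' (e.symm y)))
    ext i j
    have h2 : components g.toFun e y i j =
        β (A (fderiv ℝ (e' ∘ e.symm) y (Pi.single i 1)))
          (A (fderiv ℝ (e' ∘ e.symm) y (Pi.single j 1))) := by
      have e1 := mfderiv_symm_eq he he' hy (Pi.single i 1)
      have e2 := mfderiv_symm_eq he he' hy (Pi.single j 1)
      change g.toFun (e.symm y) _ _ = _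
      refine (g.toFun_congr (e'.left_inv hy.2).symm _ _).trans ?_
      exact congrArg₂ (fun u w : Fin 4 → ℝ => β u w) e1 e2
    have h3 : ∀ a b, components g.toFun e' ((e' ∘ e.symm) y) a b =
        β (A (Pi.single a 1)) (A (Pi.single b 1)) := fun a b => rfl
    rw [h2, h1, h1]
    simp only [map_sum, map_smul, LinearMap.sum_apply, LinearMap.smul_apply, Matrix.mul_apply,
      Matrix.transpose_apply, h3, smul_eq_mul, Finset.sum_mul, Finset.mul_sum]
    exact Finset.sum_congr rfl fun _ _ => Finset.sum_congr rfl fun _ _ => by ring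

end LorentzMetric

end Charts

/-! ### Spherical symmetry implies the conditions -/

section Forward

/-- Openness of the coordinate projection makes the image of the chart domain an open set, as
required for `v` and `λ` to be differentiated there. -/
theorem isOpenMap_fstPair : IsOpenMap fstPair := by
  let L : (Fin 4 → ℝ) →L[ℝ] (Fin 2 → ℝ) :=
    ContinuousLinearMap.pi fun i => ContinuousLinearMap.proj (il i)
  have hL : ∀ y, L y = fstPair y := fun y => by
    ext i
    exact (fstPair_apply y i).symm
  have hs : Function.Surjective L := fun z => by
    refine ⟨![z 0, z 1, 0, 0], ?_⟩
    rw [hL]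
    ext i
    fin_cases i <;> rfl
  rw [← funext hL]
  exact L.isOpenMap hs

theorem isOpenMap_sndPair : IsOpenMap sndPair := by
  let L : (Fin 4 → ℝ) →L[ℝ] (Fin 2 → ℝ) :=
    ContinuousLinearMap.pi fun i => ContinuousLinearMap.proj (ir i)
  have hL : ∀ y, L y = sndPair y := fun y => by
    ext i
    exact (sndPair_apply y i).symm
  have hs : Function.Surjective L := fun z => by
    refine ⟨![0, 0, z 0, z 1], ?_⟩
    rw [hL]
    ext i
    fin_cases i <;> rfl
  rw [← funext hL]
  exact L.isOpenMap hs

variable {M : Type*} [TopologicalSpace M] [ChartedSpace (Fin 4 → ℝ) M]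
  [IsManifold 𝓘(ℝ, Fin 4 → ℝ) ∞ M]

namespace LorentzMetric

variable {g : LorentzMetric M}

/-- The chart `e` exhibits the metric as a warped product with fibres of Gauss curvature one. -/
structure IsSphericalChart (g : LorentzMetric M) (e : OpenPartialHomeomorph M (Fin 4 → ℝ))
    (v : (Fin 2 → ℝ) → Matrix (Fin 2) (Fin 2) ℝ) (lam : (Fin 2 → ℝ) → ℝ)
    (s : (Fin 2 → ℝ) → Matrix (Fin 2) (Fin 2) ℝ) : Prop where
  mem : e ∈ IsManifold.maximalAtlas 𝓘(ℝ, Fin 4 → ℝ) ∞ M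
  isWarped : IsWarped (components g.toFun e) e.target v lam s (fstPair '' e.target)
    (sndPair '' e.target)
  fiber : ∀ z ∈ sndPair '' e.target, (s z).PosDef ∧ gaussCurvature s z = 1

theorem IsSphericallySymmetric.exists_isSphericalChart (h : g.IsSphericallySymmetric) (p : M) :
    ∃ e v lam s, p ∈ e.source ∧ IsSphericalChart g e v lam s := by
  obtain ⟨e, he, hp, v, lam, s, hv, hl, hs, hvd, hsd, hm⟩ := h p
  refine ⟨e, v, lam, s, hp, he, ?_, hsd⟩
  exact
    { isOpen := e.open_target
      base := ⟨isOpenMap_fstPair _ e.open_target, hv, fun z hz => (hvd z hz).1,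
        fun z hz => (hvd z hz).2.ne⟩
      smooth := hl
      fiber := ⟨isOpenMap_sndPair _ e.open_target, hs,
        fun z hz => by
          have := (hsd z hz).1.isHermitian
          rwa [Matrix.IsHermitian, Matrix.conjTranspose_eq_transpose_of_trivial] at this,
        fun z hz => (hsd z hz).1.det_pos.ne'⟩
      mapsTo_fst := fun y hy => ⟨y, hy, rfl⟩
      mapsTo_snd := fun y hy => ⟨y, hy, rfl⟩
      metric := hm }

variable {e e' : OpenPartialHomeomorph M (Fin 4 → ℝ)}
  {v s v' s' : (Fin 2 → ℝ) → Matrix (Fin 2) (Fin 2) ℝ} {lam lam' : (Fin 2 → ℝ) → ℝ}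

namespace IsSphericalChart

theorem det_fiberMetric_pos (h : IsSphericalChart g e v lam s) {y : Fin 4 → ℝ} (hy : y ∈ e.target) :
    0 < (fiberMetric lam s y).det := by
  rw [fiberMetric, Matrix.det_smul]
  exact mul_pos (pow_pos (Real.exp_pos _) _) (h.fiber _ (h.isWarped.mapsTo_snd hy)).1.det_pos

theorem fiberNu_eq (h : IsSphericalChart g e v lam s) (h' : IsSphericalChart g e' v' lam' s')
    {p : M} (hp : p ∈ e.source) (hp' : p ∈ e'.source) :
    IsWarped.fiberNu v lam s (e p) = IsWarped.fiberNu v' lam' s' (e' p) := by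
  have hy : e p ∈ e.target := e.map_source hp
  have hy' : e p ∈ overlap e e' := ⟨hy, by rwa [Set.mem_preimage, e.left_inv hp]⟩
  have hψ : (e' ∘ e.symm) (e p) = e' p := congrArg e' (e.left_inv hp)
  have hb' := h'.isWarped.isBlockTraceless (e'.map_source hp')
  have hd' := h'.det_fiberMetric_pos (e'.map_source hp')
  rw [← hψ] at hb' hd' ⊢
  exact (g.isPullback h.mem h'.mem).fiberNu_unique hy' (g.det_components_neg h.mem hy)
    (h.isWarped.isBlockTraceless hy) hb' (h.det_fiberMetric_pos hy) hd'

theorem weylValue_eq (h : IsSphericalChart g e v lam s) (h' : IsSphericalChart g e' v' lam' s')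
    {p : M} (hp : p ∈ e.source) (hp' : p ∈ e'.source) :
    IsWarped.weylValue v lam s (e p) = IsWarped.weylValue v' lam' s' (e' p) := by
  have hy : e p ∈ e.target := e.map_source hp
  have hy' : e p ∈ overlap e e' := ⟨hy, by rwa [Set.mem_preimage, e.left_inv hp]⟩
  have hψ : (e' ∘ e.symm) (e p) = e' p := congrArg e' (e.left_inv hp)
  have hw' := h'.isWarped.isDoubleWeylEigenvalue (e'.map_source hp')
  rw [← hψ] at hw' ⊢
  exact (h.isWarped.isDoubleWeylEigenvalue hy).unique
    ((g.isPullback h.mem h'.mem).isDoubleWeylEigenvalue hy' hw')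

end IsSphericalChart

/-- A spherically symmetric metric satisfies the conditions for suitable `ν` and `φ`. -/
theorem IsSphericallySymmetric.exists_sphericalConditions (h : g.IsSphericallySymmetric)
    (hstrict : ∀ e ∈ IsManifold.maximalAtlas 𝓘(ℝ, Fin 4 → ℝ) ∞ M, ∀ y ∈ e.target,
      7 * bInv (components g.toFun e) y ^ 2 ≠ 12 * dInv (components g.toFun e) y) :
    ∃ ν φ : M → ℝ, ContMDiff 𝓘(ℝ, Fin 4 → ℝ) 𝓘(ℝ, ℝ) ∞ ν ∧
      ∀ e ∈ IsManifold.maximalAtlas 𝓘(ℝ, Fin 4 → ℝ) ∞ M, ∀ y ∈ e.target,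
        SphericalConditions (components g.toFun e) (ν ∘ e.symm) (φ ∘ e.symm) y := by
  choose E v lam s hE hS using h.exists_isSphericalChart
  -- The two functions are defined pointwise from a chosen chart around each point. Independence of
  -- the chart shows that on the domain of any chosen chart they are given by the formula of that
  -- chart, which yields smoothness of `ν`.
  let ν : M → ℝ := fun p => IsWarped.fiberNu (v p) (lam p) (s p) (E p p)
  let φ : M → ℝ := fun p => IsWarped.weylValue (v p) (lam p) (s p) (E p p)
  have hν : ∀ p, ∀ q ∈ (E p).source, ν q = IsWarped.fiberNu (v p) (lam p) (s p) (E p q) :=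
    fun p q hq => (hS q).fiberNu_eq (hS p) (hE q) hq
  have hφ : ∀ p, ∀ q ∈ (E p).source, φ q = IsWarped.weylValue (v p) (lam p) (s p) (E p q) :=
    fun p q hq => (hS q).weylValue_eq (hS p) (hE q) hq
  refine ⟨ν, φ, fun p => ?_, fun e he y hy => ?_⟩
  · have h1 : ContMDiffOn 𝓘(ℝ, Fin 4 → ℝ) 𝓘(ℝ, ℝ) ∞
        (IsWarped.fiberNu (v p) (lam p) (s p) ∘ E p) (E p).source :=
      (contMDiffOn_iff_contDiffOn.2 (hS p).isWarped.contDiffOn_fiberNu).comp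
        (contMDiffOn_of_mem_maximalAtlas (hS p).mem) fun q hq => (E p).map_source hq
    exact (h1.congr (hν p)).contMDiffAt ((E p).open_source.mem_nhds (hE p))
  -- The conditions hold in the chosen chart around the point and are carried to the arbitrary chart
  -- `e` by the transition map.
  · let p := e.symm y
    have hy' : y ∈ overlap e (E p) := ⟨hy, hE p⟩
    obtain ⟨hc, hs1, hs2, hs3⟩ := (hS p).isWarped.sphericalConditions
      (ν := ν ∘ (E p).symm) (φ := φ ∘ (E p).symm) (hstrict _ (hS p).mem)
      (fun z hz => by
        rw [Function.comp_apply, hν p _ ((E p).map_target hz), (E p).right_inv hz])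
      (fun z hz => by
        rw [Function.comp_apply, hφ p _ ((E p).map_target hz), (E p).right_inv hz])
      (hS p).fiber ((E p).map_source (hE p))
    exact (g.isPullback he (hS p).mem).sphericalConditions (ν' := ν ∘ (E p).symm)
      (φ' := φ ∘ (E p).symm) hy'
      (fun z hz => congrArg ν ((E p).left_inv hz.2).symm)
      (fun z hz => congrArg φ ((E p).left_inv hz.2).symm) hs1 hs2 hs3 hc

end LorentzMetric

end Forward

/-! ### Functions on a box -/

section Box

/-- The point of `ℝ⁴` with given first and last pair of coordinates. -/
def joinPair (z w : Fin 2 → ℝ) : Fin 4 → ℝ := ![z 0, z 1, w 0, w 1]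

theorem joinPair_il (z w : Fin 2 → ℝ) (i : Fin 2) : joinPair z w (il i) = z i := by
  fin_cases i <;> rfl

theorem joinPair_ir (z w : Fin 2 → ℝ) (i : Fin 2) : joinPair z w (ir i) = w i := by
  fin_cases i <;> rfl

theorem fstPair_joinPair (z w : Fin 2 → ℝ) : fstPair (joinPair z w) = z := by
  ext i
  rw [fstPair_apply, joinPair_il]

theorem sndPair_joinPair (z w : Fin 2 → ℝ) : sndPair (joinPair z w) = w := by
  ext i
  rw [sndPair_apply, joinPair_ir]

theorem joinPair_pairs (y : Fin 4 → ℝ) : joinPair (fstPair y) (sndPair y) = y := by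
  ext k
  induction k using forall_blocks with
  | hl i => rw [joinPair_il, fstPair_apply]
  | hr i => rw [joinPair_ir, sndPair_apply]

theorem contDiff_joinPair_left (w : Fin 2 → ℝ) : ContDiff ℝ ∞ fun z => joinPair z w := by
  rw [contDiff_pi]
  intro k
  induction k using forall_blocks with
  | hl i => simpa only [joinPair_il] using contDiff_apply ℝ ℝ i
  | hr i => simpa only [joinPair_ir] using contDiff_const

theorem contDiff_joinPair_right (z : Fin 2 → ℝ) : ContDiff ℝ ∞ (joinPair z) := by
  rw [contDiff_pi]
  intro k
  induction k using forall_blocks with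
  | hl i => simpa only [joinPair_il] using contDiff_const
  | hr i => simpa only [joinPair_ir] using contDiff_apply ℝ ℝ i

variable {f : (Fin 4 → ℝ) → ℝ} {c : Fin 4 → ℝ} {r : ℝ} {z w : Fin 2 → ℝ}

theorem pd_joinPair_left (hf : DifferentiableAt ℝ f (joinPair z w)) (i : Fin 2) :
    pd i (fun z => f (joinPair z w)) z = pd (il i) f (joinPair z w) := by
  rw [pd_comp (ψ := fun z => joinPair z w) hf ((contDiff_joinPair_left w).differentiable (by simp) z)]
  simp [sum_blocks, joinPair_il, joinPair_ir, pd_coord, pd_const]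

theorem pd_joinPair_right (hf : DifferentiableAt ℝ f (joinPair z w)) (i : Fin 2) :
    pd i (fun w => f (joinPair z w)) w = pd (ir i) f (joinPair z w) := by
  rw [pd_comp hf ((contDiff_joinPair_right z).differentiable (by simp) w)]
  simp [sum_blocks, joinPair_il, joinPair_ir, pd_coord, pd_const]

/-- In the sup norm a ball is a box, hence the product of a ball in the base coordinates and a ball
in the fibre coordinates. -/
theorem mem_ball_iff_pairs (hr : 0 < r) {y : Fin 4 → ℝ} : y ∈ Metric.ball c r ↔
    fstPair y ∈ Metric.ball (fstPair c) r ∧ sndPair y ∈ Metric.ball (sndPair c) r := by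
  simp only [Metric.mem_ball, dist_pi_lt_iff hr, fstPair_apply, sndPair_apply]
  refine ⟨fun h => ⟨fun i => h _, fun i => h _⟩, fun h k => ?_⟩
  induction k using forall_blocks with
  | hl i => exact h.1 i
  | hr i => exact h.2 i

theorem joinPair_mem_ball (hr : 0 < r) (hz : z ∈ Metric.ball (fstPair c) r)
    (hw : w ∈ Metric.ball (sndPair c) r) : joinPair z w ∈ Metric.ball c r := by
  rw [mem_ball_iff_pairs hr, fstPair_joinPair, sndPair_joinPair]
  exact ⟨hz, hw⟩

theorem eq_of_pd_eq_zero {n : ℕ} {q : (Fin n → ℝ) → ℝ} {x₀ x x' : Fin n → ℝ}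
    (hq : ∀ y ∈ Metric.ball x₀ r, DifferentiableAt ℝ q y)
    (h : ∀ y ∈ Metric.ball x₀ r, ∀ i, pd i q y = 0) (hx : x ∈ Metric.ball x₀ r)
    (hx' : x' ∈ Metric.ball x₀ r) : q x = q x' := by
  refine Metric.isOpen_ball.is_const_of_fderiv_eq_zero
    (convex_ball x₀ r).isPreconnected (fun y hy => (hq y hy).differentiableWithinAt) ?_ hx hx'
  intro y hy
  ext v
  rw [fderiv_eq_sum_pd]
  simp [h y hy]

theorem eq_of_pd_ir_eq_zero (hr : 0 < r) (hf : ContDiffOn ℝ ∞ f (Metric.ball c r))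
    (h : ∀ y ∈ Metric.ball c r, ∀ C, pd (ir C) f y = 0) (hz : z ∈ Metric.ball (fstPair c) r)
    {w' : Fin 2 → ℝ} (hw : w ∈ Metric.ball (sndPair c) r) (hw' : w' ∈ Metric.ball (sndPair c) r) :
    f (joinPair z w) = f (joinPair z w') := by
  have hd : ∀ u ∈ Metric.ball (sndPair c) r, DifferentiableAt ℝ f (joinPair z u) := fun u hu =>
    hf.diffAt Metric.isOpen_ball (joinPair_mem_ball hr hz hu)
  refine eq_of_pd_eq_zero (q := fun w => f (joinPair z w)) (fun u hu => ?_) (fun u hu i => ?_) hw hw'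
  · exact (hd u hu).comp u ((contDiff_joinPair_right z).differentiable (by simp) u)
  · rw [pd_joinPair_right (hd u hu), h _ (joinPair_mem_ball hr hz hu)]

theorem eq_of_pd_il_eq_zero (hr : 0 < r) (hf : ContDiffOn ℝ ∞ f (Metric.ball c r))
    (h : ∀ y ∈ Metric.ball c r, ∀ i, pd (il i) f y = 0) (hw : w ∈ Metric.ball (sndPair c) r)
    {z' : Fin 2 → ℝ} (hz : z ∈ Metric.ball (fstPair c) r) (hz' : z' ∈ Metric.ball (fstPair c) r) :
    f (joinPair z w) = f (joinPair z' w) := by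
  have hd : ∀ u ∈ Metric.ball (fstPair c) r, DifferentiableAt ℝ f (joinPair u w) := fun u hu =>
    hf.diffAt Metric.isOpen_ball (joinPair_mem_ball hr hu hw)
  refine eq_of_pd_eq_zero (q := fun z => f (joinPair z w)) (fun u hu => ?_) (fun u hu i => ?_) hz hz'
  · exact (hd u hu).comp u ((contDiff_joinPair_left w).differentiable (by simp) u)
  · rw [pd_joinPair_left (hd u hu), h _ (joinPair_mem_ball hr hu hw)]

end Box

/-! ### The fibre projection as an endomorphism field -/

section Projection

variable {G H : Field4} {U : Set (Fin 4 → ℝ)} {y : Fin 4 → ℝ} {ν φ : (Fin 4 → ℝ) → ℝ}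

theorem IsMetricOn.smooth_tracelessRicci (hG : IsMetricOn G U) :
    MatrixSmoothOn (tracelessRicci G) U :=
  hG.smooth_ricci.sub (MatrixSmoothOn.smul (hG.contDiffOn_scal.div_const 4) hG.smooth)

theorem IsMetricOn.smooth_P (hG : IsMetricOn G U) (hν : ContDiffOn ℝ ∞ ν U) :
    MatrixSmoothOn (P G ν) U := by
  have hN := hG.smooth_tracelessRicci
  have hN2 : MatrixSmoothOn (fun z => dot G z (tracelessRicci G z) (tracelessRicci G z)) U :=
    (hN.mul hG.smooth_inv).mul hN
  have hb : ContDiffOn ℝ ∞ (bInv G) U := (hG.smooth_inv.mul hN2).trace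
  exact (hN2.add (MatrixSmoothOn.smul (contDiffOn_const.mul hν) hN)).add
    (MatrixSmoothOn.smul ((contDiffOn_const.mul (hν.pow 2)).sub (hb.div_const 2)) hG.smooth)

theorem IsMetricOn.smooth_hProj (hG : IsMetricOn G U) (hν : ContDiffOn ℝ ∞ ν U)
    (ht : ∀ z ∈ U, tr G z (P G ν z) ≠ 0) : MatrixSmoothOn (hProj G ν) U :=
  MatrixSmoothOn.smul (contDiffOn_const.div (hG.smooth_inv.mul (hG.smooth_P hν)).trace ht)
    (hG.smooth_P hν)

theorem IsMetricOn.hProj_symm (hG : IsMetricOn G U) (hy : y ∈ U) :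
    (hProj G ν y)ᵀ = hProj G ν y := by
  rw [hProj, Matrix.transpose_smul]
  congr 1
  rw [P, dot]
  simp only [Matrix.transpose_add, Matrix.transpose_smul, Matrix.transpose_mul,
    hG.tracelessRicci_symm hy, hG.symm y hy, hG.inv_symm hy, Matrix.mul_assoc]

theorem tr_hProj (ht : tr G y (P G ν y) ≠ 0) : ((G y)⁻¹ * hProj G ν y).trace = 2 := by
  rw [hProj, Matrix.mul_smul, Matrix.trace_smul, smul_eq_mul]
  change 2 / tr G y (P G ν y) * tr G y (P G ν y) = 2
  field_simp

/-- The covariant derivative of `H` in terms of the endomorphism field `G⁻¹ H`. -/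
theorem IsMetricOn.nablaMat_eq_mul (hG : IsMetricOn G U) (hH : MatrixSmoothOn H U) (hy : y ∈ U)
    (α : Fin 4) : nablaMat G H α y = G y * (pdMat α (fun z => (G z)⁻¹ * H z) y
      + conn G α y * ((G y)⁻¹ * H y) - ((G y)⁻¹ * H y) * conn G α y) := by
  have hT := hG.smooth_inv.mul hH
  have h1 : pdMat α H y = pdMat α (fun z => G z * ((G z)⁻¹ * H z)) y :=
    pdMat_congr_of_isOpen hG.isOpen hy fun z hz =>
      (Matrix.mul_nonsing_inv_cancel_left _ _ (hG.isUnit_det hz)).symm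
  have h2 : H y = G y * ((G y)⁻¹ * H y) :=
    (Matrix.mul_nonsing_inv_cancel_left _ _ (hG.isUnit_det hy)).symm
  rw [nablaMat, h1, pdMat_mul hG.isOpen hy hG.smooth hT, hG.pdMat_metric hy]
  set T := (G y)⁻¹ * H y with hTdef
  rw [h2, Matrix.transpose_mul, hG.symm y hy]
  simp only [Matrix.mul_add, Matrix.mul_sub, Matrix.add_mul, Matrix.mul_assoc]
  abel

theorem WarpedEq.nablaMat_eq (h : WarpedEq G H y) (α : Fin 4) :
    (2 : ℝ) • nablaMat G H α y = Matrix.vecMulVec (H y α) (divergence G H y)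
      + Matrix.vecMulVec (divergence G H y) (H y α) := by
  ext β γ
  have := h α β γ
  rw [nabla_eq] at this
  rw [Matrix.smul_apply, smul_eq_mul, this, Matrix.add_apply, Matrix.vecMulVec_apply,
    Matrix.vecMulVec_apply]
  ring

end Projection

/-! ### Metrics with a straightened fibre projection are warped products -/

section Straightened

variable {G : Field4} {U : Set (Fin 4 → ℝ)} {y : Fin 4 → ℝ} {ν φ : (Fin 4 → ℝ) → ℝ}
  {H : Field4}

/-- The upper left block. -/
def blockLL (A : Matrix (Fin 4) (Fin 4) ℝ) : Matrix (Fin 2) (Fin 2) ℝ := A.submatrix il il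

/-- The lower right block. -/
def blockRR (A : Matrix (Fin 4) (Fin 4) ℝ) : Matrix (Fin 2) (Fin 2) ℝ := A.submatrix ir ir

theorem eq_blocks_self (A : Matrix (Fin 4) (Fin 4) ℝ) :
    A = blocks (blockLL A) (A.submatrix il ir) (A.submatrix ir il) (blockRR A) := by
  apply eq_blocks <;> intro i j <;> rfl

theorem blocks_inj {a b c d a' b' c' d' : Matrix (Fin 2) (Fin 2) ℝ}
    (h : blocks a b c d = blocks a' b' c' d') : a = a' ∧ b = b' ∧ c = c' ∧ d = d' := by
  refine ⟨?_, ?_, ?_, ?_⟩ <;> ext i j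
  · simpa using congrFun (congrFun h (il i)) (il j)
  · simpa using congrFun (congrFun h (il i)) (ir j)
  · simpa using congrFun (congrFun h (ir i)) (il j)
  · simpa using congrFun (congrFun h (ir i)) (ir j)

/-- On `U`, the tensor `H` is the part of the metric `G` in the last two coordinates, it satisfies
the warped product equation and its divergence is closed. -/
structure IsStraightened (G H : Field4) (U : Set (Fin 4 → ℝ)) : Prop where
  isMetricOn : IsMetricOn G U
  smooth : MatrixSmoothOn H U
  symm : ∀ y ∈ U, (H y)ᵀ = H y
  proj : ∀ y ∈ U, H y = G y * blocks 0 0 0 1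
  warpedEq : ∀ y ∈ U, WarpedEq G H y
  isClosedAt : ∀ y ∈ U, IsClosedAt (divergence G H) y

namespace IsStraightened

/-- Symmetry of `H` means that `G` commutes with the projection onto the last two coordinates, which
forces the off-diagonal blocks to vanish. -/
theorem metric_eq (h : IsStraightened G H U) (hy : y ∈ U) :
    G y = blocks (blockLL (G y)) 0 0 (blockRR (G y)) := by
  have h1 := h.proj y hy
  have h2 := h.symm y hy
  rw [h1, Matrix.transpose_mul, h.isMetricOn.symm y hy, blocks_transpose] at h2
  have h3 := eq_blocks_self (G y)
  rw [h3, blocks_mul, blocks_mul] at h2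
  simp only [Matrix.transpose_zero, Matrix.transpose_one, Matrix.zero_mul, Matrix.mul_zero,
    Matrix.one_mul, Matrix.mul_one, add_zero, zero_add] at h2
  obtain ⟨-, h4, h5, -⟩ := blocks_inj h2
  rw [← h4, h5] at h3
  exact h3

theorem tensor_eq (h : IsStraightened G H U) (hy : y ∈ U) :
    H y = blocks 0 0 0 (blockRR (G y)) := by
  rw [h.proj y hy]
  conv_lhs => rw [h.metric_eq hy, blocks_mul]
  simp

theorem det_eq (h : IsStraightened G H U) (hy : y ∈ U) :
    (G y).det = (blockLL (G y)).det * (blockRR (G y)).det := by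
  conv_lhs => rw [h.metric_eq hy, blocks_det]

theorem det_base (h : IsStraightened G H U) (hy : y ∈ U) : (blockLL (G y)).det ≠ 0 := by
  have := h.isMetricOn.det_ne y hy
  rw [h.det_eq hy] at this
  exact left_ne_zero_of_mul this

theorem det_fiber (h : IsStraightened G H U) (hy : y ∈ U) : (blockRR (G y)).det ≠ 0 := by
  have := h.isMetricOn.det_ne y hy
  rw [h.det_eq hy] at this
  exact right_ne_zero_of_mul this

theorem fiber_symm (h : IsStraightened G H U) (hy : y ∈ U) :
    (blockRR (G y))ᵀ = blockRR (G y) := by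
  ext i j
  exact h.isMetricOn.symm_apply hy _ _

/-- The endomorphism field is constant, so its covariant derivative is its commutator with the
connection matrix. Only the off-diagonal blocks of the latter survive. -/
theorem nablaMat_eq (h : IsStraightened G H U) (hy : y ∈ U) (α : Fin 4) :
    nablaMat G H α y = blocks 0 (blockLL (G y) * (conn G α y).submatrix il ir)
      (-(blockRR (G y) * (conn G α y).submatrix ir il)) 0 := by
  have h1 : ∀ z ∈ U, (G z)⁻¹ * H z = blocks 0 0 0 1 := fun z hz => by
    rw [h.proj z hz, Matrix.nonsing_inv_mul_cancel_left _ _ (h.isMetricOn.isUnit_det hz)]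
  rw [h.isMetricOn.nablaMat_eq_mul h.smooth hy, pdMat_congr_of_isOpen h.isMetricOn.isOpen hy h1,
    h1 y hy]
  have h2 : pdMat α (fun _ => blocks 0 0 0 1) y = 0 := by
    ext a b
    exact pd_const _
  rw [h2, zero_add]
  conv_lhs => rw [h.metric_eq hy, eq_blocks_self (conn G α y), blocks_mul, blocks_mul, blocks_sub,
    blocks_mul]
  refine blocks_congr ?_ ?_ ?_ ?_ <;> simp

/-- The right-hand side of the equation for `∇H` contains the row of `H` belonging to the direction
of differentiation, and this row is zero for a base direction. So `H` is parallel along the base. -/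
theorem conn_il (h : IsStraightened G H U) (hy : y ∈ U) (i j : Fin 2) (C : Fin 2) :
    conn G (il i) y (il j) (ir C) = 0 := by
  have h1 := (h.warpedEq y hy).nablaMat_eq (il i)
  have h2 : H y (il i) = 0 := by
    ext k
    rw [h.tensor_eq hy]
    induction k using forall_blocks <;> simp
  rw [h2, Matrix.zero_vecMulVec, Matrix.vecMulVec_zero, add_zero] at h1
  have h3 := (smul_eq_zero.1 h1).resolve_left two_ne_zero
  rw [h.nablaMat_eq hy, show (0 : Matrix (Fin 4) (Fin 4) ℝ) = blocks 0 0 0 0 by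
    apply eq_blocks <;> simp] at h3
  have h4 := (blocks_inj h3).2.1
  have h5 := congrArg (fun X => (blockLL (G y))⁻¹ * X) h4
  simp only [Matrix.nonsing_inv_mul_cancel_left _ _ (h.det_base hy).isUnit, Matrix.mul_zero] at h5
  exact congrFun (congrFun h5 j) C

theorem vecMulVec_blocks (h : IsStraightened G H U) (hy : y ∈ U) (C : Fin 2) :
    blocks 0 ((2 : ℝ) • (blockLL (G y) * (conn G (ir C) y).submatrix il ir))
      ((2 : ℝ) • -(blockRR (G y) * (conn G (ir C) y).submatrix ir il)) 0 =
    blocks 0 (Matrix.vecMulVec (divergence G H y ∘ il) (blockRR (G y) C))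
      (Matrix.vecMulVec (blockRR (G y) C) (divergence G H y ∘ il))
      (Matrix.vecMulVec (blockRR (G y) C) (divergence G H y ∘ ir)
        + Matrix.vecMulVec (divergence G H y ∘ ir) (blockRR (G y) C)) := by
  have h1 := (h.warpedEq y hy).nablaMat_eq (ir C)
  rw [h.nablaMat_eq hy, smul_blocks, smul_zero] at h1
  rw [h1]
  apply eq_blocks <;> intro a b <;>
    simp [Matrix.vecMulVec_apply, h.tensor_eq hy]

/-- The fibre block of `∇H` vanishes, so the equation gives `h_{AB} ξ_D + h_{AD} ξ_B = 0`. Taking `B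
= D = C` shows that a nonzero `ξ_C` would annihilate a column of the invertible fibre block. -/
theorem divergence_ir (h : IsStraightened G H U) (hy : y ∈ U) (C : Fin 2) :
    divergence G H y (ir C) = 0 := by
  have hm : ∀ A B D, blockRR (G y) A B * divergence G H y (ir D)
      + divergence G H y (ir B) * blockRR (G y) A D = 0 := fun A B D => by
    have := (blocks_inj (h.vecMulVec_blocks hy A)).2.2.2
    have := congrFun (congrFun this B) D
    simpa [Matrix.vecMulVec_apply] using this.symm
  by_contra hne
  have h2 : ∀ A, blockRR (G y) A C = 0 := fun A => by
    have := hm A C C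
    have h3 : 2 * (blockRR (G y) A C * divergence G H y (ir C)) = 0 := by linarith
    exact (mul_eq_zero.1 ((mul_eq_zero.1 h3).resolve_left two_ne_zero)).resolve_right hne
  exact h.det_fiber hy (Matrix.det_eq_zero_of_column_eq_zero C h2)

theorem conn_ir (h : IsStraightened G H U) (hy : y ∈ U) (C D : Fin 2) (i : Fin 2) :
    conn G (ir C) y (ir D) (il i) =
      -(1 / 2) * (if D = C then 1 else 0) * divergence G H y (il i) := by
  have h1 := (blocks_inj (h.vecMulVec_blocks hy C)).2.2.1
  have h2 : blockRR (G y) C = blockRR (G y) *ᵥ Pi.single C 1 := by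
    ext a
    rw [Matrix.mulVec_single_one]
    exact (congrFun (congrFun (h.fiber_symm hy) C) a).symm
  rw [h2, ← Matrix.mul_vecMulVec] at h1
  have h5 := congrArg (fun X => (blockRR (G y))⁻¹ * X) h1
  simp only [Matrix.nonsing_inv_mul_cancel_left _ _ (h.det_fiber hy).isUnit, Matrix.mul_smul,
    Matrix.mul_neg] at h5
  have h6 := congrFun (congrFun h5 D) i
  rw [Matrix.smul_apply, Matrix.neg_apply, Matrix.vecMulVec_apply, smul_eq_mul, Pi.single_apply] at h6
  change 2 * -conn G (ir C) y (ir D) (il i) = _ * divergence G H y (il i) at h6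
  linarith

theorem pd_ir_base (h : IsStraightened G H U) (hy : y ∈ U) (C i j : Fin 2) :
    pd (ir C) (fun z => G z (il i) (il j)) y = 0 := by
  have hc : ∀ i j, (G y * conn G (ir C) y) (il i) (il j) = 0 := by
    intro i j
    rw [Matrix.mul_apply, sum_blocks]
    have e1 : ∀ k, conn G (ir C) y (il k) (il j) = 0 := fun k => by
      rw [h.isMetricOn.conn_symm hy]
      exact h.conn_il hy j k C
    have e2 : ∀ k, G y (il i) (ir k) = 0 := fun k => by
      rw [h.metric_eq hy, blocks_lr, Matrix.zero_apply]
    simp [e1, e2]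
  have h1 := congrFun (congrFun (h.isMetricOn.pdMat_metric hy (ir C)) (il i)) (il j)
  rw [Matrix.add_apply, Matrix.transpose_apply, hc, hc, add_zero] at h1
  exact h1

/-- All entries of the fibre block satisfy the same logarithmic differential equation in the base
directions. This is the source of the common warping factor. -/
theorem pd_il_fiber (h : IsStraightened G H U) (hy : y ∈ U) (i C D : Fin 2) :
    pd (il i) (fun z => G z (ir C) (ir D)) y = -divergence G H y (il i) * G y (ir C) (ir D) := by
  have hc : ∀ C D, (G y * conn G (il i) y) (ir C) (ir D) =
      -(1 / 2) * divergence G H y (il i) * G y (ir C) (ir D) := by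
    intro C D
    rw [Matrix.mul_apply, sum_blocks]
    have e1 : ∀ k, conn G (il i) y (ir k) (ir D) =
        -(1 / 2) * (if k = D then 1 else 0) * divergence G H y (il i) := fun k => by
      rw [h.isMetricOn.conn_symm hy, h.conn_ir hy]
    have e2 : ∀ k, G y (ir C) (il k) = 0 := fun k => by
      rw [h.metric_eq hy, blocks_rl, Matrix.zero_apply]
    simp only [e1, e2, zero_mul, Finset.sum_const_zero, zero_add, mul_ite, mul_one, mul_zero,
      ite_mul, Finset.sum_ite_eq', Finset.mem_univ, if_true]
    ring
  have h1 := congrFun (congrFun (h.isMetricOn.pdMat_metric hy (il i)) (ir C)) (ir D)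
  rw [Matrix.add_apply, Matrix.transpose_apply, hc, hc, h.isMetricOn.symm_apply hy (ir D)] at h1
  rw [pdMat_apply] at h1
  rw [h1]
  ring

/-- Closedness of `ξ` exchanges the indices, and the fibre components of `ξ` vanish identically.
This makes the warping factor a function of the base coordinates alone. -/
theorem pd_ir_divergence (h : IsStraightened G H U) (hy : y ∈ U) (C i : Fin 2) :
    pd (ir C) (fun z => divergence G H z (il i)) y = 0 := by
  rw [h.isClosedAt y hy,
    pd_congr_of_isOpen h.isMetricOn.isOpen hy fun z hz => h.divergence_ir hz C, pd_const]

theorem contDiffOn_divergence (h : IsStraightened G H U) (γ : Fin 4) :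
    ContDiffOn ℝ ∞ (fun z => divergence G H z γ) U := by
  have hn : ∀ α, MatrixSmoothOn (nablaMat G H α) U := fun α =>
    (h.smooth.pdMat h.isMetricOn.isOpen).sub
      (((h.isMetricOn.smooth_conn α).transpose.mul h.smooth).add
        (h.smooth.mul (h.isMetricOn.smooth_conn α)))
  simp only [divergence_eq]
  exact ContDiffOn.sum fun α _ => (h.isMetricOn.smooth_inv.mul (hn α)) α γ

/-- A fibre vector of negative square would be time-like, and on fibre vectors `h` agrees with the
metric, contrary to condition 2. The semidefinite block is definite because it is invertible. -/
theorem posDef_fiber (h : IsStraightened G H U) (hy : y ∈ U) (hs : IsSpaceLike G H y) :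
    (blockRR (G y)).PosDef := by
  have hsymm : (blockRR (G y)).IsHermitian := by
    rw [Matrix.IsHermitian, Matrix.conjTranspose_eq_transpose_of_trivial, h.fiber_symm hy]
  have hpsd : (blockRR (G y)).PosSemidef := by
    refine Matrix.PosSemidef.of_dotProduct_mulVec_nonneg hsymm fun w => ?_
    rw [star_trivial]
    by_contra hlt
    push Not at hlt
    have e1 : joinPair 0 w ⬝ᵥ G y *ᵥ joinPair 0 w = w ⬝ᵥ blockRR (G y) *ᵥ w := by
      simp [dotProduct, Matrix.mulVec, sum_blocks, joinPair_il, joinPair_ir, blockRR]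
    have e2 : joinPair 0 w ⬝ᵥ H y *ᵥ joinPair 0 w = w ⬝ᵥ blockRR (G y) *ᵥ w := by
      rw [h.tensor_eq hy]
      simp [dotProduct, Matrix.mulVec, sum_blocks, joinPair_il, joinPair_ir]
    have := hs (joinPair 0 w) (by rwa [e1])
    rw [e2] at this
    linarith
  rw [hpsd.posDef_iff_isUnit, Matrix.isUnit_iff_isUnit_det]
  exact (h.det_fiber hy).isUnit

end IsStraightened

end Straightened

/-! ### Integration to a warped product on a box, and normalisation of the fibre curvature -/

section Normalization

variable {G H : Field4} {c : Fin 4 → ℝ} {r : ℝ} {ν φ : (Fin 4 → ℝ) → ℝ}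
  {v s : (Fin 2 → ℝ) → Matrix (Fin 2) (Fin 2) ℝ} {lam : (Fin 2 → ℝ) → ℝ}

/-- A metric on a box with a straightened fibre projection is a warped product. -/
theorem IsStraightened.exists_isWarped (h : IsStraightened G H (Metric.ball c r)) (hr : 0 < r)
    (hs : ∀ y ∈ Metric.ball c r, IsSpaceLike G H y) :
    ∃ v lam s, IsWarped G (Metric.ball c r) v lam s (Metric.ball (fstPair c) r)
      (Metric.ball (sndPair c) r) ∧ ∀ w ∈ Metric.ball (sndPair c) r, (s w).PosDef := by
  have hz₀ : fstPair c ∈ Metric.ball (fstPair c) r := Metric.mem_ball_self hr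
  have hw₀ : sndPair c ∈ Metric.ball (sndPair c) r := Metric.mem_ball_self hr
  have ho := h.isMetricOn.isOpen
  set z₀ := fstPair c with hz₀def
  set w₀ := sndPair c with hw₀def
  have hL : Set.MapsTo (fun z => joinPair z w₀) (Metric.ball z₀ r) (Metric.ball c r) :=
    fun z hz => joinPair_mem_ball hr hz hw₀
  have hR : Set.MapsTo (joinPair z₀) (Metric.ball w₀ r) (Metric.ball c r) :=
    fun w hw => joinPair_mem_ball hr hz₀ hw
  have hsL : ∀ a b, ContDiffOn ℝ ∞ (fun z => G (joinPair z w₀) a b) (Metric.ball z₀ r) :=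
    fun a b => (h.isMetricOn.smooth a b).comp (contDiff_joinPair_left w₀).contDiffOn hL
  have hsR : ∀ a b, ContDiffOn ℝ ∞ (fun w => G (joinPair z₀ w) a b) (Metric.ball w₀ r) :=
    fun a b => (h.isMetricOn.smooth a b).comp (contDiff_joinPair_right z₀).contDiffOn hR
  -- A positive diagonal entry of the fibre block, taken along the base slice through the centre,
  -- serves as `e^{2λ}`. The fibre metric is then the fibre block over the centre, divided by the
  -- value of `q` there.
  let q : (Fin 2 → ℝ) → ℝ := fun z => G (joinPair z w₀) (ir 0) (ir 0)
  have hq : ∀ z ∈ Metric.ball z₀ r, 0 < q z := fun z hz =>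
    (h.posDef_fiber (hL hz) (hs _ (hL hz))).diag_pos (i := 0)
  have hqs : ContDiffOn ℝ ∞ q (Metric.ball z₀ r) := hsL _ _
  have hq' : ∀ z ∈ Metric.ball z₀ r, q z ≠ 0 := fun z hz => (hq z hz).ne'
  have hfst : Set.MapsTo fstPair (Metric.ball c r) (Metric.ball z₀ r) :=
    fun y hy => ((mem_ball_iff_pairs hr).1 hy).1
  have hsnd : Set.MapsTo sndPair (Metric.ball c r) (Metric.ball w₀ r) :=
    fun y hy => ((mem_ball_iff_pairs hr).1 hy).2
  have hqy : ContDiffOn ℝ ∞ (fun y => q (fstPair y)) (Metric.ball c r) :=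
    hqs.comp contDiff_fstPair.contDiffOn hfst
  have hq₀ := hq z₀ hz₀
  refine ⟨fun z => blockLL (G (joinPair z w₀)), fun z => Real.log (q z) / 2,
    fun w => (q z₀)⁻¹ • blockRR (G (joinPair z₀ w)), ?_, ?_⟩
  · refine ⟨ho, ⟨Metric.isOpen_ball, fun i j => hsL _ _, fun z hz => ?_, fun z hz => ?_⟩,
      (hqs.log hq').div_const 2, ⟨Metric.isOpen_ball, fun i j => ?_, fun w hw => ?_, fun w hw => ?_⟩,
      hfst, hsnd, fun y hy => ?_⟩
    · ext i j
      exact h.isMetricOn.symm_apply (hL hz) _ _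
    · exact h.det_base (hL hz)
    · exact contDiffOn_const.mul (hsR _ _)
    · rw [Matrix.transpose_smul, h.fiber_symm (hR hw)]
    · rw [Matrix.det_smul]
      exact mul_ne_zero (pow_ne_zero _ (inv_ne_zero hq₀.ne')) (h.det_fiber (hR hw))
    · have hzy := hfst hy
      have hwy := hsnd hy
      rw [warpedBlock_eq]
      have e0 : Real.exp (2 * (Real.log (q (fstPair y)) / 2)) = q (fstPair y) := by
        rw [mul_div_cancel₀ _ two_ne_zero, Real.exp_log (hq _ hzy)]
      rw [e0]
      conv_lhs => rw [h.metric_eq hy]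
      refine blocks_congr ?_ rfl rfl ?_
      · ext i j
        have := eq_of_pd_ir_eq_zero hr (h.isMetricOn.smooth (il i) (il j))
          (fun z hz C => h.pd_ir_base hz C i j) hzy hwy hw₀
        rw [joinPair_pairs] at this
        exact this
      · ext a b
        -- The base components of `ξ` are constant along the fibres, so the equation for `q`, valid
        -- on the central slice, has the same coefficient as the one at `z`.
        have hξ : ∀ z ∈ Metric.ball c r, ∀ i, divergence G H (joinPair (fstPair z) w₀) (il i) =
            divergence G H z (il i) := fun z hz i => by
          have := eq_of_pd_ir_eq_zero hr (h.contDiffOn_divergence (il i))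
            (fun z hz C => h.pd_ir_divergence hz C i) (hfst hz) hw₀ (hsnd hz)
          rwa [joinPair_pairs] at this
        have hpq : ∀ z ∈ Metric.ball c r, ∀ i, pd (il i) (fun y => q (fstPair y)) z =
            -divergence G H z (il i) * q (fstPair z) := fun z hz i => by
          have hm := hL (hfst hz)
          rw [pd_il_fst (hqs.diffAt Metric.isOpen_ball (hfst hz)),
            pd_joinPair_left ((h.isMetricOn.smooth _ _).diffAt ho hm), h.pd_il_fiber hm, hξ z hz]
        -- Numerator and denominator satisfy the same equation `∂ᵢ f = -ξᵢ f`, so the quotient does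
        -- not depend on the base coordinates.
        have hfs : ContDiffOn ℝ ∞ (fun z => G z (ir a) (ir b) * (q (fstPair z))⁻¹)
            (Metric.ball c r) :=
          (h.isMetricOn.smooth _ _).mul (hqy.inv fun z hz => hq' _ (hfst hz))
        have hf : ∀ z ∈ Metric.ball c r, ∀ i,
            pd (il i) (fun z => G z (ir a) (ir b) * (q (fstPair z))⁻¹) z = 0 := by
          intro z hz i
          have hne := hq' _ (hfst hz)
          have e1 : pd (il i) (fun z => G z (ir a) (ir b)) z =
              pd (il i) (fun z => G z (ir a) (ir b) * (q (fstPair z))⁻¹ * q (fstPair z)) z :=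
            pd_congr_of_isOpen ho hz fun u hu => by
              rw [mul_assoc, inv_mul_cancel₀ (hq' _ (hfst hu)), mul_one]
          rw [pd_mul (hfs.diffAt ho hz) (hqy.diffAt ho hz), h.pd_il_fiber hz, hpq z hz] at e1
          have e2 : pd (il i) (fun z => G z (ir a) (ir b) * (q (fstPair z))⁻¹) z
              * q (fstPair z) = 0 := by
            have e3 : G z (ir a) (ir b) * (q (fstPair z))⁻¹ *
                (-divergence G H z (il i) * q (fstPair z)) =
                -divergence G H z (il i) * G z (ir a) (ir b) := by
              field_simp
            linarith
          exact (mul_eq_zero.1 e2).resolve_right hne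
        have := eq_of_pd_il_eq_zero hr hfs hf hwy hzy hz₀
        simp only [joinPair_pairs, fstPair_joinPair] at this
        rw [Matrix.smul_apply, Matrix.smul_apply, smul_eq_mul, smul_eq_mul]
        change G y (ir a) (ir b) = q (fstPair y) * ((q z₀)⁻¹ *
          G (joinPair z₀ (sndPair y)) (ir a) (ir b))
        rw [mul_comm (q z₀)⁻¹, ← this]
        have hne := hq' _ hzy
        field_simp
  · intro w hw
    exact (h.posDef_fiber (hR hw) (hs _ (hR hw))).smul (inv_pos.2 hq₀)

theorem christoffel_smul {B : Set (Fin 2 → ℝ)} (hs : IsMetricOn s B) {k : ℝ} (hk : k ≠ 0)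
    {z : Fin 2 → ℝ} (hz : z ∈ B) (a i j : Fin 2) :
    christoffel (fun z => k • s z) z a i j = christoffel s z a i j := by
  have hp : ∀ l a b, pd l (fun z => k * s z a b) z = k * pd l (fun z => s z a b) z :=
    fun l a b => pd_const_mul k ((hs.smooth a b).diffAt hs.isOpen hz)
  have hi : (k • s z)⁻¹ = k⁻¹ • (s z)⁻¹ := by
    refine Matrix.inv_eq_right_inv ?_
    rw [Matrix.smul_mul, Matrix.mul_smul, Matrix.mul_nonsing_inv _ (hs.isUnit_det hz), smul_smul,
      mul_inv_cancel₀ hk, one_smul]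
  simp only [christoffel, hi, Matrix.smul_apply, smul_eq_mul, hp]
  congr 1
  refine Finset.sum_congr rfl fun l _ => ?_
  field_simp

/-- A constant factor does not change the connection nor the curvature with one upper index.
Lowering the index brings one factor `k`, and the determinant in dimension two brings `k²`. -/
theorem gaussCurvature_smul {B : Set (Fin 2 → ℝ)} (hs : IsMetricOn s B) {k : ℝ} (hk : k ≠ 0)
    {z : Fin 2 → ℝ} (hz : z ∈ B) :
    gaussCurvature (fun z => k • s z) z = k⁻¹ * gaussCurvature s z := by
  have hu : ∀ a b c d, riemannUp (fun z => k • s z) z a b c d = riemannUp s z a b c d := by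
    intro a b c d
    have e1 : ∀ l a b c, pd l (fun z => christoffel (fun z => k • s z) z a b c) z =
        pd l (fun z => christoffel s z a b c) z := fun l a b c =>
      pd_congr_of_isOpen hs.isOpen hz fun u hu => christoffel_smul hs hk hu a b c
    simp only [riemannUp, e1, christoffel_smul hs hk hz]
  have hr : riemann (fun z => k • s z) z 0 1 0 1 = k * riemann s z 0 1 0 1 := by
    simp only [riemann, hu, Matrix.smul_apply, smul_eq_mul, Finset.mul_sum, mul_assoc]
  rw [gaussCurvature, gaussCurvature, hr, Matrix.det_smul, Fintype.card_fin]
  have := hs.det_ne z hz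
  field_simp

/-- The splitting into warping factor and fibre metric is unique only up to a constant; this freedom
is used to normalise the Gauss curvature. -/
theorem IsWarped.rescale {U : Set (Fin 4 → ℝ)} {A B : Set (Fin 2 → ℝ)}
    (h : IsWarped G U v lam s A B) {k : ℝ} (hk : 0 < k) :
    IsWarped G U v (fun z => lam z - Real.log k / 2) (fun z => k • s z) A B where
  isOpen := h.isOpen
  base := h.base
  smooth := h.smooth.sub contDiffOn_const
  fiber := ⟨h.fiber.isOpen, MatrixSmoothOn.smul contDiffOn_const h.fiber.smooth,
    fun z hz => by rw [Matrix.transpose_smul, h.fiber.symm z hz],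
    fun z hz => by
      rw [Matrix.det_smul]
      exact mul_ne_zero (pow_ne_zero _ hk.ne') (h.fiber.det_ne z hz)⟩
  mapsTo_fst := h.mapsTo_fst
  mapsTo_snd := h.mapsTo_snd
  metric := fun y hy => by
    rw [h.metric y hy, warpedBlock_eq, warpedBlock_eq, smul_smul, mul_sub,
      mul_div_cancel₀ _ two_ne_zero, Real.exp_sub, Real.exp_log hk, div_mul_cancel₀ _ hk.ne.symm]

/-- A metric on a box which satisfies the conditions and whose fibre projection is straightened is a
warped product with fibres of Gauss curvature one. -/
theorem exists_isWarped_gaussCurvature_one (hr : 0 < r)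
    (hG : IsMetricOn G (Metric.ball c r)) (hdet : ∀ y ∈ Metric.ball c r, (G y).det < 0)
    (hstrict : ∀ y ∈ Metric.ball c r, 7 * bInv G y ^ 2 ≠ 12 * dInv G y)
    (hν : ContDiffOn ℝ ∞ ν (Metric.ball c r))
    (hc : ∀ y ∈ Metric.ball c r, SphericalConditions G ν φ y)
    (hproj : ∀ y ∈ Metric.ball c r, hProj G ν y = G y * blocks 0 0 0 1) :
    ∃ v lam s, IsWarped G (Metric.ball c r) v lam s (Metric.ball (fstPair c) r)
      (Metric.ball (sndPair c) r) ∧ (∀ z ∈ Metric.ball (fstPair c) r, (v z).det < 0) ∧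
      ∀ w ∈ Metric.ball (sndPair c) r, (s w).PosDef ∧ gaussCurvature s w = 1 := by
  have hst : IsStraightened G (hProj G ν) (Metric.ball c r) :=
    { isMetricOn := hG
      smooth := hG.smooth_hProj hν fun y hy => (hc y hy).2.2.1
      symm := fun y hy => hG.hProj_symm hy
      proj := hproj
      warpedEq := fun y hy => (hc y hy).2.2.2.2.2.1
      isClosedAt := fun y hy => (hc y hy).2.2.2.2.2.2.1 }
  obtain ⟨v, lam, s, hw, hpd⟩ := hst.exists_isWarped hr fun y hy => (hc y hy).2.2.2.2.1
  have hh : ∀ y ∈ Metric.ball c r, hProj G ν y = blocks 0 0 0 (fiberMetric lam s y) := by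
    intro y hy
    have h1 := hst.metric_eq hy
    conv_lhs at h1 => rw [hw.metric_eq' hy]
    rw [hst.tensor_eq hy, (blocks_inj h1).2.2.2]
  -- Both parameters are now forced: the nonzero fibre part of `h` excludes the wrong sign of `ν`,
  -- and the double Weyl eigenvalue is unique. Hence `κ` is given by the formula for warped
  -- products, although `φ` was not assumed to be smooth.
  have hνe : ∀ y ∈ Metric.ball c r, ν y = IsWarped.fiberNu v lam s y := fun y hy =>
    (hw.isBlockTraceless hy).nu_eq (hstrict y hy) (hc y hy).1 (hh y hy)
  have hφe : ∀ y ∈ Metric.ball c r, φ y = IsWarped.weylValue v lam s y := fun y hy =>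
    (hc y hy).2.1.unique (hw.isDoubleWeylEigenvalue hy)
  have hκ : ∀ y ∈ Metric.ball c r, kappa G ν φ y =
      Real.exp (-2 * lam (fstPair y)) * gaussCurvature s (sndPair y) := fun y hy =>
    hw.kappa_eq hy hh (hνe y hy) (hφe y hy)
  have hz₀ : fstPair c ∈ Metric.ball (fstPair c) r := Metric.mem_ball_self hr
  have hw₀ : sndPair c ∈ Metric.ball (sndPair c) r := Metric.mem_ball_self hr
  have he : ContDiffOn ℝ ∞ (fun z => Real.exp (-2 * lam z)) (Metric.ball (fstPair c) r) :=
    (contDiffOn_const.mul hw.smooth).exp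
  have hK := IsWarped.contDiffOn_gaussCurvature hw.fiber
  -- The condition `h(dκ) = 0` says that the fibre derivatives of `κ` vanish. As `λ` depends on the
  -- base only, they are `e^{-2λ}` times those of the Gauss curvature.
  have hKd : ∀ w ∈ Metric.ball (sndPair c) r, ∀ C, pd C (gaussCurvature s) w = 0 := by
    intro w hww C
    have hy := joinPair_mem_ball hr hz₀ hww
    have h1 := (hw.killsDifferential_iff hy (hh _ hy)).1 (hc _ hy).2.2.2.2.2.2.2.2 C
    rw [pd_congr_of_isOpen hw.isOpen hy hκ, pd_mul ((hw.smooth_fst he).diffAt hw.isOpen hy)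
      ((hw.smooth_snd hK).diffAt hw.isOpen hy),
      pd_ir_fst (f := fun z => Real.exp (-2 * lam z))
        (he.diffAt hw.base.isOpen (hw.mapsTo_fst hy)),
      pd_ir_snd (hK.diffAt hw.fiber.isOpen (hw.mapsTo_snd hy)), zero_mul, zero_add,
      sndPair_joinPair] at h1
    exact (mul_eq_zero.1 h1).resolve_left (Real.exp_ne_zero _)
  have hKc : ∀ w ∈ Metric.ball (sndPair c) r,
      gaussCurvature s w = gaussCurvature s (sndPair c) := fun w hww =>
    eq_of_pd_eq_zero (fun u hu => hK.diffAt Metric.isOpen_ball hu) hKd hww hw₀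
  have hkpos : 0 < gaussCurvature s (sndPair c) := by
    have h1 := (hc c (Metric.mem_ball_self hr)).2.2.2.2.2.2.2.1
    rw [hκ c (Metric.mem_ball_self hr)] at h1
    exact pos_of_mul_pos_right h1 (Real.exp_pos _).le
  refine ⟨v, _, _, hw.rescale hkpos, fun z hz => ?_, fun w hww => ⟨(hpd w hww).smul hkpos, ?_⟩⟩
  · have hy := joinPair_mem_ball hr hz hw₀
    have h1 := hdet _ hy
    rw [hw.metric_eq hy, blocks_det, Matrix.det_smul, fstPair_joinPair, sndPair_joinPair] at h1
    have h2 : 0 < Real.exp (2 * lam z) ^ Fintype.card (Fin 2) * (s (sndPair c)).det :=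
      mul_pos (pow_pos (Real.exp_pos _) _) (hpd _ hw₀).det_pos
    exact neg_of_mul_neg_left h1 h2.le
  · rw [gaussCurvature_smul hw.fiber hkpos.ne' hww, hKc w hww, inv_mul_cancel₀ hkpos.ne']

end Normalization

/-! ### Straightening a pair of complementary involutive distributions -/

section Splitting

/-- If the kernels of `Q` and `1 - Q` are involutive, then `Q` is locally conjugate to a constant
projection by a change of coordinates. -/
theorem exists_splitting {X : Type*} [NormedAddCommGroup X] [NormedSpace ℝ X]
    [FiniteDimensional ℝ X] {Q : X → X →L[ℝ] X} {U : Set X} (hU : IsOpen U)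
    (hQ : ContDiffOn ℝ ∞ Q U) (hproj : ∀ y ∈ U, Q y * Q y = Q y)
    (hker : ∀ y ∈ U, ∀ u w, Q y u = 0 → Q y w = 0 → fderiv ℝ Q y u w = fderiv ℝ Q y w u)
    (hran : ∀ y ∈ U, ∀ u w, Q y u = u → Q y w = w → fderiv ℝ Q y u w = fderiv ℝ Q y w u)
    {y₀ : X} (hy₀ : y₀ ∈ U) :
    ∃ (V : Set X) (f : X → X), IsOpen V ∧ y₀ ∈ V ∧ V ⊆ U ∧ ContDiffOn ℝ ∞ f V ∧
      fderiv ℝ f y₀ = 1 ∧ ∀ y ∈ V, ∀ w, Q y₀ (fderiv ℝ f y w) = fderiv ℝ f y (Q y w) := by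
  -- Each distribution is integrated separately: `f₁` is constant along `ker Q` with derivative
  -- valued in the range of `Q₀`, and `f₂` is constant along the range of `Q` with derivative valued
  -- in `ker Q₀`.
  obtain ⟨V₁, f₁, ho₁, hm₁, hs₁, hf₁, hk₁, hr₁, hd₁⟩ := exists_first_integral hU hQ hproj hker hy₀
  have hsub : ∀ y u, (1 - Q y) u = 0 ↔ Q y u = u := fun y u => by
    change u - Q y u = 0 ↔ _
    rw [sub_eq_zero, eq_comm]
  obtain ⟨V₂, f₂, ho₂, hm₂, hs₂, hf₂, hk₂, hr₂, hd₂⟩ := exists_first_integral (Q := fun y => 1 - Q y)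
    hU (contDiffOn_const.sub hQ)
    (fun y hy => by
      rw [mul_sub, sub_mul, sub_mul, hproj y hy]
      simp)
    (fun y hy u w hu hw => by
      rw [fderiv_const_sub]
      change -(fderiv ℝ Q y u w) = -(fderiv ℝ Q y w u)
      rw [hran y hy u w ((hsub y u).1 hu) ((hsub y w).1 hw)]) hy₀
  have hd : ∀ y ∈ V₁ ∩ V₂, fderiv ℝ (fun z => f₁ z + f₂ z) y = fderiv ℝ f₁ y + fderiv ℝ f₂ y :=
    fun y hy => fderiv_fun_add
      ((hf₁.contDiffAt (ho₁.mem_nhds hy.1)).differentiableAt (by simp))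
      ((hf₂.contDiffAt (ho₂.mem_nhds hy.2)).differentiableAt (by simp))
  -- At `y₀` the derivative of the sum is `Q₀ + (1 - Q₀) = 1`. Elsewhere the derivative of `f₁` sees
  -- only the range part of a vector and that of `f₂` only the kernel part, whence the intertwining
  -- property.
  refine ⟨V₁ ∩ V₂, fun z => f₁ z + f₂ z, ho₁.inter ho₂, ⟨hm₁, hm₂⟩, fun y hy => hs₁ hy.1,
    (hf₁.mono Set.inter_subset_left).add (hf₂.mono Set.inter_subset_right), ?_, ?_⟩
  · rw [hd y₀ ⟨hm₁, hm₂⟩, hd₁, hd₂]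
    exact add_sub_cancel _ _
  · intro y hy w
    have hQQ : ∀ u, Q y (Q y u) = Q y u := fun u =>
      congrArg (fun A : X →L[ℝ] X => A u) (hproj y (hs₁ hy.1))
    have e1 : Q y₀ (fderiv ℝ f₂ y w) = 0 := by
      have := hr₂ y hy.2 w
      change fderiv ℝ f₂ y w - Q y₀ (fderiv ℝ f₂ y w) = _ at this
      simpa using this
    have e2 : fderiv ℝ f₁ y (w - Q y w) = 0 := hk₁ y hy.1 _ (by rw [map_sub, hQQ, sub_self])
    rw [map_sub, sub_eq_zero] at e2
    rw [hd y hy, _root_.add_apply, _root_.add_apply, map_add, hr₁ y hy.1, e1,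
      hk₂ y hy.2 _ ((hsub y _).2 (hQQ w)), e2]

/-- The linear map of a matrix. -/
def mulVecCLM {n : ℕ} (A : Matrix (Fin n) (Fin n) ℝ) : (Fin n → ℝ) →L[ℝ] (Fin n → ℝ) :=
  LinearMap.toContinuousLinearMap A.mulVecLin

theorem mulVecCLM_apply {n : ℕ} (A : Matrix (Fin n) (Fin n) ℝ) (u : Fin n → ℝ) :
    mulVecCLM A u = A *ᵥ u := rfl

theorem contDiffOn_mulVecCLM {n : ℕ} {A : (Fin n → ℝ) → Matrix (Fin n) (Fin n) ℝ}
    {U : Set (Fin n → ℝ)} (hA : MatrixSmoothOn A U) :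
    ContDiffOn ℝ ∞ (fun y => mulVecCLM (A y)) U := by
  have h1 : ∀ y, mulVecCLM (A y) = ∑ a, ∑ b, A y a b • mulVecCLM (Matrix.single a b 1) := by
    intro y
    ext1 u
    simp only [_root_.sum_apply, _root_.smul_apply, mulVecCLM_apply]
    conv_lhs => rw [Matrix.matrix_eq_sum_single (A y)]
    simp only [Matrix.sum_mulVec, ← Matrix.smul_mulVec, Matrix.smul_single, smul_eq_mul, mul_one]
  simp only [h1]
  exact ContDiffOn.sum fun a _ => ContDiffOn.sum fun b _ => (hA a b).smul contDiffOn_const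

/-- The derivative of a matrix-valued function along a vector. -/
def dirDeriv {n : ℕ} (A : (Fin n → ℝ) → Matrix (Fin n) (Fin n) ℝ) (y u : Fin n → ℝ) :
    Matrix (Fin n) (Fin n) ℝ :=
  ∑ α, u α • pdMat α A y

theorem fderiv_mulVecCLM {n : ℕ} {A : (Fin n → ℝ) → Matrix (Fin n) (Fin n) ℝ}
    {U : Set (Fin n → ℝ)} (hU : IsOpen U) (hA : MatrixSmoothOn A U) {y : Fin n → ℝ} (hy : y ∈ U)
    (u w : Fin n → ℝ) :
    fderiv ℝ (fun y => mulVecCLM (A y)) y u w = dirDeriv A y u *ᵥ w := by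
  have hd : DifferentiableAt ℝ (fun y => mulVecCLM (A y)) y :=
    ((contDiffOn_mulVecCLM hA).contDiffAt (hU.mem_nhds hy)).differentiableAt (by simp)
  have h1 : HasFDerivAt (fun z => A z *ᵥ w)
      ((ContinuousLinearMap.apply ℝ (Fin n → ℝ) w).comp
        (fderiv ℝ (fun y => mulVecCLM (A y)) y)) y :=
    (ContinuousLinearMap.apply ℝ (Fin n → ℝ) w).hasFDerivAt.comp y hd.hasFDerivAt
  ext a
  have h2 := (hasFDerivAt_pi'.1 h1 a).fderiv
  have h3 := congrArg (fun B : (Fin n → ℝ) →L[ℝ] ℝ => B u) h2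
  change _ = fderiv ℝ (fun y => mulVecCLM (A y)) y u w a at h3
  rw [← h3, fderiv_eq_sum_pd]
  have h4 : ∀ α, pd α (fun z => (A z *ᵥ w) a) y = ∑ b, pdMat α A y a b * w b := by
    intro α
    simp only [Matrix.mulVec, dotProduct]
    have hdb : ∀ b, DifferentiableAt ℝ (fun z => A z a b) y := fun b => (hA a b).diffAt hU hy
    rw [pd_sum _ fun b _ => (hdb b).mul_const (w b)]
    refine Finset.sum_congr rfl fun b _ => ?_
    rw [pd_mul (hdb b) (differentiableAt_const _), pd_const, mul_zero, add_zero, pdMat_apply]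
  simp only [h4]
  simp only [dirDeriv, Matrix.mulVec, dotProduct, Matrix.sum_apply, Matrix.smul_apply,
    smul_eq_mul, Finset.sum_mul, Finset.mul_sum]
  rw [Finset.sum_comm]
  exact Finset.sum_congr rfl fun _ _ => Finset.sum_congr rfl fun _ _ => by ring

/-- Every projection of rank two in dimension four is conjugate to the standard one. -/
theorem exists_conj_blocks {T : Matrix (Fin 4) (Fin 4) ℝ} (hT : T * T = T) (ht : T.trace = 2) :
    ∃ L : (Fin 4 → ℝ) ≃L[ℝ] (Fin 4 → ℝ), ∀ u, L (T *ᵥ u) = blocks 0 0 0 1 *ᵥ L u := by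
  let f := Matrix.toLin' T
  have hff : ∀ u, f (f u) = f u := fun u => by
    simp only [f, Matrix.toLin'_apply, Matrix.mulVec_mulVec, hT]
  have hp : LinearMap.IsProj (LinearMap.range f) f :=
    ⟨fun x => LinearMap.mem_range_self f x, by rintro _ ⟨x, rfl⟩; exact hff x⟩
  -- The rank of a projection is its trace.
  have hr : Module.finrank ℝ (LinearMap.range f) = 2 := by
    have h1 := hp.trace
    rw [Matrix.trace_toLin'_eq, ht] at h1
    exact_mod_cast h1.symm
  have hk : Module.finrank ℝ (LinearMap.ker f) = 2 := by
    have h1 := LinearMap.finrank_range_add_finrank_ker f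
    rw [hr, Module.finrank_fin_fun] at h1
    omega
  let b₁ := Module.finBasisOfFinrankEq ℝ (LinearMap.ker f) hk
  let b₂ := Module.finBasisOfFinrankEq ℝ (LinearMap.range f) hr
  let E := Submodule.prodEquivOfIsCompl (LinearMap.ker f) (LinearMap.range f) hp.isCompl.symm
  let J : ((Fin 2 → ℝ) × (Fin 2 → ℝ)) ≃ₗ[ℝ] (Fin 4 → ℝ) :=
    { toFun := fun p => joinPair p.1 p.2
      invFun := fun y => (fstPair y, sndPair y)
      left_inv := fun p => by simp only [fstPair_joinPair, sndPair_joinPair]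
      right_inv := joinPair_pairs
      map_add' := fun p p' => by
        ext k
        induction k using forall_blocks <;> simp [joinPair_il, joinPair_ir]
      map_smul' := fun t p => by
        ext k
        induction k using forall_blocks <;> simp [joinPair_il, joinPair_ir] }
  let L := (E.symm.trans (b₁.equivFun.prodCongr b₂.equivFun)).trans J
  refine ⟨L.toContinuousLinearEquiv, fun u => ?_⟩
  change L (T *ᵥ u) = blocks 0 0 0 1 *ᵥ L u
  obtain ⟨⟨a, b⟩, rfl⟩ := E.surjective u
  have h1 : T *ᵥ E (a, b) = E (0, b) := by
    have e1 : f (a : Fin 4 → ℝ) = 0 := a.2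
    obtain ⟨x, hx⟩ := b.2
    have e2 : f (b : Fin 4 → ℝ) = b := by rw [← hx, hff]
    change f (E (a, b)) = E (0, b)
    rw [Submodule.coe_prodEquivOfIsCompl', Submodule.coe_prodEquivOfIsCompl']
    simp only [map_add, e1, e2, Submodule.coe_zero]
  rw [h1]
  have h2 : ∀ a b, L (E (a, b)) = joinPair (b₁.equivFun a) (b₂.equivFun b) := fun a b => by
    change J ((b₁.equivFun.prodCongr b₂.equivFun) (E.symm (E (a, b)))) = _
    rw [E.symm_apply_apply]
    rfl
  rw [h2, h2, map_zero]
  ext k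
  induction k using forall_blocks with
  | hl i => simp [Matrix.mulVec, dotProduct, sum_blocks, joinPair_il, joinPair_ir]
  | hr i => simp [Matrix.mulVec, dotProduct, sum_blocks, joinPair_il, joinPair_ir, Matrix.one_apply]

end Splitting

/-! ### Integrability of the fibre projection -/

section Integrability

variable {G H : Field4} {U : Set (Fin 4 → ℝ)} {y : Fin 4 → ℝ}

/-- The connection matrix along a vector. -/
def dirConn (G : Field4) (y u : Fin 4 → ℝ) : Matrix (Fin 4) (Fin 4) ℝ := ∑ α, u α • conn G α y

theorem IsMetricOn.dirConn_symm (hG : IsMetricOn G U) (hy : y ∈ U) (u w : Fin 4 → ℝ) :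
    dirConn G y u *ᵥ w = dirConn G y w *ᵥ u := by
  ext a
  simp only [dirConn, Matrix.mulVec, dotProduct, Matrix.sum_apply, Matrix.smul_apply, smul_eq_mul,
    Finset.sum_mul]
  rw [Finset.sum_comm]
  refine Finset.sum_congr rfl fun α _ => Finset.sum_congr rfl fun b _ => ?_
  rw [hG.conn_symm hy a b α]
  ring

/-- The endomorphism field of a covariant 2-tensor field. -/
def endo (G H : Field4) (y : Fin 4 → ℝ) : Matrix (Fin 4) (Fin 4) ℝ := (G y)⁻¹ * H y

/-- A solution of the warped product equation of constant trace whose endomorphism field is a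
projection. -/
structure IsWarpedProjection (G H : Field4) (U : Set (Fin 4 → ℝ)) : Prop where
  isMetricOn : IsMetricOn G U
  smooth : MatrixSmoothOn H U
  symm : ∀ y ∈ U, (H y)ᵀ = H y
  dot_self : ∀ y ∈ U, dot G y (H y) (H y) = H y
  trace : ∀ y ∈ U, (endo G H y).trace = 2
  warpedEq : ∀ y ∈ U, WarpedEq G H y

namespace IsWarpedProjection

theorem smooth_endo (h : IsWarpedProjection G H U) : MatrixSmoothOn (endo G H) U :=
  h.isMetricOn.smooth_inv.mul h.smooth

theorem endo_mul_endo (h : IsWarpedProjection G H U) (hy : y ∈ U) :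
    endo G H y * endo G H y = endo G H y := by
  have := h.dot_self y hy
  rw [dot] at this
  rw [endo, Matrix.mul_assoc, ← Matrix.mul_assoc (H y), this]

/-- The warped product equation with one index raised. The left-hand side is twice the covariant
derivative of the projection, written with a commutator, so that traces become accessible. -/
theorem two_smul_pdMat (h : IsWarpedProjection G H U) (hy : y ∈ U) (α : Fin 4) :
    (2 : ℝ) • (pdMat α (endo G H) y + conn G α y * endo G H y - endo G H y * conn G α y) =
      Matrix.vecMulVec ((G y)⁻¹ *ᵥ H y α) (divergence G H y)
        + Matrix.vecMulVec ((G y)⁻¹ *ᵥ divergence G H y) (H y α) := by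
  have h1 := (h.warpedEq y hy).nablaMat_eq α
  rw [h.isMetricOn.nablaMat_eq_mul h.smooth hy] at h1
  have h2 := congrArg (fun X => (G y)⁻¹ * X) h1
  simp only [Matrix.mul_smul, Matrix.nonsing_inv_mul_cancel_left _ _ (h.isMetricOn.isUnit_det hy),
    Matrix.mul_add, Matrix.mul_vecMulVec] at h2
  exact h2

/-- The trace of the projection is constant and a commutator has trace zero, while the two rank-one
terms have equal traces. So `ξ` vanishes on the range of the projection. -/
theorem divergence_dotProduct (h : IsWarpedProjection G H U) (hy : y ∈ U) (α : Fin 4) :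
    divergence G H y ⬝ᵥ (G y)⁻¹ *ᵥ H y α = 0 := by
  have h1 := congrArg Matrix.trace (h.two_smul_pdMat hy α)
  have h2 : (pdMat α (endo G H) y).trace = 0 := by
    have e1 : (pdMat α (endo G H) y).trace = pd α (fun z => (endo G H z).trace) y := by
      simp only [Matrix.trace, Matrix.diag]
      rw [pd_sum _ fun k _ => (h.smooth_endo k k).diffAt h.isMetricOn.isOpen hy]
      rfl
    rw [e1, pd_congr_of_isOpen h.isMetricOn.isOpen hy h.trace, pd_const]
  rw [Matrix.trace_smul, Matrix.trace_sub, Matrix.trace_add, h2, Matrix.trace_mul_comm, zero_add,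
    sub_self, smul_zero, Matrix.trace_add, Matrix.trace_vecMulVec, Matrix.trace_vecMulVec] at h1
  have h3 : (G y)⁻¹ *ᵥ divergence G H y ⬝ᵥ H y α = divergence G H y ⬝ᵥ (G y)⁻¹ *ᵥ H y α := by
    rw [Matrix.dotProduct_mulVec, ← Matrix.mulVec_transpose, h.isMetricOn.inv_symm hy]
  rw [dotProduct_comm, h3] at h1
  linarith

theorem sum_smul_row (h : IsWarpedProjection G H U) (hy : y ∈ U) (u : Fin 4 → ℝ) :
    ∑ α, u α • H y α = H y *ᵥ u := by
  ext b
  simp only [Finset.sum_apply, Pi.smul_apply, smul_eq_mul, Matrix.mulVec, dotProduct]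
  refine Finset.sum_congr rfl fun α _ => ?_
  rw [← congrFun (congrFun (h.symm y hy) α) b, Matrix.transpose_apply, mul_comm]

theorem divergence_endo (h : IsWarpedProjection G H U) (hy : y ∈ U) (u : Fin 4 → ℝ) :
    divergence G H y ⬝ᵥ endo G H y *ᵥ u = 0 := by
  rw [endo, ← Matrix.mulVec_mulVec, ← h.sum_smul_row hy, Matrix.mulVec_sum, dotProduct_sum]
  refine Finset.sum_eq_zero fun α _ => ?_
  rw [Matrix.mulVec_smul, dotProduct_smul, h.divergence_dotProduct hy, smul_zero]

theorem two_smul_dirDeriv (h : IsWarpedProjection G H U) (hy : y ∈ U) (u w : Fin 4 → ℝ) :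
    (2 : ℝ) • dirDeriv (endo G H) y u *ᵥ w =
      (divergence G H y ⬝ᵥ w) • endo G H y *ᵥ u + ((H y *ᵥ u) ⬝ᵥ w) • (G y)⁻¹ *ᵥ divergence G H y
        - (2 : ℝ) • dirConn G y u *ᵥ (endo G H y *ᵥ w)
        + (2 : ℝ) • endo G H y *ᵥ (dirConn G y u *ᵥ w) := by
  have h1 : (2 : ℝ) • (dirDeriv (endo G H) y u + dirConn G y u * endo G H y
      - endo G H y * dirConn G y u) =
      Matrix.vecMulVec (endo G H y *ᵥ u) (divergence G H y)
        + Matrix.vecMulVec ((G y)⁻¹ *ᵥ divergence G H y) (H y *ᵥ u) := by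
    have e1 : ∑ α, u α • ((2 : ℝ) • (pdMat α (endo G H) y + conn G α y * endo G H y
        - endo G H y * conn G α y)) = (2 : ℝ) • (dirDeriv (endo G H) y u
          + dirConn G y u * endo G H y - endo G H y * dirConn G y u) := by
      simp only [dirDeriv, dirConn, Finset.sum_mul, Finset.mul_sum, Matrix.smul_mul,
        Matrix.mul_smul, ← Finset.sum_add_distrib, ← Finset.sum_sub_distrib, ← smul_add,
        ← smul_sub, Finset.smul_sum]
      exact Finset.sum_congr rfl fun α _ => smul_comm _ _ _
    rw [← e1]
    simp only [h.two_smul_pdMat hy]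
    rw [endo, ← Matrix.mulVec_mulVec, ← h.sum_smul_row hy, Matrix.mulVec_sum]
    ext a b
    simp only [Matrix.sum_apply, Matrix.add_apply, Matrix.smul_apply, Matrix.vecMulVec_apply,
      Finset.sum_apply, Pi.smul_apply, smul_eq_mul, Finset.sum_mul, Finset.mul_sum,
      ← Finset.sum_add_distrib, Matrix.mulVec_smul]
    exact Finset.sum_congr rfl fun _ _ => by ring
  have h2 := congrArg (fun X => X *ᵥ w) h1
  simp only [Matrix.smul_mulVec, Matrix.add_mulVec, Matrix.sub_mulVec, Matrix.vecMulVec_mulVec,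
    ← Matrix.mulVec_mulVec, op_smul_eq_smul] at h2
  rw [← h2]
  module

/-- On the kernel all terms drop out except the projection of `Γ(u) w`, which is symmetric because
the connection is torsion-free. -/
theorem involutive_ker (h : IsWarpedProjection G H U) (hy : y ∈ U) {u w : Fin 4 → ℝ}
    (hu : endo G H y *ᵥ u = 0) (hw : endo G H y *ᵥ w = 0) :
    dirDeriv (endo G H) y u *ᵥ w = dirDeriv (endo G H) y w *ᵥ u := by
  have hH : ∀ u, endo G H y *ᵥ u = 0 → H y *ᵥ u = 0 := fun u hu => by
    have : G y * endo G H y = H y :=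
      Matrix.mul_nonsing_inv_cancel_left _ _ (h.isMetricOn.isUnit_det hy)
    rw [← this, ← Matrix.mulVec_mulVec, hu, Matrix.mulVec_zero]
  have h1 : (2 : ℝ) • dirDeriv (endo G H) y u *ᵥ w = (2 : ℝ) • dirDeriv (endo G H) y w *ᵥ u := by
    rw [h.two_smul_dirDeriv hy, h.two_smul_dirDeriv hy, hu, hw, hH u hu, hH w hw,
      h.isMetricOn.dirConn_symm hy u w]
    simp
  exact smul_right_injective _ two_ne_zero h1

/-- On the range `ξ` vanishes; the remaining terms are symmetric, by the symmetry of `H` and of the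
connection. -/
theorem involutive_range (h : IsWarpedProjection G H U) (hy : y ∈ U) {u w : Fin 4 → ℝ}
    (hu : endo G H y *ᵥ u = u) (hw : endo G H y *ᵥ w = w) :
    dirDeriv (endo G H) y u *ᵥ w = dirDeriv (endo G H) y w *ᵥ u := by
  have hd : ∀ u, endo G H y *ᵥ u = u → divergence G H y ⬝ᵥ u = 0 := fun u hu => by
    rw [← hu, h.divergence_endo hy]
  have h1 : (2 : ℝ) • dirDeriv (endo G H) y u *ᵥ w = (2 : ℝ) • dirDeriv (endo G H) y w *ᵥ u := by
    rw [h.two_smul_dirDeriv hy, h.two_smul_dirDeriv hy, hu, hw, hd u hu, hd w hw,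
      h.isMetricOn.dirConn_symm hy u w, zero_smul, zero_smul]
    congr 4
    rw [dotProduct_comm, Matrix.dotProduct_mulVec, ← Matrix.mulVec_transpose, h.symm y hy]
  exact smul_right_injective _ two_ne_zero h1

/-- Coordinates in which the fibre projection is the projection onto the last two coordinates. -/
theorem exists_straightening (h : IsWarpedProjection G H U) (hy : y ∈ U) :
    ∃ (V : Set (Fin 4 → ℝ)) (f : (Fin 4 → ℝ) → Fin 4 → ℝ) (L : (Fin 4 → ℝ) ≃L[ℝ] (Fin 4 → ℝ)),
      IsOpen V ∧ y ∈ V ∧ V ⊆ U ∧ ContDiffOn ℝ ∞ f V ∧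
      HasFDerivAt f (L : (Fin 4 → ℝ) →L[ℝ] (Fin 4 → ℝ)) y ∧
      ∀ z ∈ V, ∀ w, fderiv ℝ f z (endo G H z *ᵥ w) = blocks 0 0 0 1 *ᵥ fderiv ℝ f z w := by
  have ho := h.isMetricOn.isOpen
  obtain ⟨V, f, hV, hyV, hVU, hf, hfy, hfd⟩ := exists_splitting (Q := fun z => mulVecCLM (endo G H z))
    ho (contDiffOn_mulVecCLM h.smooth_endo)
    (fun z hz => by
      ext1 u
      change endo G H z *ᵥ (endo G H z *ᵥ u) = endo G H z *ᵥ u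
      rw [Matrix.mulVec_mulVec, h.endo_mul_endo hz])
    (fun z hz u w hu hw => by
      rw [fderiv_mulVecCLM ho h.smooth_endo hz, fderiv_mulVecCLM ho h.smooth_endo hz]
      exact h.involutive_ker hz hu hw)
    (fun z hz u w hu hw => by
      rw [fderiv_mulVecCLM ho h.smooth_endo hz, fderiv_mulVecCLM ho h.smooth_endo hz]
      exact h.involutive_range hz hu hw) hy
  -- The splitting conjugates the field to its value at `y`; a linear change of coordinates takes
  -- this projection to the standard one.
  obtain ⟨L, hL⟩ := exists_conj_blocks (h.endo_mul_endo hy) (h.trace y hy)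
  have hd : ∀ z ∈ V, DifferentiableAt ℝ f z := fun z hz =>
    (hf.contDiffAt (hV.mem_nhds hz)).differentiableAt (by simp)
  have hLd : ∀ z ∈ V, HasFDerivAt (fun z => L (f z))
      ((L : (Fin 4 → ℝ) →L[ℝ] (Fin 4 → ℝ)).comp (fderiv ℝ f z)) z := fun z hz =>
    L.hasFDerivAt.comp z (hd z hz).hasFDerivAt
  refine ⟨V, fun z => L (f z), L, hV, hyV, hVU, L.contDiff.comp_contDiffOn hf, ?_, ?_⟩
  · have := hLd y hyV
    rw [hfy] at this
    exact this
  · intro z hz w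
    rw [(hLd z hz).fderiv]
    change L (fderiv ℝ f z (endo G H z *ᵥ w)) = _ *ᵥ L (fderiv ℝ f z w)
    have := hfd z hz w
    rw [mulVecCLM_apply, mulVecCLM_apply] at this
    rw [← this, hL]

end IsWarpedProjection

end Integrability

/-! ### The conditions imply spherical symmetry -/

section Backward

theorem fderiv_eq_jac_mulVec {n : ℕ} {ψ : (Fin n → ℝ) → Fin n → ℝ} {y : Fin n → ℝ}
    (hψ : DifferentiableAt ℝ ψ y) (w : Fin n → ℝ) : fderiv ℝ ψ y w = jac ψ y *ᵥ w := by
  ext a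
  have h1 := congrArg (fun B : (Fin n → ℝ) →L[ℝ] ℝ => B w)
    (hasFDerivAt_pi'.1 hψ.hasFDerivAt a).fderiv
  change _ = fderiv ℝ ψ y w a at h1
  rw [← h1, fderiv_eq_sum_pd]
  simp only [Matrix.mulVec, dotProduct, jac, Matrix.of_apply]
  exact Finset.sum_congr rfl fun _ _ => mul_comm _ _

variable {M : Type*} [TopologicalSpace M] [ChartedSpace (Fin 4 → ℝ) M]

theorem contDiffOn_comp_symm {e : OpenPartialHomeomorph M (Fin 4 → ℝ)}
    (he : e ∈ IsManifold.maximalAtlas 𝓘(ℝ, Fin 4 → ℝ) ∞ M) {ν : M → ℝ}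
    (hν : ContMDiff 𝓘(ℝ, Fin 4 → ℝ) 𝓘(ℝ, ℝ) ∞ ν) : ContDiffOn ℝ ∞ (ν ∘ e.symm) e.target := by
  rw [← contMDiffOn_iff_contDiffOn]
  exact hν.comp_contMDiffOn (contMDiffOn_symm_of_mem_maximalAtlas he)

variable [IsManifold 𝓘(ℝ, Fin 4 → ℝ) ∞ M]

/-- A local diffeomorphism yields a chart with values in a box. -/
theorem exists_box_chart {e : OpenPartialHomeomorph M (Fin 4 → ℝ)}
    (he : e ∈ IsManifold.maximalAtlas 𝓘(ℝ, Fin 4 → ℝ) ∞ M) {p : M} (hp : p ∈ e.source)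
    {V : Set (Fin 4 → ℝ)} (hV : IsOpen V) (hpV : e p ∈ V) (hVe : V ⊆ e.target)
    {f : (Fin 4 → ℝ) → Fin 4 → ℝ} (hf : ContDiffOn ℝ ∞ f V)
    {L : (Fin 4 → ℝ) ≃L[ℝ] (Fin 4 → ℝ)}
    (hL : HasFDerivAt f (L : (Fin 4 → ℝ) →L[ℝ] (Fin 4 → ℝ)) (e p)) :
    ∃ e' ∈ IsManifold.maximalAtlas 𝓘(ℝ, Fin 4 → ℝ) ∞ M, ∃ (c : Fin 4 → ℝ) (r : ℝ), p ∈ e'.source ∧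
      0 < r ∧ e'.target = Metric.ball c r ∧ e'.source ⊆ e.source ∧
      ∀ q ∈ e'.source, e q ∈ V ∧ e' q = f (e q) := by
  obtain ⟨e₁, hpe, heV, hef, hes, -⟩ := exists_smooth_openPartialHomeomorph hV hf hpV hL
  -- The image is shrunk to a ball of the sup norm, because the integration to a warped product
  -- needs a box.
  obtain ⟨r, hr, hball⟩ := Metric.isOpen_iff.1 e₁.open_target (e₁ (e p)) (e₁.map_source hpe)
  let e₂ := (e₁.symm.restrOpen (Metric.ball (e₁ (e p)) r) Metric.isOpen_ball).symm
  have hsrc : ∀ z, z ∈ e₂.source ↔ z ∈ e₁.source ∧ e₁ z ∈ Metric.ball (e₁ (e p)) r := fun z =>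
    Iff.rfl
  have htgt : ∀ z, z ∈ e₂.target ↔ z ∈ Metric.ball (e₁ (e p)) r := fun z =>
    ⟨fun h => h.2, fun h => ⟨hball h, h⟩⟩
  have hmem : ∀ q ∈ (e.trans e₂).source, q ∈ e.source ∧ e q ∈ V := fun q hq => by
    rw [OpenPartialHomeomorph.trans_source] at hq
    exact ⟨hq.1, heV ((hsrc _).1 hq.2).1⟩
  refine ⟨e.trans e₂, ?_, e₁ (e p), r, ?_, hr, ?_, fun q hq => (hmem q hq).1,
    fun q hq => ⟨(hmem q hq).2, hef _⟩⟩
  · refine OpenPartialHomeomorph.mem_maximalAtlas_of_contMDiffOn _ ?_ ?_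
    · have h1 : ContMDiffOn 𝓘(ℝ, Fin 4 → ℝ) 𝓘(ℝ, Fin 4 → ℝ) ∞ (f ∘ e) (e.trans e₂).source :=
        (contMDiffOn_iff_contDiffOn.2 hf).comp
          ((contMDiffOn_of_mem_maximalAtlas he).mono fun q hq => (hmem q hq).1)
          fun q hq => (hmem q hq).2
      exact h1.congr fun q _ => hef _
    · exact (contMDiffOn_symm_of_mem_maximalAtlas he).comp
        ((contMDiffOn_iff_contDiffOn.2 hes).mono fun z hz => by
          rw [OpenPartialHomeomorph.trans_target] at hz
          exact hball ((htgt z).1 hz.1))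
        fun z hz => by
          rw [OpenPartialHomeomorph.trans_target] at hz
          exact hz.2
  · rw [OpenPartialHomeomorph.trans_source]
    exact ⟨hp, (hsrc _).2 ⟨hpe, Metric.mem_ball_self hr⟩⟩
  · rw [OpenPartialHomeomorph.trans_target]
    ext z
    refine ⟨fun h => (htgt z).1 h.1, fun h => ⟨(htgt z).2 h, ?_⟩⟩
    exact hVe (heV (e₁.map_target (hball h)))

/-- A metric which satisfies the conditions for some `ν` and `φ` is spherically symmetric. -/
theorem LorentzMetric.isSphericallySymmetric_of_sphericalConditions (g : LorentzMetric M)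
    (hstrict : ∀ e ∈ IsManifold.maximalAtlas 𝓘(ℝ, Fin 4 → ℝ) ∞ M, ∀ y ∈ e.target,
      7 * bInv (components g.toFun e) y ^ 2 ≠ 12 * dInv (components g.toFun e) y)
    {ν φ : M → ℝ} (hν : ContMDiff 𝓘(ℝ, Fin 4 → ℝ) 𝓘(ℝ, ℝ) ∞ ν)
    (hc : ∀ e ∈ IsManifold.maximalAtlas 𝓘(ℝ, Fin 4 → ℝ) ∞ M, ∀ y ∈ e.target,
      SphericalConditions (components g.toFun e) (ν ∘ e.symm) (φ ∘ e.symm) y) :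
    g.IsSphericallySymmetric := by
  intro p
  let e := chartAt (Fin 4 → ℝ) p
  have he : e ∈ IsManifold.maximalAtlas 𝓘(ℝ, Fin 4 → ℝ) ∞ M := IsManifold.chart_mem_maximalAtlas p
  have hp : p ∈ e.source := mem_chart_source _ p
  have hG := g.isMetricOn he
  have hW : IsWarpedProjection (components g.toFun e) (hProj (components g.toFun e) (ν ∘ e.symm))
      e.target :=
    { isMetricOn := hG
      smooth := hG.smooth_hProj (contDiffOn_comp_symm he hν) fun y hy => (hc e he y hy).2.2.1
      symm := fun y hy => hG.hProj_symm hy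
      dot_self := fun y hy => (hc e he y hy).2.2.2.1
      trace := fun y hy => tr_hProj (hc e he y hy).2.2.1
      warpedEq := fun y hy => (hc e he y hy).2.2.2.2.2.1 }
  obtain ⟨V, f, L, hV, hpV, hVe, hf, hL, hfd⟩ := hW.exists_straightening (e.map_source hp)
  obtain ⟨e', he', c, r, hpe', hr, htgt, hsub, hef⟩ := exists_box_chart he hp hV hpV hVe hf hL
  have hG' := g.isMetricOn he'
  -- The straightening was obtained for the endomorphism field in the chart `e`. The transition map
  -- to `e'` coincides locally with `f`, so its Jacobian conjugates the field to the standard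
  -- projection, and covariance of `hProj` turns this into a statement in `e'`.
  have hproj : ∀ y ∈ e'.target, hProj (components g.toFun e') (ν ∘ e'.symm) y =
      components g.toFun e' y * blocks 0 0 0 1 := by
    intro y hy
    let q := e'.symm y
    have hq : q ∈ e'.source := e'.map_target hy
    have hqe : e.symm (e q) = q := e.left_inv (hsub hq)
    have hz : e q ∈ overlap e e' := ⟨e.map_source (hsub hq), by
      change e.symm (e q) ∈ e'.source
      rwa [hqe]⟩
    have hpb := g.isPullback he he'
    have hψ : (e' ∘ e.symm) (e q) = y := by
      rw [Function.comp_apply, hqe, e'.right_inv hy]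
    have hfψ : e' ∘ e.symm =ᶠ[𝓝 (e q)] f := by
      filter_upwards [(isOpen_overlap e e').mem_nhds hz] with z hz
      rw [Function.comp_apply, (hef _ hz.2).2, e.right_inv hz.1]
    have hJ := hpb.isUnit_jac hz
    have hJT : IsUnit (jac (e' ∘ e.symm) (e q))ᵀ.det := by rwa [Matrix.det_transpose]
    have h1 : jac (e' ∘ e.symm) (e q) * endo (components g.toFun e)
        (hProj (components g.toFun e) (ν ∘ e.symm)) (e q) =
        blocks 0 0 0 1 * jac (e' ∘ e.symm) (e q) := by
      refine Matrix.ext_of_mulVec_single fun i => ?_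
      have h2 := hfd (e q) (hef q hq).1 (Pi.single i 1)
      rw [← hfψ.fderiv_eq, fderiv_eq_jac_mulVec (hpb.differentiableAt hz),
        fderiv_eq_jac_mulVec (hpb.differentiableAt hz)] at h2
      rw [← Matrix.mulVec_mulVec, h2, Matrix.mulVec_mulVec]
    have h3 : ∀ z ∈ overlap e e', (ν ∘ e.symm) z = (ν ∘ e'.symm) ((e' ∘ e.symm) z) := fun z hz =>
      congrArg ν (e'.left_inv hz.2).symm
    rw [endo, hpb.hProj_eq hz (h3 _ hz), hpb.inv_metric hz, Matrix.transpose_nonsing_inv, hψ] at h1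
    set J := jac (e' ∘ e.symm) (e q) with hJdef
    simp only [Matrix.mul_assoc] at h1
    rw [Matrix.nonsing_inv_mul_cancel_left _ _ hJT, Matrix.mul_nonsing_inv_cancel_left _ _ hJ,
      ← Matrix.mul_assoc] at h1
    have h4 := congrArg (fun X => X * J⁻¹) h1
    simp only [Matrix.mul_nonsing_inv_cancel_right _ _ hJ] at h4
    rw [← h4, Matrix.mul_nonsing_inv_cancel_left _ _ (hG'.isUnit_det hy)]
  obtain ⟨v, lam, s, hw, hvd, hsd⟩ := exists_isWarped_gaussCurvature_one hr (htgt ▸ hG')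
    (fun y hy => g.det_components_neg he' (htgt ▸ hy)) (fun y hy => hstrict e' he' y (htgt ▸ hy))
    (htgt ▸ contDiffOn_comp_symm he' hν) (fun y hy => hc e' he' y (htgt ▸ hy))
    (fun y hy => hproj y (htgt ▸ hy))
  have h1 : fstPair '' e'.target ⊆ Metric.ball (fstPair c) r := by
    rw [htgt]
    exact hw.mapsTo_fst.image_subset
  have h2 : sndPair '' e'.target ⊆ Metric.ball (sndPair c) r := by
    rw [htgt]
    exact hw.mapsTo_snd.image_subset
  exact ⟨e', he', hpe', v, lam, s, hw.base.smooth.mono h1, hw.smooth.mono h1,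
    hw.fiber.smooth.mono h2, fun z hz => ⟨hw.base.symm z (h1 hz), hvd z (h1 hz)⟩,
    fun z hz => hsd z (h2 hz), fun y hy => hw.metric y (htgt ▸ hy)⟩

end Backward

end RicciSph

end

open RicciSph
theorem theorem2 {M : Type*} [TopologicalSpace M] [ChartedSpace (Fin 4 → ℝ) M]
    [IsManifold 𝓘(ℝ, Fin 4 → ℝ) ∞ M] (g : LorentzMetric M)
    (hstrict : ∀ e ∈ IsManifold.maximalAtlas 𝓘(ℝ, Fin 4 → ℝ) ∞ M, ∀ y ∈ e.target,
      7 * bInv (components g.toFun e) y ^ 2 ≠ 12 * dInv (components g.toFun e) y) :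
    g.IsSphericallySymmetric ↔
      ∃ ν φ : M → ℝ, ContMDiff 𝓘(ℝ, Fin 4 → ℝ) 𝓘(ℝ, ℝ) ∞ ν ∧
        ∀ e ∈ IsManifold.maximalAtlas 𝓘(ℝ, Fin 4 → ℝ) ∞ M, ∀ y ∈ e.target,
          let G : Field4 := components g.toFun e
          let h : Field4 := hProj G (ν ∘ e.symm)
          let κ : (Fin 4 → ℝ) → ℝ := kappa G (ν ∘ e.symm) (φ ∘ e.symm)
          IsNu (bInv G y) (cInv G y) (dInv G y) (ν (e.symm y)) ∧
          IsDoubleWeylEigenvalue G y (φ (e.symm y)) ∧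
          tr G y (P G (ν ∘ e.symm) y) ≠ 0 ∧
          dot G y (h y) (h y) = h y ∧
          IsSpaceLike G h y ∧
          WarpedEq G h y ∧
          IsClosedAt (divergence G h) y ∧
          0 < κ y ∧
          KillsDifferential G h κ y := by
  constructor
  · intro h
    exact h.exists_sphericalConditions hstrict
  · rintro ⟨ν, φ, hν, hc⟩
    exact g.isSphericallySymmetric_of_sphericalConditions hstrict hν hc
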